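/- Work over the field $\mathbb{Q}$ with homologically graded, possibly unbounded, complexes and the Koszul sign rule. Let $C$ be a (counital, coassociative, non-negatively graded) graded-cocommutative dg coalgebra which is $2$-reduced, i.e. $C_0=\mathbb{Q}$ and $C_1=0$, with its canonical coaugmentation $\mathbb{Q}\to C$ and $\overline{C}=\operatorname{coker}(\mathbb{Q}\to C)$. Write $\Delta c = c_{(0)}\otimes c_{(1)}$, and write the coaction of a left comodule as $n\mapsto n_{(0)}\otimes n_{(1)}$. The cobar construction $\Omega C$ is the dg algebra whose underlying algebra is the tensor algebra on symbols $tc$ (linear in $c\in\overline{C}$) of degree $|tc|=|c|-1$, with the derivation differential determined by $$d(tc)=-t(dc)-(-1)^{|c_{(0)}|}\,tc_{(0)}\cdot tc_{(1)} .$$ Let $\Omega C\text{-}\mathrm{Mod}$ be the category of unbounded left dg $\Omega C$-modules and $C\text{-}\mathrm{Comod}$ the category of unbounded left dg $C$-comodules. For a comodule $N$ let $t^!N$ be the graded $\Omega C$-module $\Omega C\otimes N$ with differential $$d(a\otimes n)=da\otimes n+(-1)^{|a|}a\otimes dn-(-1)^{|a|}a\cdot tn_{(0)}\otimes n_{(1)},$$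 and for a module $M$ let $t_*M$ be the cofree graded $C$-comodule $C\otimes M$ with differential $$d(c\otimes m)=dc\otimes m+(-1)^{|c|}c\otimes dm+(-1)^{|c_{(0)}|}c_{(0)}\otimes tc_{(1)}\cdot m .$$ These define functors and an adjunction $t^!\colon C\text{-}\mathrm{Comod}\rightleftarrows \Omega C\text{-}\mathrm{Mod}\colon t_*$ (with $t^!$ left adjoint), under which $f\colon t^!N\to M$ corresponds to $n\mapsto n_{(0)}\otimes f(1\otimes n_{(1)})$. A morphism $f$ of comodules is called a $t$-equivalence if $t^!f$ is a quasi-isomorphism. Equip $\Omega C\text{-}\mathrm{Mod}$ with the projective model structure, i.e. the model structure whose weak equivalences are the quasi-isomorphisms and whose fibrations are the degreewise epimorphisms. Then there is a combinatorial model structure on $C\text{-}\mathrm{Comod}$ (the $t$-local model structure), left-induced along $t^!$ (a morphism $f$ is a weak equivalence, respectively a cofibration, if and only if $t^!f$ is one), such that 1. the weak equivalences are the $t$-equivalences; 2. the cofibrations are the monomorphisms; 3. with respect to these model structures, the adjunction $t^!\dashv t_*$ is a Quillen equivalence. -/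

import Mathlib

open scoped TensorProduct
open CategoryTheory HomotopicalAlgebra

universe u

namespace DGKoszul

noncomputable section

section Graded

variable {V W X : Type*} [AddCommGroup V] [Module ℚ V] [AddCommGroup W] [Module ℚ W]
  [AddCommGroup X] [Module ℚ X]

/-- The linear map out of `V = ⨁ₙ 𝒱 n` with prescribed restrictions to the summands. -/
def gradedLift (𝒱 : ℤ → Submodule ℚ V) (h : DirectSum.IsInternal 𝒱)
    (f : (n : ℤ) → 𝒱 n →ₗ[ℚ] W) : V →ₗ[ℚ] W :=
  DirectSum.toModule ℚ ℤ W f ∘ₗ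
    (LinearEquiv.ofBijective (DirectSum.coeLinearMap 𝒱) h).symm.toLinearMap

theorem gradedLift_of_mem (𝒱 : ℤ → Submodule ℚ V) (h : DirectSum.IsInternal 𝒱)
    (f : (n : ℤ) → 𝒱 n →ₗ[ℚ] W) {n : ℤ} {x : V} (hx : x ∈ 𝒱 n) :
    gradedLift 𝒱 h f x = f n ⟨x, hx⟩ := by
  have : (LinearEquiv.ofBijective (DirectSum.coeLinearMap 𝒱) h).symm x =
      DirectSum.lof ℚ ℤ (fun n => 𝒱 n) n ⟨x, hx⟩ := by
    rw [LinearEquiv.symm_apply_eq]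
    exact (DirectSum.coeLinearMap_lof 𝒱 n ⟨x, hx⟩).symm
  simp [gradedLift, this]

theorem graded_ext {𝒱 : ℤ → Submodule ℚ V} (h : ⨆ n, 𝒱 n = ⊤) {f g : V →ₗ[ℚ] W}
    (hfg : ∀ n, ∀ x ∈ 𝒱 n, f x = g x) : f = g := by
  have : ⨆ n, 𝒱 n ≤ LinearMap.eqLocus f g := iSup_le fun n x hx => hfg n x hx
  ext x
  exact this (h ▸ Submodule.mem_top)

theorem isInternal_of_detect (𝒱 : ℤ → Submodule ℚ V) (δ : V →ₗ[ℚ] (ℤ →₀ V))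
    (hδ : ∀ n, ∀ x ∈ 𝒱 n, δ x = Finsupp.single n x) (htop : ⨆ n, 𝒱 n = ⊤) :
    DirectSum.IsInternal 𝒱 := by
  refine ⟨?_, ?_⟩
  · have key : ∀ z : DirectSum ℤ (fun n => 𝒱 n), ∀ n,
        δ (DirectSum.coeLinearMap 𝒱 z) n = (z n : V) := by
      intro z n
      induction z using DirectSum.induction_on with
      | zero => simp
      | of i x =>
        rw [DirectSum.coeLinearMap_of, hδ i x x.2]
        by_cases hin : i = n
        · subst hin; simp
        · rw [Finsupp.single_eq_of_ne (Ne.symm hin), DirectSum.of_eq_of_ne _ _ _ (Ne.symm hin)]; simp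
      | add x y hx hy => simp [hx, hy]
    intro z z' hz
    ext n
    rw [← key z n, ← key z' n]
    exact congrArg (fun v => δ v n) hz
  · change Function.Surjective (DirectSum.coeLinearMap 𝒱)
    rw [← LinearMap.range_eq_top, DirectSum.range_coeLinearMap, htop]

/-- The Koszul sign operator `x ↦ (-1)^|x| x`. -/
def signMap (𝒱 : ℤ → Submodule ℚ V) (h : DirectSum.IsInternal 𝒱) : V →ₗ[ℚ] V :=
  gradedLift 𝒱 h fun n => (n.negOnePow : ℤˣ) • (𝒱 n).subtype

theorem signMap_of_mem {𝒱 : ℤ → Submodule ℚ V} (h : DirectSum.IsInternal 𝒱) {n : ℤ} {x : V}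
    (hx : x ∈ 𝒱 n) : signMap 𝒱 h x = n.negOnePow • x := by
  rw [signMap, gradedLift_of_mem 𝒱 h _ hx]
  rfl

theorem map_negOnePow_smul (f : V →ₗ[ℚ] W) (n : ℤ) (x : V) :
    f (n.negOnePow • x) = n.negOnePow • f x := by
  rcases Int.units_eq_one_or n.negOnePow with h | h <;> simp [h]

theorem signMap_signMap {𝒱 : ℤ → Submodule ℚ V} (h : DirectSum.IsInternal 𝒱) (x : V) :
    signMap 𝒱 h (signMap 𝒱 h x) = x := by
  have : signMap 𝒱 h ∘ₗ signMap 𝒱 h = LinearMap.id := by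
    refine graded_ext h.submodule_iSup_eq_top fun n x hx => ?_
    rw [LinearMap.comp_apply, signMap_of_mem h hx, map_negOnePow_smul, signMap_of_mem h hx,
      smul_smul]
    simp
  exact LinearMap.congr_fun this x

theorem signMap_mem {𝒱 : ℤ → Submodule ℚ V} (h : DirectSum.IsInternal 𝒱) {n : ℤ} {x : V}
    (hx : x ∈ 𝒱 n) : signMap 𝒱 h x ∈ 𝒱 n := by
  rw [signMap_of_mem h hx]
  rcases Int.units_eq_one_or n.negOnePow with h | h <;> simp [h, hx]

/-- Linear maps of degree `0` commute with the sign operators. -/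
theorem map_signMap {𝒱 : ℤ → Submodule ℚ V} (h : DirectSum.IsInternal 𝒱)
    {𝒲 : ℤ → Submodule ℚ W} (h' : DirectSum.IsInternal 𝒲) (f : V →ₗ[ℚ] W)
    (hf : ∀ n, ∀ x ∈ 𝒱 n, f x ∈ 𝒲 n) (x : V) :
    f (signMap 𝒱 h x) = signMap 𝒲 h' (f x) := by
  have : f ∘ₗ signMap 𝒱 h = signMap 𝒲 h' ∘ₗ f := by
    refine graded_ext h.submodule_iSup_eq_top fun n x hx => ?_
    rw [LinearMap.comp_apply, LinearMap.comp_apply, signMap_of_mem h hx, map_negOnePow_smul,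
      signMap_of_mem h' (hf n x hx)]
  exact LinearMap.congr_fun this x

/-- Linear maps of degree `-1` anticommute with the sign operators. -/
theorem map_signMap_neg {𝒱 : ℤ → Submodule ℚ V} (h : DirectSum.IsInternal 𝒱)
    {𝒲 : ℤ → Submodule ℚ W} (h' : DirectSum.IsInternal 𝒲) (f : V →ₗ[ℚ] W)
    (hf : ∀ n, ∀ x ∈ 𝒱 n, f x ∈ 𝒲 (n - 1)) (x : V) :
    f (signMap 𝒱 h x) = - signMap 𝒲 h' (f x) := by
  have : f ∘ₗ signMap 𝒱 h = - (signMap 𝒲 h' ∘ₗ f) := by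
    refine graded_ext h.submodule_iSup_eq_top fun n x hx => ?_
    rw [LinearMap.neg_apply, LinearMap.comp_apply, LinearMap.comp_apply, signMap_of_mem h hx,
      map_negOnePow_smul, signMap_of_mem h' (hf n x hx), Int.negOnePow_sub, Int.negOnePow_one]
    simp
  exact LinearMap.congr_fun this x

/-- The grading of a tensor product: `(V ⊗ W)_n` is spanned by the `x ⊗ y` with
`|x| + |y| = n`. -/
def tensorGr (𝒱 : ℤ → Submodule ℚ V) (𝒲 : ℤ → Submodule ℚ W) (n : ℤ) :
    Submodule ℚ (V ⊗[ℚ] W) :=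
  Submodule.span ℚ {z | ∃ i j : ℤ, i + j = n ∧ ∃ x ∈ 𝒱 i, ∃ y ∈ 𝒲 j, x ⊗ₜ[ℚ] y = z}

theorem tmul_mem_tensorGr {𝒱 : ℤ → Submodule ℚ V} {𝒲 : ℤ → Submodule ℚ W} {i j n : ℤ} {x : V}
    {y : W} (hx : x ∈ 𝒱 i) (hy : y ∈ 𝒲 j) (hn : i + j = n) : x ⊗ₜ[ℚ] y ∈ tensorGr 𝒱 𝒲 n :=
  Submodule.subset_span ⟨i, j, hn, x, hx, y, hy, rfl⟩

theorem map_mem_of_tensorGr {𝒱 : ℤ → Submodule ℚ V} {𝒲 : ℤ → Submodule ℚ W} {n : ℤ}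
    (f : V ⊗[ℚ] W →ₗ[ℚ] X) (S : Submodule ℚ X)
    (h : ∀ i j, i + j = n → ∀ x ∈ 𝒱 i, ∀ y ∈ 𝒲 j, f (x ⊗ₜ y) ∈ S)
    {z : V ⊗[ℚ] W} (hz : z ∈ tensorGr 𝒱 𝒲 n) : f z ∈ S := by
  have : tensorGr 𝒱 𝒲 n ≤ S.comap f := by
    refine Submodule.span_le.2 ?_
    rintro _ ⟨i, j, hn, x, hx, y, hy, rfl⟩
    exact h i j hn x hx y hy
  exact this hz

theorem iSup_tensorGr {𝒱 : ℤ → Submodule ℚ V} {𝒲 : ℤ → Submodule ℚ W}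
    (h : ⨆ n, 𝒱 n = ⊤) (h' : ⨆ n, 𝒲 n = ⊤) : ⨆ n, tensorGr 𝒱 𝒲 n = ⊤ := by
  have h1 : ∀ x : V, ∀ y : W, x ⊗ₜ[ℚ] y ∈ ⨆ n, tensorGr 𝒱 𝒲 n := by
    intro x y
    have hx : x ∈ ⨆ n, 𝒱 n := h ▸ Submodule.mem_top
    have hy : y ∈ ⨆ n, 𝒲 n := h' ▸ Submodule.mem_top
    induction hx using Submodule.iSup_induction' with
    | mem i x hx =>
      induction hy using Submodule.iSup_induction' with
      | mem j y hy => exact Submodule.mem_iSup_of_mem (i + j) (tmul_mem_tensorGr hx hy rfl)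
      | zero => simp
      | add y y' _ _ hy hy' => rw [TensorProduct.tmul_add]; exact add_mem hy hy'
    | zero => simp
    | add x x' _ _ hx hx' => rw [TensorProduct.add_tmul]; exact add_mem hx hx'
  rw [eq_top_iff]
  rintro z -
  induction z with
  | zero => simp
  | tmul x y => exact h1 x y
  | add x y hx hy => exact add_mem hx hy

theorem isInternal_tensorGr {𝒱 : ℤ → Submodule ℚ V} {𝒲 : ℤ → Submodule ℚ W}
    (h : DirectSum.IsInternal 𝒱) (h' : DirectSum.IsInternal 𝒲) :
    DirectSum.IsInternal (tensorGr 𝒱 𝒲) := by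
  let δV : V →ₗ[ℚ] (ℤ →₀ V) := gradedLift 𝒱 h fun n => Finsupp.lsingle n ∘ₗ (𝒱 n).subtype
  let δW : W →ₗ[ℚ] (ℤ →₀ W) := gradedLift 𝒲 h' fun n => Finsupp.lsingle n ∘ₗ (𝒲 n).subtype
  refine isInternal_of_detect _
    (Finsupp.lmapDomain (V ⊗[ℚ] W) ℚ (fun p : ℤ × ℤ => p.1 + p.2) ∘ₗ
      (finsuppTensorFinsupp ℚ ℚ V W ℤ ℤ).toLinearMap ∘ₗ TensorProduct.map δV δW) ?_
    (iSup_tensorGr h.submodule_iSup_eq_top h'.submodule_iSup_eq_top)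
  intro n z hz
  have : tensorGr 𝒱 𝒲 n ≤ LinearMap.eqLocus
      (Finsupp.lmapDomain (V ⊗[ℚ] W) ℚ (fun p : ℤ × ℤ => p.1 + p.2) ∘ₗ
      (finsuppTensorFinsupp ℚ ℚ V W ℤ ℤ).toLinearMap ∘ₗ TensorProduct.map δV δW)
      (Finsupp.lsingle n) := by
    refine Submodule.span_le.2 ?_
    rintro _ ⟨i, j, hn, x, hx, y, hy, rfl⟩
    have hx' : δV x = Finsupp.single i x := gradedLift_of_mem 𝒱 h _ hx
    have hy' : δW y = Finsupp.single j y := gradedLift_of_mem 𝒲 h' _ hy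
    simp [hx', hy', Finsupp.mapDomain_single, hn]
  exact this hz

theorem tensor_signMap {𝒱 : ℤ → Submodule ℚ V} {𝒲 : ℤ → Submodule ℚ W}
    (h : DirectSum.IsInternal 𝒱) (h' : DirectSum.IsInternal 𝒲) (z : V ⊗[ℚ] W) :
    signMap (tensorGr 𝒱 𝒲) (isInternal_tensorGr h h') z =
      TensorProduct.map (signMap 𝒱 h) (signMap 𝒲 h') z := by
  have : signMap (tensorGr 𝒱 𝒲) (isInternal_tensorGr h h') =
      TensorProduct.map (signMap 𝒱 h) (signMap 𝒲 h') := by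
    refine graded_ext (isInternal_tensorGr h h').submodule_iSup_eq_top fun n z hz => ?_
    rw [signMap_of_mem _ hz]
    have : tensorGr 𝒱 𝒲 n ≤ LinearMap.eqLocus (n.negOnePow • LinearMap.id)
        (TensorProduct.map (signMap 𝒱 h) (signMap 𝒲 h')) := by
      refine Submodule.span_le.2 ?_
      rintro _ ⟨i, j, hn, x, hx, y, hy, rfl⟩
      subst hn
      change (i + j).negOnePow • (x ⊗ₜ[ℚ] y) = TensorProduct.map _ _ (x ⊗ₜ[ℚ] y)
      rw [TensorProduct.map_tmul, signMap_of_mem h hx, signMap_of_mem h' hy, Int.negOnePow_add]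
      rcases Int.units_eq_one_or i.negOnePow with h1 | h1 <;>
        rcases Int.units_eq_one_or j.negOnePow with h2 | h2 <;>
        simp [h1, h2, TensorProduct.neg_tmul, TensorProduct.tmul_neg]
    exact this hz
  exact LinearMap.congr_fun this z

/-- The symmetry `x ⊗ y ↦ (-1)^(|x||y|) y ⊗ x` of the tensor product of graded vector spaces. -/
def koszulSwap (𝒱 : ℤ → Submodule ℚ V) (h : DirectSum.IsInternal 𝒱)
    (𝒲 : ℤ → Submodule ℚ W) (h' : DirectSum.IsInternal 𝒲) : V ⊗[ℚ] W →ₗ[ℚ] W ⊗[ℚ] V :=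
  TensorProduct.lift <| gradedLift 𝒱 h fun p =>
    (LinearMap.lcomp ℚ (W ⊗[ℚ] V)
      (if Even p then LinearMap.id else signMap 𝒲 h' : W →ₗ[ℚ] W)) ∘ₗ
      (TensorProduct.mk ℚ W V).flip ∘ₗ (𝒱 p).subtype

theorem koszulSwap_tmul {𝒱 : ℤ → Submodule ℚ V} (h : DirectSum.IsInternal 𝒱)
    {𝒲 : ℤ → Submodule ℚ W} (h' : DirectSum.IsInternal 𝒲) {p q : ℤ} {x : V} {y : W}
    (hx : x ∈ 𝒱 p) (hy : y ∈ 𝒲 q) :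
    koszulSwap 𝒱 h 𝒲 h' (x ⊗ₜ y) = (p * q).negOnePow • (y ⊗ₜ[ℚ] x) := by
  rw [koszulSwap, TensorProduct.lift.tmul, gradedLift_of_mem 𝒱 h _ hx]
  by_cases hp : Even p
  · simp [hp, Int.negOnePow_even _ (hp.mul_right q)]
  · have ho := Int.not_even_iff_odd.1 hp
    have : (p * q).negOnePow = q.negOnePow := by
      by_cases hq : Even q
      · rw [Int.negOnePow_even _ hq, Int.negOnePow_even _ (hq.mul_left p)]
      · have hq' := Int.not_even_iff_odd.1 hq
        rw [Int.negOnePow_odd _ hq', Int.negOnePow_odd _ (ho.mul hq')]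
    simp only [hp, if_false, this]
    simp only [LinearMap.comp_apply, LinearMap.lcomp_apply', signMap_of_mem h' hy,
      Submodule.subtype_apply, LinearMap.flip_apply, TensorProduct.mk_apply]
    rcases Int.units_eq_one_or q.negOnePow with h1 | h1 <;> simp [h1, TensorProduct.neg_tmul]

end Graded

/-! ### Chain complexes, dg algebras, dg coalgebras, dg modules and dg comodules -/

/-- An unbounded, homologically graded chain complex of rational vector spaces, presented as the
internal direct sum of its homogeneous components. -/
structure DGVect where
  carrier : Type u
  [addCommGroup : AddCommGroup carrier]
  [module : Module ℚ carrier]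
  gr : ℤ → Submodule ℚ carrier
  isInternal : DirectSum.IsInternal gr
  d : carrier →ₗ[ℚ] carrier
  d_mem : ∀ n, ∀ x ∈ gr n, d x ∈ gr (n - 1)
  d_d : ∀ x, d (d x) = 0

attribute [instance] DGVect.addCommGroup DGVect.module

/-- The Koszul sign operator `x ↦ (-1)^|x| x` of a complex. -/
def DGVect.sgn (V : DGVect.{u}) : V.carrier →ₗ[ℚ] V.carrier := signMap V.gr V.isInternal

/-- The differential `d(x ⊗ y) = dx ⊗ y + (-1)^|x| x ⊗ dy` of a tensor product. -/
def tensorD (V W : DGVect.{u}) : V.carrier ⊗[ℚ] W.carrier →ₗ[ℚ] V.carrier ⊗[ℚ] W.carrier :=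
  V.d.rTensor W.carrier + TensorProduct.map V.sgn W.d

/-- A (connective, coassociative, counital) dg coalgebra over `ℚ`: the comultiplication and the
counit are chain maps of degree `0`. -/
structure DGCoalg extends DGVect.{u} where
  [coalgebra : Coalgebra ℚ carrier]
  connective : ∀ n < 0, gr n = ⊥
  comul_mem : ∀ n, ∀ x ∈ gr n, Coalgebra.comul (R := ℚ) x ∈ tensorGr gr gr n
  comul_d : ∀ x, Coalgebra.comul (R := ℚ) (d x) = tensorD toDGVect toDGVect (Coalgebra.comul x)
  counit_of_ne : ∀ n, n ≠ 0 → ∀ x ∈ gr n, Coalgebra.counit (R := ℚ) x = 0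
  counit_d : ∀ x, Coalgebra.counit (R := ℚ) (d x) = 0

attribute [instance] DGCoalg.coalgebra

/-- Graded cocommutativity: the comultiplication is invariant under the signed swap. -/
def DGCoalg.IsCocommutative (C : DGCoalg.{u}) : Prop :=
  ∀ x : C.carrier, koszulSwap C.gr C.isInternal C.gr C.isInternal (Coalgebra.comul x) =
    Coalgebra.comul (R := ℚ) x

/-- `C` is 2-reduced: `C₀ = ℚ` and `C₁ = 0`. -/
structure DGCoalg.IsTwoReduced (C : DGCoalg.{u}) : Prop where
  finrank_gr_zero : Module.finrank ℚ (C.gr 0) = 1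
  gr_one : C.gr 1 = ⊥

/-- A coaugmentation `ℚ → C` of a dg coalgebra, given by the image `e` of `1`. -/
structure Coaugmentation (C : DGCoalg.{u}) where
  e : C.carrier
  e_mem : e ∈ C.gr 0
  d_e : C.d e = 0
  comul_e : Coalgebra.comul e = e ⊗ₜ[ℚ] e
  counit_e : Coalgebra.counit (R := ℚ) e = 1

/-- A dg algebra over `ℚ` (associative and unital). -/
structure DGAlg where
  carrier : Type u
  [ring : Ring carrier]
  [algebra : Algebra ℚ carrier]
  gr : ℤ → Submodule ℚ carrier
  isInternal : DirectSum.IsInternal gr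
  d : carrier →ₗ[ℚ] carrier
  d_mem : ∀ n, ∀ x ∈ gr n, d x ∈ gr (n - 1)
  d_d : ∀ x, d (d x) = 0
  one_mem : 1 ∈ gr 0
  mul_mem : ∀ i j, ∀ a ∈ gr i, ∀ b ∈ gr j, a * b ∈ gr (i + j)
  d_mul : ∀ i, ∀ a ∈ gr i, ∀ b, d (a * b) = d a * b + i.negOnePow • (a * d b)

attribute [instance] DGAlg.ring DGAlg.algebra

/-- The underlying complex of a dg algebra. -/
abbrev DGAlg.toDGVect (A : DGAlg.{u}) : DGVect.{u} where
  carrier := A.carrier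
  gr := A.gr
  isInternal := A.isInternal
  d := A.d
  d_mem := A.d_mem
  d_d := A.d_d

/-- The Koszul sign operator of a dg algebra. -/
def DGAlg.sgn (A : DGAlg.{u}) : A.carrier →ₗ[ℚ] A.carrier := signMap A.gr A.isInternal

/-- A left dg module (unbounded) over a dg algebra. -/
structure DGMod (A : DGAlg.{u}) extends DGVect.{u} where
  [moduleA : Module A.carrier carrier]
  [tower : IsScalarTower ℚ A.carrier carrier]
  smul_mem : ∀ i j, ∀ a ∈ A.gr i, ∀ x ∈ gr j, a • x ∈ gr (i + j)
  d_smul : ∀ i, ∀ a ∈ A.gr i, ∀ x, d (a • x) = A.d a • x + i.negOnePow • (a • d x)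

attribute [instance] DGMod.moduleA DGMod.tower

/-- A left dg comodule (unbounded) over a dg coalgebra: the coaction is a coassociative and
counital chain map of degree `0`. -/
structure DGComod (C : DGCoalg.{u}) extends DGVect.{u} where
  coact : carrier →ₗ[ℚ] C.carrier ⊗[ℚ] carrier
  coact_mem : ∀ n, ∀ x ∈ gr n, coact x ∈ tensorGr C.gr gr n
  coact_d : ∀ x, coact (d x) = tensorD C.toDGVect toDGVect (coact x)
  coassoc : ∀ x, TensorProduct.assoc ℚ C.carrier C.carrier carrier
    ((Coalgebra.comul (R := ℚ)).rTensor carrier (coact x)) = coact.lTensor C.carrier (coact x)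
  counit : ∀ x, (Coalgebra.counit (R := ℚ)).rTensor carrier (coact x) = 1 ⊗ₜ[ℚ] x

/-- Morphisms of dg modules: `A`-linear chain maps of degree `0`. -/
@[ext]
structure DGMod.Hom {A : DGAlg.{u}} (M N : DGMod A) where
  lin : M.carrier →ₗ[A.carrier] N.carrier
  map_mem : ∀ n, ∀ x ∈ M.gr n, lin x ∈ N.gr n
  map_d : ∀ x, lin (M.d x) = N.d (lin x)

instance (A : DGAlg.{u}) : Category.{u} (DGMod A) where
  Hom M N := DGMod.Hom M N
  id M := ⟨LinearMap.id, fun _ _ h => h, fun _ => rfl⟩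
  comp f g := ⟨g.lin ∘ₗ f.lin, fun n x h => g.map_mem n _ (f.map_mem n x h), fun x => by
    simp [f.map_d, g.map_d]⟩

/-- Morphisms of dg comodules: `C`-colinear chain maps of degree `0`. -/
@[ext]
structure DGComod.Hom {C : DGCoalg.{u}} (M N : DGComod C) where
  lin : M.carrier →ₗ[ℚ] N.carrier
  map_mem : ∀ n, ∀ x ∈ M.gr n, lin x ∈ N.gr n
  map_d : ∀ x, lin (M.d x) = N.d (lin x)
  map_coact : ∀ x, N.coact (lin x) = lin.lTensor C.carrier (M.coact x)

instance (C : DGCoalg.{u}) : Category.{u} (DGComod C) where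
  Hom M N := DGComod.Hom M N
  id M := ⟨LinearMap.id, fun _ _ h => h, fun _ => rfl, fun x => by simp⟩
  comp f g := ⟨g.lin ∘ₗ f.lin, fun n x h => g.map_mem n _ (f.map_mem n x h), fun x => by
    simp [f.map_d, g.map_d], fun x => by
    simp [f.map_coact, g.map_coact, LinearMap.lTensor_comp_apply]⟩

@[ext]
theorem DGMod.hom_ext {A : DGAlg.{u}} {M N : DGMod A} {f g : M ⟶ N}
    (h : ∀ x, DGMod.Hom.lin f x = DGMod.Hom.lin g x) : f = g :=
  DGMod.Hom.ext (LinearMap.ext h)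

@[ext]
theorem DGComod.hom_ext {C : DGCoalg.{u}} {M N : DGComod C} {f g : M ⟶ N}
    (h : ∀ x, DGComod.Hom.lin f x = DGComod.Hom.lin g x) : f = g :=
  DGComod.Hom.ext (LinearMap.ext h)

@[simp]
theorem DGMod.id_lin {A : DGAlg.{u}} (M : DGMod A) : DGMod.Hom.lin (𝟙 M) = LinearMap.id := rfl

@[simp]
theorem DGMod.comp_lin {A : DGAlg.{u}} {M N P : DGMod A} (f : M ⟶ N) (g : N ⟶ P) :
    DGMod.Hom.lin (f ≫ g) = DGMod.Hom.lin g ∘ₗ DGMod.Hom.lin f := rfl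

@[simp]
theorem DGComod.id_lin {C : DGCoalg.{u}} (M : DGComod C) :
    DGComod.Hom.lin (𝟙 M) = LinearMap.id := rfl

@[simp]
theorem DGComod.comp_lin {C : DGCoalg.{u}} {M N P : DGComod C} (f : M ⟶ N) (g : N ⟶ P) :
    DGComod.Hom.lin (f ≫ g) = DGComod.Hom.lin g ∘ₗ DGComod.Hom.lin f := rfl

/-! ### Homology and quasi-isomorphisms -/

/-- The `n`-cycles of a complex. -/
def DGVect.cycles (V : DGVect.{u}) (n : ℤ) : Submodule ℚ V.carrier := V.gr n ⊓ LinearMap.ker V.d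

/-- The `n`-boundaries, as a subspace of the `n`-cycles. -/
def DGVect.boundaries (V : DGVect.{u}) (n : ℤ) : Submodule ℚ (V.cycles n) :=
  ((V.gr (n + 1)).map V.d).comap (V.cycles n).subtype

/-- The homology `Hₙ(V)`. -/
abbrev DGVect.homology (V : DGVect.{u}) (n : ℤ) : Type u := V.cycles n ⧸ V.boundaries n

/-- The map induced on `Hₙ` by a chain map of degree `0`. -/
def homologyMap {V W : DGVect.{u}} (f : V.carrier →ₗ[ℚ] W.carrier)
    (hf : ∀ n, ∀ x ∈ V.gr n, f x ∈ W.gr n) (hd : ∀ x, f (V.d x) = W.d (f x)) (n : ℤ) :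
    V.homology n →ₗ[ℚ] W.homology n :=
  Submodule.mapQ (V.boundaries n) (W.boundaries n)
    (f.restrict (p := V.cycles n) (q := W.cycles n) fun x hx =>
      ⟨hf n x hx.1, by
        have h2 : V.d x = 0 := hx.2
        change W.d (f x) = 0
        rw [← hd, h2, map_zero]⟩)
    (by
      rintro x ⟨y, hy, hyx⟩
      exact ⟨f y, hf _ y hy, by rw [← hd, hyx]; rfl⟩)

/-- A morphism of dg modules is a quasi-isomorphism if it is bijective on all homology groups. -/
def DGMod.quasiIso (A : DGAlg.{u}) : MorphismProperty (DGMod A) := fun _ _ f =>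
  ∀ n, Function.Bijective
    (homologyMap ((DGMod.Hom.lin f).restrictScalars ℚ) (DGMod.Hom.map_mem f) (DGMod.Hom.map_d f) n)

/-- Degreewise epimorphisms of dg modules. -/
def DGMod.degreewiseEpi (A : DGAlg.{u}) : MorphismProperty (DGMod A) := fun M N f =>
  ∀ n, ∀ y ∈ N.gr n, ∃ x ∈ M.gr n, DGMod.Hom.lin f x = y

/-! ### Sign lemmas -/

theorem DGVect.sgn_sgn (V : DGVect.{u}) (x : V.carrier) : V.sgn (V.sgn x) = x :=
  signMap_signMap _ x

theorem DGVect.sgn_mem (V : DGVect.{u}) {n : ℤ} {x : V.carrier} (hx : x ∈ V.gr n) :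
    V.sgn x ∈ V.gr n := signMap_mem _ hx

theorem DGVect.d_sgn (V : DGVect.{u}) (x : V.carrier) : V.d (V.sgn x) = - V.sgn (V.d x) :=
  map_signMap_neg _ _ _ V.d_mem x

theorem tensorD_tmul (V W : DGVect.{u}) (x : V.carrier) (y : W.carrier) :
    tensorD V W (x ⊗ₜ y) = V.d x ⊗ₜ y + V.sgn x ⊗ₜ W.d y := rfl

theorem tensorD_mem (V W : DGVect.{u}) (n : ℤ) (z : V.carrier ⊗[ℚ] W.carrier)
    (hz : z ∈ tensorGr V.gr W.gr n) : tensorD V W z ∈ tensorGr V.gr W.gr (n - 1) := by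
  refine map_mem_of_tensorGr _ _ ?_ hz
  intro i j hij x hx y hy
  rw [tensorD_tmul]
  exact add_mem (tmul_mem_tensorGr (V.d_mem i x hx) hy (by omega))
    (tmul_mem_tensorGr (V.sgn_mem hx) (W.d_mem j y hy) (by omega))

theorem tensorD_tensorD (V W : DGVect.{u}) (z : V.carrier ⊗[ℚ] W.carrier) :
    tensorD V W (tensorD V W z) = 0 := by
  induction z with
  | zero => simp
  | tmul x y =>
    simp [tensorD_tmul, V.d_d, W.d_d, V.d_sgn, TensorProduct.neg_tmul]
  | add x y hx hy => simp [hx, hy]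

theorem DGAlg.sgn_sgn (A : DGAlg.{u}) (x : A.carrier) : A.sgn (A.sgn x) = x :=
  signMap_signMap _ x

theorem DGAlg.sgn_mem (A : DGAlg.{u}) {n : ℤ} {x : A.carrier} (hx : x ∈ A.gr n) :
    A.sgn x ∈ A.gr n := signMap_mem _ hx

theorem DGAlg.d_sgn (A : DGAlg.{u}) (x : A.carrier) : A.d (A.sgn x) = - A.sgn (A.d x) :=
  map_signMap_neg _ _ _ A.d_mem x

theorem DGAlg.sgn_one (A : DGAlg.{u}) : A.sgn 1 = 1 := by
  rw [DGAlg.sgn, signMap_of_mem _ A.one_mem]; simp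

theorem DGAlg.d_mul' (A : DGAlg.{u}) (a b : A.carrier) :
    A.d (a * b) = A.d a * b + A.sgn a * A.d b := by
  have ha : a ∈ ⨆ n, A.gr n := A.isInternal.submodule_iSup_eq_top ▸ Submodule.mem_top
  induction ha using Submodule.iSup_induction' with
  | mem i a ha =>
    rw [A.d_mul i a ha, DGAlg.sgn, signMap_of_mem _ ha]
    rcases Int.units_eq_one_or i.negOnePow with h | h <;> simp [h]
  | zero => simp
  | add a a' _ _ h h' => simp only [add_mul, map_add, h, h']; abel

theorem DGAlg.d_one (A : DGAlg.{u}) : A.d 1 = 0 := by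
  have := A.d_mul' 1 1
  simpa [A.sgn_one] using this

theorem DGAlg.sgn_mul (A : DGAlg.{u}) (a b : A.carrier) :
    A.sgn (a * b) = A.sgn a * A.sgn b := by
  have ha : a ∈ ⨆ n, A.gr n := A.isInternal.submodule_iSup_eq_top ▸ Submodule.mem_top
  have hb : b ∈ ⨆ n, A.gr n := A.isInternal.submodule_iSup_eq_top ▸ Submodule.mem_top
  induction ha using Submodule.iSup_induction' with
  | mem i a ha =>
    induction hb using Submodule.iSup_induction' with
    | mem j b hb =>
      rw [DGAlg.sgn, signMap_of_mem _ ha, signMap_of_mem _ hb,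
        signMap_of_mem _ (A.mul_mem i j a ha b hb), Int.negOnePow_add]
      rcases Int.units_eq_one_or i.negOnePow with h | h <;>
        rcases Int.units_eq_one_or j.negOnePow with h' | h' <;> simp [h, h']
    | zero => simp
    | add b b' _ _ h h' => simp only [mul_add, map_add, h, h']
  | zero => simp
  | add a a' _ _ h h' => simp only [add_mul, map_add, h, h']

theorem DGMod.d_smul' {A : DGAlg.{u}} (M : DGMod A) (a : A.carrier) (x : M.carrier) :
    M.d (a • x) = A.d a • x + A.sgn a • M.d x := by
  have ha : a ∈ ⨆ n, A.gr n := A.isInternal.submodule_iSup_eq_top ▸ Submodule.mem_top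
  induction ha using Submodule.iSup_induction' with
  | mem i a ha =>
    rw [M.d_smul i a ha, DGAlg.sgn, signMap_of_mem _ ha]
    rcases Int.units_eq_one_or i.negOnePow with h | h <;> simp [h]
  | zero => simp
  | add a a' _ _ h h' => simp only [add_smul, map_add, h, h']; abel

theorem DGCoalg.comul_sgn (C : DGCoalg.{u}) (x : C.carrier) :
    Coalgebra.comul (R := ℚ) (C.sgn x) = TensorProduct.map C.sgn C.sgn (Coalgebra.comul x) := by
  rw [DGVect.sgn, map_signMap C.isInternal (isInternal_tensorGr C.isInternal C.isInternal) _
    C.comul_mem, tensor_signMap]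

theorem DGCoalg.counit_sgn (C : DGCoalg.{u}) (x : C.carrier) :
    Coalgebra.counit (R := ℚ) (C.sgn x) = Coalgebra.counit (R := ℚ) x := by
  have : Coalgebra.counit (R := ℚ) ∘ₗ C.sgn = Coalgebra.counit (R := ℚ) (A := C.carrier) := by
    refine graded_ext C.isInternal.submodule_iSup_eq_top fun n x hx => ?_
    by_cases hn : n = 0
    · subst hn
      rw [LinearMap.comp_apply, DGVect.sgn, signMap_of_mem _ hx]; simp
    · rw [LinearMap.comp_apply, C.counit_of_ne n hn x hx, C.counit_of_ne n hn _ (C.sgn_mem hx)]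
  exact LinearMap.congr_fun this x

theorem DGComod.coact_sgn {C : DGCoalg.{u}} (N : DGComod C) (x : N.carrier) :
    N.coact (N.sgn x) = TensorProduct.map C.sgn N.sgn (N.coact x) := by
  rw [DGVect.sgn, map_signMap N.isInternal (isInternal_tensorGr C.isInternal N.isInternal) _
    N.coact_mem, tensor_signMap]
  rfl

/-! ### Twisting chains, twisted extensions and coextensions -/

/-- The product `c ⊗ c' ↦ (-1)^|c| τ(c) τ(c')` attached to a linear map `τ : C → A`. -/
def signedMul (C : DGCoalg.{u}) {R : Type u} [Ring R] [Algebra ℚ R] (τ : C.carrier →ₗ[ℚ] R) :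
    C.carrier ⊗[ℚ] C.carrier →ₗ[ℚ] R :=
  LinearMap.mul' ℚ R ∘ₗ TensorProduct.map (τ ∘ₗ C.sgn) τ

@[simp]
theorem signedMul_tmul (C : DGCoalg.{u}) {R : Type u} [Ring R] [Algebra ℚ R]
    (τ : C.carrier →ₗ[ℚ] R) (a b : C.carrier) :
    signedMul C τ (a ⊗ₜ b) = τ (C.sgn a) * τ b := rfl

/-- A twisting chain `τ : C ⇝ A`: a linear map of degree `-1` with
`d(τ c) = - τ(dc) - (-1)^|c₀| τ(c₀) τ(c₁)`. -/
structure TwistingChain (C : DGCoalg.{u}) (A : DGAlg.{u}) where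
  lin : C.carrier →ₗ[ℚ] A.carrier
  mem : ∀ n, ∀ c ∈ C.gr n, lin c ∈ A.gr (n - 1)
  d_lin : ∀ c, A.d (lin c) = - lin (C.d c) - signedMul C lin (Coalgebra.comul c)

section Twisted

variable {C : DGCoalg.{u}} {A : DGAlg.{u}} (τ : TwistingChain C A)

theorem TwistingChain.lin_sgn (c : C.carrier) : τ.lin (C.sgn c) = - A.sgn (τ.lin c) :=
  map_signMap_neg _ _ _ τ.mem c

/-- For `m : M`, the map `c ⊗ c' ↦ (-1)^|c| c ⊗ τ(c')•m`. -/
def coextAux (M : DGMod A) (m : M.carrier) :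
    C.carrier ⊗[ℚ] C.carrier →ₗ[ℚ] C.carrier ⊗[ℚ] M.carrier :=
  TensorProduct.map C.sgn
    ((LinearMap.toSpanSingleton A.carrier M.carrier m).restrictScalars ℚ ∘ₗ τ.lin)

@[simp]
theorem coextAux_tmul (M : DGMod A) (m : M.carrier) (a b : C.carrier) :
    coextAux τ M m (a ⊗ₜ b) = C.sgn a ⊗ₜ[ℚ] (τ.lin b • m) := rfl

/-- The twisting term `c ⊗ m ↦ (-1)^|c₀| c₀ ⊗ τ(c₁)•m` on `C ⊗ M`. -/
def coextTwist (M : DGMod A) : C.carrier ⊗[ℚ] M.carrier →ₗ[ℚ] C.carrier ⊗[ℚ] M.carrier :=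
  (TensorProduct.lift ((Algebra.lsmul ℚ ℚ M.carrier).toLinearMap ∘ₗ τ.lin)).lTensor C.carrier ∘ₗ
    (TensorProduct.assoc ℚ C.carrier C.carrier M.carrier).toLinearMap ∘ₗ
    (C.sgn.rTensor C.carrier ∘ₗ Coalgebra.comul).rTensor M.carrier

theorem coextTwist_tmul (M : DGMod A) (c : C.carrier) (m : M.carrier) :
    coextTwist τ M (c ⊗ₜ m) = coextAux τ M m (Coalgebra.comul c) := by
  simp only [coextTwist, LinearMap.comp_apply, LinearMap.rTensor_tmul, LinearEquiv.coe_coe]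
  generalize (Coalgebra.comul c : C.carrier ⊗[ℚ] C.carrier) = z
  induction z with
  | zero => simp
  | tmul x y => simp
  | add x y hx hy => simp [TensorProduct.add_tmul, hx, hy]

theorem coextTwist_mem (M : DGMod A) (n : ℤ) (z : C.carrier ⊗[ℚ] M.carrier)
    (hz : z ∈ tensorGr C.gr M.gr n) : coextTwist τ M z ∈ tensorGr C.gr M.gr (n - 1) := by
  refine map_mem_of_tensorGr _ _ ?_ hz
  intro i j hij c hc m hm
  rw [coextTwist_tmul]
  refine map_mem_of_tensorGr _ _ ?_ (C.comul_mem i c hc)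
  intro k l hkl a ha b hb
  exact tmul_mem_tensorGr (C.sgn_mem ha) (M.smul_mem _ _ _ (τ.mem l b hb) m hm) (by omega)

/-- The map `c ⊗ y ↦ c ⊗ (signedMul y)•m`. -/
def coextAux₂ (M : DGMod A) (m : M.carrier) :
    C.carrier ⊗[ℚ] (C.carrier ⊗[ℚ] C.carrier) →ₗ[ℚ] C.carrier ⊗[ℚ] M.carrier :=
  ((LinearMap.toSpanSingleton A.carrier M.carrier m).restrictScalars ℚ ∘ₗ
    signedMul C τ.lin).lTensor C.carrier

theorem coextAux₂_tmul (M : DGMod A) (m : M.carrier) (a : C.carrier)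
    (y : C.carrier ⊗[ℚ] C.carrier) :
    coextAux₂ τ M m (a ⊗ₜ y) = a ⊗ₜ[ℚ] (signedMul C τ.lin y • m) := rfl

theorem coextTwist_coextAux (M : DGMod A) (m : M.carrier) (z : C.carrier ⊗[ℚ] C.carrier) :
    coextTwist τ M (coextAux τ M m z) = coextAux₂ τ M m (TensorProduct.assoc ℚ _ _ _
      ((Coalgebra.comul (R := ℚ)).rTensor C.carrier z)) := by
  induction z with
  | zero => simp
  | tmul a b =>
    rw [coextAux_tmul, coextTwist_tmul, LinearMap.rTensor_tmul, C.comul_sgn]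
    generalize (Coalgebra.comul a : C.carrier ⊗[ℚ] C.carrier) = y
    induction y with
    | zero => simp
    | tmul x y => simp [coextAux₂_tmul, mul_smul, C.sgn_sgn]
    | add x y hx hy => simp [TensorProduct.add_tmul, hx, hy]
  | add x y hx hy => simp [hx, hy]

theorem tensorD_coextAux (M : DGMod A) (m : M.carrier) (z : C.carrier ⊗[ℚ] C.carrier) :
    tensorD C.toDGVect M.toDGVect (coextAux τ M m z) +
      coextAux τ M m (tensorD C.toDGVect C.toDGVect z) +
      coextAux τ M (M.d m) (TensorProduct.map C.sgn C.sgn z) +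
      coextAux₂ τ M m ((Coalgebra.comul (R := ℚ)).lTensor C.carrier z) = 0 := by
  induction z with
  | zero => simp
  | tmul a b =>
    simp only [coextAux_tmul, tensorD_tmul, map_add, TensorProduct.map_tmul,
      LinearMap.lTensor_tmul, coextAux₂_tmul, M.d_smul', C.d_sgn, C.sgn_sgn, τ.d_lin, τ.lin_sgn,
      TensorProduct.tmul_add, TensorProduct.tmul_neg, TensorProduct.neg_tmul, sub_smul, neg_smul,
      TensorProduct.tmul_sub]
    abel
  | add x y hx hy =>
    simp only [map_add]
    have := congrArg₂ (· + ·) hx hy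
    simp only [add_zero] at this
    rw [← this]
    abel

/-- The differential of the twisted coextension:
`d(c ⊗ m) = dc ⊗ m + (-1)^|c| c ⊗ dm + (-1)^|c₀| c₀ ⊗ τ(c₁)•m`. -/
def coextD (M : DGMod A) : C.carrier ⊗[ℚ] M.carrier →ₗ[ℚ] C.carrier ⊗[ℚ] M.carrier :=
  tensorD C.toDGVect M.toDGVect + coextTwist τ M

theorem coextD_coextD (M : DGMod A) (z : C.carrier ⊗[ℚ] M.carrier) :
    coextD τ M (coextD τ M z) = 0 := by
  induction z with
  | zero => simp
  | tmul c m =>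
    have h1 := tensorD_tensorD C.toDGVect M.toDGVect (c ⊗ₜ m)
    have h2 := tensorD_coextAux τ M m (Coalgebra.comul c)
    have h3 := coextTwist_coextAux τ M m (Coalgebra.comul c)
    rw [Coalgebra.coassoc_apply] at h3
    rw [← h3, ← C.comul_d, ← C.comul_sgn] at h2
    simp only [coextD, LinearMap.add_apply, map_add, coextTwist_tmul, h1, zero_add]
    rw [tensorD_tmul, map_add, coextTwist_tmul, coextTwist_tmul, ← h2]
    abel
  | add x y hx hy => simp [hx, hy]

/-- The coaction on the cofree graded comodule `C ⊗ V`. -/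
def cofreeCoact (C : DGCoalg.{u}) (V : Type u) [AddCommGroup V] [Module ℚ V] :
    C.carrier ⊗[ℚ] V →ₗ[ℚ] C.carrier ⊗[ℚ] (C.carrier ⊗[ℚ] V) :=
  (TensorProduct.assoc ℚ C.carrier C.carrier V).toLinearMap ∘ₗ
    (Coalgebra.comul (R := ℚ)).rTensor V

theorem cofreeCoact_tmul (C : DGCoalg.{u}) (V : Type u) [AddCommGroup V] [Module ℚ V]
    (c : C.carrier) (v : V) : cofreeCoact C V (c ⊗ₜ v) =
      ((TensorProduct.mk ℚ C.carrier V).flip v).lTensor C.carrier (Coalgebra.comul c) := by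
  simp only [cofreeCoact, LinearMap.comp_apply, LinearMap.rTensor_tmul, LinearEquiv.coe_coe]
  generalize (Coalgebra.comul c : C.carrier ⊗[ℚ] C.carrier) = z
  induction z with
  | zero => simp
  | tmul x y => simp
  | add x y hx hy => simp [TensorProduct.add_tmul, hx, hy]

theorem cofreeCoact_coextAux (M : DGMod A) (m : M.carrier) (z : C.carrier ⊗[ℚ] C.carrier) :
    cofreeCoact C M.carrier (coextAux τ M m z) =
      TensorProduct.map C.sgn (coextAux τ M m) (TensorProduct.assoc ℚ _ _ _
        ((Coalgebra.comul (R := ℚ)).rTensor C.carrier z)) := by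
  induction z with
  | zero => simp
  | tmul a b =>
    rw [coextAux_tmul, cofreeCoact_tmul, LinearMap.rTensor_tmul, C.comul_sgn]
    generalize (Coalgebra.comul a : C.carrier ⊗[ℚ] C.carrier) = y
    induction y with
    | zero => simp
    | tmul x y => simp
    | add x y hx hy => simp [TensorProduct.add_tmul, hx, hy]
  | add x y hx hy => simp [hx, hy]

/-- The `τ`-twisted coextension `C ⊗^τ M` of a dg module. -/
def coext (M : DGMod A) : DGComod C where
  carrier := C.carrier ⊗[ℚ] M.carrier
  gr := tensorGr C.gr M.gr
  isInternal := isInternal_tensorGr C.isInternal M.isInternal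
  d := coextD τ M
  d_mem n x hx := add_mem (tensorD_mem C.toDGVect M.toDGVect n x hx) (coextTwist_mem τ M n x hx)
  d_d := coextD_coextD τ M
  coact := cofreeCoact C M.carrier
  coact_mem n x hx := by
    refine map_mem_of_tensorGr _ _ ?_ hx
    intro i j hij c hc m hm
    rw [cofreeCoact_tmul]
    refine map_mem_of_tensorGr _ _ ?_ (C.comul_mem i c hc)
    intro k l hkl a ha b hb
    exact tmul_mem_tensorGr ha (tmul_mem_tensorGr hb hm rfl) (by omega)
  coact_d x := by
    induction x with
    | zero => simp
    | tmul c m =>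
      have key : ∀ z : C.carrier ⊗[ℚ] C.carrier,
          ((TensorProduct.mk ℚ C.carrier M.carrier).flip m).lTensor C.carrier
            (tensorD C.toDGVect C.toDGVect z) +
          ((TensorProduct.mk ℚ C.carrier M.carrier).flip (M.d m)).lTensor C.carrier
            (TensorProduct.map C.sgn C.sgn z) +
          TensorProduct.map C.sgn (coextAux τ M m)
            ((Coalgebra.comul (R := ℚ)).lTensor C.carrier z) =
          (C.d.rTensor (C.carrier ⊗[ℚ] M.carrier) + TensorProduct.map C.sgn (coextD τ M))
            (((TensorProduct.mk ℚ C.carrier M.carrier).flip m).lTensor C.carrier z) := by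
        intro z
        induction z with
        | zero => simp
        | tmul a b =>
          simp [tensorD_tmul, coextD, coextTwist_tmul, TensorProduct.tmul_add]
          abel
        | add x y hx hy =>
          simp only [map_add] at hx hy ⊢
          rw [← hx, ← hy]
          abel
      change cofreeCoact C M.carrier (coextD τ M (c ⊗ₜ m)) =
        (C.d.rTensor (C.carrier ⊗[ℚ] M.carrier) + TensorProduct.map C.sgn (coextD τ M))
          (cofreeCoact C M.carrier (c ⊗ₜ m))
      rw [cofreeCoact_tmul, ← key, coextD, LinearMap.add_apply, tensorD_tmul, coextTwist_tmul,
        map_add, map_add, cofreeCoact_coextAux, Coalgebra.coassoc_apply, cofreeCoact_tmul,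
        cofreeCoact_tmul, C.comul_d, C.comul_sgn]
    | add x y hx hy => simp only [map_add, hx, hy]
  coassoc x := by
    induction x with
    | zero => simp
    | tmul c m =>
      have h1 : ∀ z : C.carrier ⊗[ℚ] C.carrier,
          (cofreeCoact C M.carrier).lTensor C.carrier
            (((TensorProduct.mk ℚ C.carrier M.carrier).flip m).lTensor C.carrier z) =
          (((TensorProduct.mk ℚ C.carrier M.carrier).flip m).lTensor C.carrier).lTensor C.carrier
            ((Coalgebra.comul (R := ℚ)).lTensor C.carrier z) := by
        intro z
        induction z with
        | zero => simp
        | tmul a b => simp [cofreeCoact_tmul]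
        | add x y hx hy => simp only [map_add, hx, hy]
      have h2 : ∀ z : C.carrier ⊗[ℚ] C.carrier,
          TensorProduct.assoc ℚ C.carrier C.carrier (C.carrier ⊗[ℚ] M.carrier)
            ((Coalgebra.comul (R := ℚ)).rTensor (C.carrier ⊗[ℚ] M.carrier)
            (((TensorProduct.mk ℚ C.carrier M.carrier).flip m).lTensor C.carrier z)) =
          (((TensorProduct.mk ℚ C.carrier M.carrier).flip m).lTensor C.carrier).lTensor C.carrier
            (TensorProduct.assoc ℚ _ _ _ ((Coalgebra.comul (R := ℚ)).rTensor C.carrier z)) := by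
        intro z
        induction z with
        | zero => simp
        | tmul a b =>
          simp only [LinearMap.lTensor_tmul, LinearMap.rTensor_tmul]
          generalize (Coalgebra.comul a : C.carrier ⊗[ℚ] C.carrier) = y
          induction y with
          | zero => simp
          | tmul x y => simp
          | add x y hx hy => simp only [TensorProduct.add_tmul, map_add, hx, hy]
        | add x y hx hy => simp only [map_add, hx, hy]
      rw [cofreeCoact_tmul, h1, h2, Coalgebra.coassoc_apply]
    | add x y hx hy => simp only [map_add, hx, hy]
  counit x := by
    induction x with
    | zero => simp
    | tmul c m =>
      have h1 : ∀ z : C.carrier ⊗[ℚ] C.carrier,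
          (Coalgebra.counit (R := ℚ)).rTensor (C.carrier ⊗[ℚ] M.carrier)
            (((TensorProduct.mk ℚ C.carrier M.carrier).flip m).lTensor C.carrier z) =
          ((TensorProduct.mk ℚ C.carrier M.carrier).flip m).lTensor ℚ
            ((Coalgebra.counit (R := ℚ)).rTensor C.carrier z) := by
        intro z
        induction z with
        | zero => simp
        | tmul a b => simp
        | add x y hx hy => simp only [map_add, hx, hy]
      rw [cofreeCoact_tmul, h1, Coalgebra.rTensor_counit_comul]
      simp
    | add x y hx hy => simp only [map_add, TensorProduct.tmul_add, hx, hy]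

/-- The twisted coextension functor `τ_* : A-Mod ⥤ C-Comod`. -/
def coextFunctor : DGMod A ⥤ DGComod C where
  obj M := coext τ M
  map {M N} f :=
    { lin := ((DGMod.Hom.lin f).restrictScalars ℚ).lTensor C.carrier
      map_mem := fun n x hx => by
        refine map_mem_of_tensorGr _ _ ?_ hx
        intro i j hij c hc m hm
        exact tmul_mem_tensorGr hc (DGMod.Hom.map_mem f j m hm) hij
      map_d := fun (x : C.carrier ⊗[ℚ] M.carrier) => by
        change LinearMap.lTensor _ _ (coextD τ M x) = coextD τ N (LinearMap.lTensor _ _ x)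
        induction x with
        | zero => simp
        | tmul c m =>
          change LinearMap.lTensor _ _ (coextD τ M (c ⊗ₜ m)) =
            coextD τ N (c ⊗ₜ DGMod.Hom.lin f m)
          rw [coextD, coextD, LinearMap.add_apply, LinearMap.add_apply, tensorD_tmul, tensorD_tmul,
            coextTwist_tmul, coextTwist_tmul, map_add, map_add, ← DGMod.Hom.map_d]
          congr 1
          generalize (Coalgebra.comul c : C.carrier ⊗[ℚ] C.carrier) = z
          induction z with
          | zero => simp
          | tmul a b => simp
          | add x y hx hy => simp only [map_add, hx, hy]
        | add x y hx hy => simp only [map_add, hx, hy]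
      map_coact := fun (x : C.carrier ⊗[ℚ] M.carrier) => by
        change cofreeCoact C N.carrier (LinearMap.lTensor _ _ x) =
          LinearMap.lTensor _ _ (cofreeCoact C M.carrier x)
        induction x with
        | zero => simp
        | tmul c m =>
          change cofreeCoact C N.carrier (c ⊗ₜ DGMod.Hom.lin f m) =
            LinearMap.lTensor _ _ (cofreeCoact C M.carrier (c ⊗ₜ m))
          rw [cofreeCoact_tmul, cofreeCoact_tmul]
          generalize (Coalgebra.comul c : C.carrier ⊗[ℚ] C.carrier) = z
          induction z with
          | zero => simp
          | tmul a b => simp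
          | add x y hx hy => simp only [map_add, hx, hy]
        | add x y hx hy => simp only [map_add, hx, hy] }
  map_id M := by
    apply DGComod.Hom.ext
    exact TensorProduct.ext' fun c m => rfl
  map_comp f g := by
    apply DGComod.Hom.ext
    exact TensorProduct.ext' fun c m => rfl

/-- For `a : A`, the map `c ⊗ n ↦ a τ(c) ⊗ n`. -/
def extAux (V : Type u) [AddCommGroup V] [Module ℚ V] (a : A.carrier) :
    C.carrier ⊗[ℚ] V →ₗ[ℚ] A.carrier ⊗[ℚ] V :=
  (LinearMap.mulLeft ℚ a ∘ₗ τ.lin).rTensor V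

@[simp]
theorem extAux_tmul (V : Type u) [AddCommGroup V] [Module ℚ V] (a : A.carrier) (c : C.carrier)
    (v : V) : extAux τ V a (c ⊗ₜ v) = (a * τ.lin c) ⊗ₜ[ℚ] v := rfl

/-- The twisting term `a ⊗ n ↦ - (-1)^|a| a τ(n₀) ⊗ n₁` on `A ⊗ N`. -/
def extTwist (N : DGComod C) : A.carrier ⊗[ℚ] N.carrier →ₗ[ℚ] A.carrier ⊗[ℚ] N.carrier :=
  - ((LinearMap.mul' ℚ A.carrier).rTensor N.carrier ∘ₗ
      (TensorProduct.assoc ℚ A.carrier A.carrier N.carrier).symm.toLinearMap ∘ₗ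
      TensorProduct.map A.sgn (τ.lin.rTensor N.carrier ∘ₗ N.coact))

theorem extTwist_tmul (N : DGComod C) (a : A.carrier) (n : N.carrier) :
    extTwist τ N (a ⊗ₜ n) = - extAux τ N.carrier (A.sgn a) (N.coact n) := by
  simp only [extTwist, LinearMap.neg_apply, LinearMap.comp_apply, TensorProduct.map_tmul,
    LinearEquiv.coe_coe]
  congr 1
  generalize N.coact n = z
  induction z with
  | zero => simp
  | tmul x y => simp
  | add x y hx hy => simp only [map_add, TensorProduct.tmul_add, hx, hy]

theorem extTwist_mem (N : DGComod C) (n : ℤ) (z : A.carrier ⊗[ℚ] N.carrier)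
    (hz : z ∈ tensorGr A.gr N.gr n) : extTwist τ N z ∈ tensorGr A.gr N.gr (n - 1) := by
  refine map_mem_of_tensorGr _ _ ?_ hz
  intro i j hij a ha x hx
  rw [extTwist_tmul]
  refine neg_mem (map_mem_of_tensorGr _ _ ?_ (N.coact_mem j x hx))
  intro k l hkl c hc y hy
  exact tmul_mem_tensorGr (A.mul_mem _ _ _ (A.sgn_mem ha) _ (τ.mem k c hc)) hy (by omega)

/-- The map `y ⊗ n ↦ a (signedMul y) ⊗ n`. -/
def extAux₂ (N : DGComod C) (a : A.carrier) :
    C.carrier ⊗[ℚ] (C.carrier ⊗[ℚ] N.carrier) →ₗ[ℚ] A.carrier ⊗[ℚ] N.carrier :=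
  (LinearMap.mulLeft ℚ a ∘ₗ signedMul C τ.lin).rTensor N.carrier ∘ₗ
    (TensorProduct.assoc ℚ C.carrier C.carrier N.carrier).symm.toLinearMap

theorem extTwist_extAux (N : DGComod C) (a : A.carrier) (z : C.carrier ⊗[ℚ] N.carrier) :
    extTwist τ N (extAux τ N.carrier (A.sgn a) z) =
      extAux₂ τ N a (N.coact.lTensor C.carrier z) := by
  induction z with
  | zero => simp
  | tmul c n =>
    rw [extAux_tmul, extTwist_tmul, LinearMap.lTensor_tmul]
    generalize N.coact n = y
    induction y with
    | zero => simp
    | tmul x y =>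
      simp [extAux₂, A.sgn_mul, A.sgn_sgn, τ.lin_sgn, mul_assoc, TensorProduct.neg_tmul]
    | add x y hx hy =>
      simp only [map_add, TensorProduct.tmul_add, neg_add]
      rw [← hx, ← hy]
  | add x y hx hy => simp only [map_add, hx, hy]

theorem tensorD_extAux (N : DGComod C) (a : A.carrier) (z : C.carrier ⊗[ℚ] N.carrier) :
    tensorD A.toDGVect N.toDGVect (extAux τ N.carrier (A.sgn a) z) +
      extAux τ N.carrier (A.sgn (A.d a)) z +
      extAux τ N.carrier a (tensorD C.toDGVect N.toDGVect z) +
      extAux₂ τ N a (TensorProduct.assoc ℚ C.carrier C.carrier N.carrier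
        ((Coalgebra.comul (R := ℚ)).rTensor N.carrier z)) = 0 := by
  induction z with
  | zero => simp
  | tmul c n =>
    have h1 : tensorD A.toDGVect N.toDGVect (extAux τ N.carrier (A.sgn a) (c ⊗ₜ n)) =
        A.d (A.sgn a * τ.lin c) ⊗ₜ[ℚ] n + A.sgn (A.sgn a * τ.lin c) ⊗ₜ[ℚ] N.d n := rfl
    rw [h1]
    simp only [extAux_tmul, tensorD_tmul, map_add, LinearMap.rTensor_tmul, extAux₂,
      LinearMap.comp_apply, LinearEquiv.coe_coe, LinearEquiv.symm_apply_apply, A.d_mul', A.d_sgn,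
      A.sgn_sgn, A.sgn_mul, τ.d_lin, τ.lin_sgn, LinearMap.mulLeft_apply, TensorProduct.add_tmul,
      TensorProduct.sub_tmul, TensorProduct.neg_tmul, mul_sub, mul_neg, neg_mul]
    abel
  | add x y hx hy =>
    simp only [map_add]
    have := congrArg₂ (· + ·) hx hy
    simp only [add_zero] at this
    rw [← this]
    abel

/-- The differential of the twisted extension:
`d(a ⊗ n) = da ⊗ n + (-1)^|a| a ⊗ dn - (-1)^|a| a τ(n₀) ⊗ n₁`. -/
def extD (N : DGComod C) : A.carrier ⊗[ℚ] N.carrier →ₗ[ℚ] A.carrier ⊗[ℚ] N.carrier :=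
  tensorD A.toDGVect N.toDGVect + extTwist τ N

theorem extD_tmul (N : DGComod C) (a : A.carrier) (n : N.carrier) :
    extD τ N (a ⊗ₜ n) = A.d a ⊗ₜ n + A.sgn a ⊗ₜ N.d n
      - extAux τ N.carrier (A.sgn a) (N.coact n) := by
  rw [extD, LinearMap.add_apply, extTwist_tmul, tensorD_tmul, sub_eq_add_neg]
  rfl

theorem extD_extD (N : DGComod C) (z : A.carrier ⊗[ℚ] N.carrier) :
    extD τ N (extD τ N z) = 0 := by
  induction z with
  | zero => simp
  | tmul a n =>
    have h1 := tensorD_tensorD A.toDGVect N.toDGVect (a ⊗ₜ n)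
    have h2 := tensorD_extAux τ N a (N.coact n)
    have h3 := extTwist_extAux τ N a (N.coact n)
    rw [N.coassoc, ← h3, ← N.coact_d] at h2
    have h4 : extTwist τ N (tensorD A.toDGVect N.toDGVect (a ⊗ₜ n)) =
        - extAux τ N.carrier (A.sgn (A.d a)) (N.coact n) -
          extAux τ N.carrier a (N.coact (N.d n)) := by
      rw [tensorD_tmul, map_add, extTwist_tmul, extTwist_tmul]
      change _ + - extAux τ _ (A.sgn (A.sgn a)) _ = _
      rw [A.sgn_sgn]
      abel
    simp only [extD, LinearMap.add_apply, map_add, h1, zero_add, h4]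
    rw [extTwist_tmul, map_neg, map_neg]
    rw [← neg_eq_zero, ← h2]
    abel
  | add x y hx hy => simp [hx, hy]

theorem extAux_mul (V : Type u) [AddCommGroup V] [Module ℚ V] (a b : A.carrier)
    (z : C.carrier ⊗[ℚ] V) : extAux τ V (a * b) z = a • extAux τ V b z := by
  induction z with
  | zero => simp
  | tmul x y => simp [mul_assoc, TensorProduct.smul_tmul']
  | add x y hx hy => simp only [map_add, smul_add, hx, hy]

/-- The `τ`-twisted extension `A ⊗_τ N` of a dg comodule. -/
def ext (N : DGComod C) : DGMod A where
  carrier := A.carrier ⊗[ℚ] N.carrier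
  gr := tensorGr A.gr N.gr
  isInternal := isInternal_tensorGr A.isInternal N.isInternal
  d := extD τ N
  d_mem n x hx := add_mem (tensorD_mem A.toDGVect N.toDGVect n x hx) (extTwist_mem τ N n x hx)
  d_d := extD_extD τ N
  smul_mem i j a ha x hx := by
    refine map_mem_of_tensorGr (n := j) (Algebra.lsmul ℚ ℚ (A.carrier ⊗[ℚ] N.carrier) a) _ ?_ hx
    intro k l hkl b hb n hn
    exact tmul_mem_tensorGr (A.mul_mem _ _ a ha b hb) hn (by omega)
  d_smul i a ha x := by
    have hs : ∀ y : A.carrier ⊗[ℚ] N.carrier, i.negOnePow • (a • y) = A.sgn a • y := by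
      intro y
      rw [DGAlg.sgn, signMap_of_mem _ ha]
      rcases Int.units_eq_one_or i.negOnePow with h | h
      · simp [h]
      · rw [h, Units.neg_smul, one_smul, Units.neg_smul, one_smul]
        exact (neg_smul a y).symm
    rw [hs]
    induction x with
    | zero => simp
    | tmul b n =>
      rw [TensorProduct.smul_tmul', smul_eq_mul, extD_tmul, extD_tmul, A.d_mul', A.sgn_mul,
        extAux_mul, smul_sub, smul_add, TensorProduct.smul_tmul', TensorProduct.smul_tmul',
        TensorProduct.smul_tmul', TensorProduct.add_tmul]
      simp only [smul_eq_mul]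
      abel
    | add x y hx hy => simp only [map_add, smul_add, hx, hy]; abel

/-- The twisted extension functor `τ^! : C-Comod ⥤ A-Mod`. -/
def extFunctor : DGComod C ⥤ DGMod A where
  obj N := ext τ N
  map {M N} f :=
    { lin := (DGComod.Hom.lin f).baseChange A.carrier
      map_mem := fun n x hx => by
        refine map_mem_of_tensorGr (((DGComod.Hom.lin f).baseChange A.carrier).restrictScalars ℚ)
          _ ?_ hx
        intro i j hij a ha m hm
        exact tmul_mem_tensorGr ha (DGComod.Hom.map_mem f j m hm) hij
      map_d := fun (x : A.carrier ⊗[ℚ] M.carrier) => by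
        change LinearMap.baseChange _ _ (extD τ M x) = extD τ N (LinearMap.baseChange _ _ x)
        induction x with
        | zero => simp
        | tmul a m =>
          change LinearMap.baseChange _ _ (extD τ M (a ⊗ₜ m)) =
            extD τ N (a ⊗ₜ DGComod.Hom.lin f m)
          rw [extD_tmul, extD_tmul, map_sub, map_add, ← DGComod.Hom.map_d, DGComod.Hom.map_coact]
          congr 1
          generalize M.coact m = z
          induction z with
          | zero => simp
          | tmul a b => simp
          | add x y hx hy => simp only [map_add, hx, hy]
        | add x y hx hy => simp only [map_add, hx, hy] }
  map_id M := by
    apply DGMod.Hom.ext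
    exact LinearMap.baseChange_id
  map_comp f g := by
    apply DGMod.Hom.ext
    exact LinearMap.baseChange_comp _ _

end Twisted

/-! ### The adjunction between twisted extension and coextension -/

section Adjunction

variable {C : DGCoalg.{u}} {A : DGAlg.{u}} (τ : TwistingChain C A)

/-- The map `c ⊗ n ↦ τ(c)•θ(n)`. -/
def twistPair {N : DGComod C} {M : DGMod A} (θ : N.carrier →ₗ[ℚ] M.carrier) :
    C.carrier ⊗[ℚ] N.carrier →ₗ[ℚ] M.carrier :=
  TensorProduct.lift (((Algebra.lsmul ℚ ℚ M.carrier).toLinearMap ∘ₗ τ.lin).compl₂ θ)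

@[simp]
theorem twistPair_tmul {N : DGComod C} {M : DGMod A} (θ : N.carrier →ₗ[ℚ] M.carrier)
    (c : C.carrier) (n : N.carrier) : twistPair τ θ (c ⊗ₜ n) = τ.lin c • θ n := rfl

/-- A modular `τ`-twist `θ : N ⇝ M`: a linear map of degree `0` with
`dθ(n) = θ(dn) - τ(n₀)•θ(n₁)`. -/
@[ext]
structure ModularTwist (N : DGComod C) (M : DGMod A) where
  lin : N.carrier →ₗ[ℚ] M.carrier
  mem : ∀ n, ∀ x ∈ N.gr n, lin x ∈ M.gr n
  d_lin : ∀ x, M.d (lin x) = lin (N.d x) - twistPair τ lin (N.coact x)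

variable {τ}

/-- The linear map underlying a morphism `A ⊗_τ N ⟶ M`. -/
def extHomLin {N : DGComod C} {M : DGMod A} (f : ext τ N ⟶ M) :
    A.carrier ⊗[ℚ] N.carrier →ₗ[A.carrier] M.carrier := DGMod.Hom.lin f

/-- The linear map underlying a morphism `N ⟶ C ⊗^τ M`. -/
def coextHomLin {N : DGComod C} {M : DGMod A} (g : N ⟶ coext τ M) :
    N.carrier →ₗ[ℚ] C.carrier ⊗[ℚ] M.carrier := DGComod.Hom.lin g

theorem extHomLin_tmul {N : DGComod C} {M : DGMod A} (f : ext τ N ⟶ M) (a : A.carrier)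
    (n : N.carrier) : extHomLin f (a ⊗ₜ n) = a • extHomLin f (1 ⊗ₜ n) := by
  rw [← map_smul, TensorProduct.smul_tmul', smul_eq_mul, mul_one]

/-- The modular twist `n ↦ f(1 ⊗ n)`. -/
def twistOfExtHom {N : DGComod C} {M : DGMod A} (f : ext τ N ⟶ M) : ModularTwist τ N M where
  lin := (extHomLin f).restrictScalars ℚ ∘ₗ TensorProduct.mk ℚ A.carrier N.carrier 1
  mem n x hx := DGMod.Hom.map_mem f n _ (tmul_mem_tensorGr A.one_mem hx (zero_add n))
  d_lin x := by
    have h1 : M.d (extHomLin f (1 ⊗ₜ x)) = extHomLin f (extD τ N (1 ⊗ₜ x)) :=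
      (DGMod.Hom.map_d f _).symm
    change M.d (extHomLin f (1 ⊗ₜ x)) = extHomLin f (1 ⊗ₜ N.d x) - _
    rw [h1, extD_tmul, A.d_one, A.sgn_one, TensorProduct.zero_tmul, zero_add, map_sub]
    congr 1
    generalize N.coact x = z
    induction z with
    | zero => simp
    | tmul c n => simp [extHomLin_tmul f (τ.lin c) n]
    | add x y hx hy => simp only [map_add, hx, hy]

/-- The `A`-linear map `a ⊗ n ↦ a•θ(n)`. -/
def extLinOfTwist {N : DGComod C} {M : DGMod A} (θ : N.carrier →ₗ[ℚ] M.carrier) :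
    A.carrier ⊗[ℚ] N.carrier →ₗ[A.carrier] M.carrier :=
  TensorProduct.AlgebraTensorModule.lift
    { toFun := fun a => (Algebra.lsmul ℚ ℚ M.carrier a) ∘ₗ θ
      map_add' := fun a b => LinearMap.ext fun n => add_smul a b (θ n)
      map_smul' := fun a b => LinearMap.ext fun n => mul_smul a b (θ n) }

@[simp]
theorem extLinOfTwist_tmul {N : DGComod C} {M : DGMod A} (θ : N.carrier →ₗ[ℚ] M.carrier)
    (a : A.carrier) (n : N.carrier) :
    extLinOfTwist θ (a ⊗ₜ n) = a • θ n := rfl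

/-- The morphism `a ⊗ n ↦ a•θ(n)` attached to a modular twist. -/
def extHomOfTwist {N : DGComod C} {M : DGMod A} (θ : ModularTwist τ N M) : ext τ N ⟶ M where
  lin := extLinOfTwist θ.lin
  map_mem n x hx := by
    refine map_mem_of_tensorGr ((extLinOfTwist θ.lin).restrictScalars ℚ) _ ?_ hx
    intro i j hij a ha y hy
    subst hij
    exact M.smul_mem i j a ha _ (θ.mem j y hy)
  map_d := fun (x : A.carrier ⊗[ℚ] N.carrier) => by
    change extLinOfTwist θ.lin (extD τ N x) = M.d (extLinOfTwist θ.lin x)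
    induction x with
    | zero => simp
    | tmul a n =>
      have key : ∀ z : C.carrier ⊗[ℚ] N.carrier,
          extLinOfTwist θ.lin (extAux τ N.carrier (A.sgn a) z) =
          A.sgn a • twistPair τ θ.lin z := by
        intro z
        induction z with
        | zero => simp
        | tmul c n => simp [mul_smul]
        | add x y hx hy => simp only [map_add, smul_add, hx, hy]
      rw [extD_tmul, map_sub, map_add, key, extLinOfTwist_tmul, extLinOfTwist_tmul,
        extLinOfTwist_tmul, M.d_smul', θ.d_lin, smul_sub]
      abel
    | add x y hx hy => simp only [map_add, hx, hy]

/-- Morphisms `A ⊗_τ N ⟶ M` are the modular twists `N ⇝ M`. -/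
def extHomEquiv (N : DGComod C) (M : DGMod A) : (ext τ N ⟶ M) ≃ ModularTwist τ N M where
  toFun := twistOfExtHom
  invFun := extHomOfTwist
  left_inv f := by
    apply DGMod.Hom.ext
    apply LinearMap.ext
    intro (x : A.carrier ⊗[ℚ] N.carrier)
    change extLinOfTwist (twistOfExtHom f).lin x = extHomLin f x
    induction x with
    | zero => simp
    | tmul a n => rw [extHomLin_tmul]; rfl
    | add x y hx hy => simp only [map_add, hx, hy]
  right_inv θ := by
    apply ModularTwist.ext
    apply LinearMap.ext
    intro x
    change (1 : A.carrier) • θ.lin x = θ.lin x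
    rw [one_smul]

/-- The linear map `n ↦ n₀ ⊗ θ(n₁)`. -/
def coextLinOfTwist {N : DGComod C} {M : DGMod A} (θ : N.carrier →ₗ[ℚ] M.carrier) :
    N.carrier →ₗ[ℚ] C.carrier ⊗[ℚ] M.carrier := θ.lTensor C.carrier ∘ₗ N.coact

/-- The morphism `n ↦ n₀ ⊗ θ(n₁)` attached to a modular twist. -/
def coextHomOfTwist {N : DGComod C} {M : DGMod A} (θ : ModularTwist τ N M) : N ⟶ coext τ M where
  lin := coextLinOfTwist θ.lin
  map_mem n x hx := by
    refine map_mem_of_tensorGr (θ.lin.lTensor C.carrier) (tensorGr C.gr M.gr n) ?_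
      (N.coact_mem n x hx)
    intro i j hij c hc y hy
    exact tmul_mem_tensorGr hc (θ.mem j y hy) hij
  map_d x := by
    change θ.lin.lTensor C.carrier (N.coact (N.d x)) =
      coextD τ M (θ.lin.lTensor C.carrier (N.coact x))
    have key : ∀ z : C.carrier ⊗[ℚ] N.carrier,
        coextD τ M (θ.lin.lTensor C.carrier z) =
          θ.lin.lTensor C.carrier (tensorD C.toDGVect N.toDGVect z) -
          TensorProduct.map C.sgn (twistPair τ θ.lin) (N.coact.lTensor C.carrier z) +
          TensorProduct.map C.sgn (twistPair τ θ.lin) (TensorProduct.assoc ℚ _ _ _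
            ((Coalgebra.comul (R := ℚ)).rTensor N.carrier z)) := by
      intro z
      induction z with
      | zero => simp
      | tmul c n =>
        have h2 : ∀ y : C.carrier ⊗[ℚ] C.carrier, coextAux τ M (θ.lin n) y =
            TensorProduct.map C.sgn (twistPair τ θ.lin)
              (TensorProduct.assoc ℚ _ _ _ (y ⊗ₜ n)) := by
          intro y
          induction y with
          | zero => simp
          | tmul a b => simp
          | add x y hx hy => simp only [map_add, TensorProduct.add_tmul, hx, hy]
        simp only [LinearMap.lTensor_tmul, LinearMap.rTensor_tmul, tensorD_tmul, coextD,
          LinearMap.add_apply, coextTwist_tmul, h2, map_add, TensorProduct.map_tmul, θ.d_lin,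
          TensorProduct.tmul_sub]
        abel
      | add x y hx hy => simp only [map_add, hx, hy]; abel
    rw [key, N.coassoc, N.coact_d]
    abel
  map_coact x := by
    change cofreeCoact C M.carrier (θ.lin.lTensor C.carrier (N.coact x)) =
      (coextLinOfTwist θ.lin).lTensor C.carrier (N.coact x)
    rw [coextLinOfTwist, LinearMap.lTensor_comp_apply, ← N.coassoc]
    generalize N.coact x = z
    induction z with
    | zero => simp
    | tmul c n =>
      rw [LinearMap.lTensor_tmul, cofreeCoact_tmul, LinearMap.rTensor_tmul]
      generalize (Coalgebra.comul c : C.carrier ⊗[ℚ] C.carrier) = y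
      induction y with
      | zero => simp
      | tmul a b => simp
      | add x y hx hy => simp only [map_add, TensorProduct.add_tmul, hx, hy]
    | add x y hx hy => simp only [map_add, hx, hy]

/-- The map `c ⊗ v ↦ ε(c)v`. -/
def counitMap (C : DGCoalg.{u}) (V : Type u) [AddCommGroup V] [Module ℚ V] :
    C.carrier ⊗[ℚ] V →ₗ[ℚ] V :=
  (TensorProduct.lid ℚ V).toLinearMap ∘ₗ (Coalgebra.counit (R := ℚ)).rTensor V

@[simp]
theorem counitMap_tmul (V : Type u) [AddCommGroup V] [Module ℚ V] (c : C.carrier) (v : V) :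
    counitMap C V (c ⊗ₜ v) = Coalgebra.counit (R := ℚ) c • v := rfl

theorem coextHomLin_coact {N : DGComod C} {M : DGMod A} (g : N ⟶ coext τ M) (x : N.carrier) :
    cofreeCoact C M.carrier (coextHomLin g x) =
      (coextHomLin g).lTensor C.carrier (N.coact x) := DGComod.Hom.map_coact g x

theorem lTensor_counitMap_cofreeCoact (C : DGCoalg.{u}) (V : Type u) [AddCommGroup V] [Module ℚ V]
    (z : C.carrier ⊗[ℚ] V) : (counitMap C V).lTensor C.carrier (cofreeCoact C V z) = z := by
  induction z with
  | zero => simp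
  | tmul c v =>
    have key : ∀ y : C.carrier ⊗[ℚ] C.carrier,
        (counitMap C V).lTensor C.carrier
          (((TensorProduct.mk ℚ C.carrier V).flip v).lTensor C.carrier y) =
        (TensorProduct.rid ℚ C.carrier
          ((Coalgebra.counit (R := ℚ)).lTensor C.carrier y)) ⊗ₜ v := by
      intro y
      induction y with
      | zero => simp
      | tmul a b => simp [TensorProduct.smul_tmul']
      | add x y hx hy => simp only [map_add, TensorProduct.add_tmul, hx, hy]
    rw [cofreeCoact_tmul, key, Coalgebra.lTensor_counit_comul]
    simp
  | add x y hx hy => simp only [map_add, hx, hy]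

/-- A colinear map `g` into a cofree comodule is `n ↦ n₀ ⊗ ε(g(n₁)₀) g(n₁)₁`. -/
theorem coextHomLin_eq {N : DGComod C} {M : DGMod A} (g : N ⟶ coext τ M) (x : N.carrier) :
    (counitMap C M.carrier ∘ₗ coextHomLin g).lTensor C.carrier (N.coact x) =
      coextHomLin g x := by
  rw [LinearMap.lTensor_comp_apply, ← coextHomLin_coact, lTensor_counitMap_cofreeCoact]

theorem counitMap_coextD (M : DGMod A) (z : C.carrier ⊗[ℚ] M.carrier) :
    counitMap C M.carrier (coextD τ M z) = M.d (counitMap C M.carrier z) +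
      TensorProduct.lift ((Algebra.lsmul ℚ ℚ M.carrier).toLinearMap ∘ₗ τ.lin) z := by
  induction z with
  | zero => simp
  | tmul c m =>
    have key : ∀ y : C.carrier ⊗[ℚ] C.carrier,
        counitMap C M.carrier (coextAux τ M m y) =
          LinearMap.toSpanSingleton A.carrier M.carrier m (τ.lin (TensorProduct.lid ℚ C.carrier
            ((Coalgebra.counit (R := ℚ)).rTensor C.carrier y))) := by
      intro y
      induction y with
      | zero => simp
      | tmul a b => simp [C.counit_sgn]
      | add x y hx hy => simp only [map_add, hx, hy]
    rw [coextD, LinearMap.add_apply, coextTwist_tmul, map_add, key, tensorD_tmul,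
      Coalgebra.rTensor_counit_comul]
    simp [C.counit_d, C.counit_sgn]
  | add x y hx hy => simp only [map_add, hx, hy]; abel

/-- The modular twist `n ↦ (ε ⊗ id)(g(n))`. -/
def twistOfCoextHom {N : DGComod C} {M : DGMod A} (g : N ⟶ coext τ M) : ModularTwist τ N M where
  lin := counitMap C M.carrier ∘ₗ coextHomLin g
  mem n x hx := by
    have hg : coextHomLin g x ∈ tensorGr C.gr M.gr n := DGComod.Hom.map_mem g n x hx
    refine map_mem_of_tensorGr (counitMap C M.carrier) (M.gr n) ?_ hg
    intro k l hkl c hc m hm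
    rw [counitMap_tmul]
    by_cases hk : k = 0
    · subst hk
      have : l = n := by omega
      subst this
      exact Submodule.smul_mem _ _ hm
    · rw [C.counit_of_ne k hk c hc]; simp
  d_lin x := by
    have h1 : coextHomLin g (N.d x) = coextD τ M (coextHomLin g x) := DGComod.Hom.map_d g x
    rw [LinearMap.comp_apply, LinearMap.comp_apply, h1, counitMap_coextD]
    have h2 : ∀ z : C.carrier ⊗[ℚ] N.carrier,
        twistPair τ (counitMap C M.carrier ∘ₗ coextHomLin g) z =
        TensorProduct.lift ((Algebra.lsmul ℚ ℚ M.carrier).toLinearMap ∘ₗ τ.lin)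
          ((counitMap C M.carrier ∘ₗ coextHomLin g).lTensor C.carrier z) := by
      intro z
      induction z with
      | zero => simp
      | tmul c n => simp
      | add x y hx hy => simp only [map_add, hx, hy]
    rw [h2, coextHomLin_eq]
    abel

/-- Morphisms `N ⟶ C ⊗^τ M` are the modular twists `N ⇝ M`. -/
def coextHomEquiv (N : DGComod C) (M : DGMod A) : (N ⟶ coext τ M) ≃ ModularTwist τ N M where
  toFun := twistOfCoextHom
  invFun := coextHomOfTwist
  left_inv g := by
    apply DGComod.Hom.ext
    apply LinearMap.ext
    intro x
    exact coextHomLin_eq g x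
  right_inv θ := by
    apply ModularTwist.ext
    apply LinearMap.ext
    intro x
    change counitMap C M.carrier (θ.lin.lTensor C.carrier (N.coact x)) = θ.lin x
    have key : ∀ z : C.carrier ⊗[ℚ] N.carrier,
        counitMap C M.carrier (θ.lin.lTensor C.carrier z) =
          θ.lin (TensorProduct.lid ℚ N.carrier
            ((Coalgebra.counit (R := ℚ)).rTensor N.carrier z)) := by
      intro z
      induction z with
      | zero => simp
      | tmul c n => simp
      | add x y hx hy => simp only [map_add, hx, hy]
    rw [key, N.counit]
    simp

/-- The adjunction `τ^! ⊣ τ_*`, under which `f : A ⊗_τ N ⟶ M` corresponds to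
`n ↦ n₀ ⊗ f(1 ⊗ n₁)`. -/
def twistAdj (τ : TwistingChain C A) : extFunctor τ ⊣ coextFunctor τ :=
  Adjunction.mkOfHomEquiv
    { homEquiv := fun N M => (extHomEquiv N M).trans (coextHomEquiv N M).symm
      homEquiv_naturality_left_symm := fun {N N' M} f g => by
        apply DGMod.Hom.ext
        apply LinearMap.ext
        intro (x : A.carrier ⊗[ℚ] N.carrier)
        change extLinOfTwist (twistOfCoextHom (f ≫ g)).lin x =
          extLinOfTwist (twistOfCoextHom g).lin
            (LinearMap.baseChange A.carrier (DGComod.Hom.lin f) x)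
        induction x with
        | zero => simp
        | tmul a n => rfl
        | add x y hx hy => simp only [map_add, hx, hy]
      homEquiv_naturality_right := fun {N M M'} f g => by
        apply DGComod.Hom.ext
        apply LinearMap.ext
        intro x
        change (twistOfExtHom (f ≫ g)).lin.lTensor C.carrier (N.coact x) =
          ((DGMod.Hom.lin g).restrictScalars ℚ).lTensor C.carrier
            ((twistOfExtHom f).lin.lTensor C.carrier (N.coact x))
        rw [← LinearMap.lTensor_comp_apply]
        rfl }

end Adjunction

/-! ### The cobar construction -/

section Cobar

variable (C : DGCoalg.{u}) (η : Coaugmentation C)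

/-- The cokernel `C̄` of the coaugmentation. -/
abbrev cobarGen : Type u := C.carrier ⧸ Submodule.span ℚ {η.e}

/-- The algebra underlying the cobar construction: the tensor algebra on `C̄`. -/
abbrev cobarCarrier : Type u := TensorAlgebra ℚ (cobarGen C η)

/-- The map `c ↦ tc` from `C` to the generators of the cobar construction. -/
def cobarT : C.carrier →ₗ[ℚ] cobarCarrier C η :=
  TensorAlgebra.ι ℚ ∘ₗ (Submodule.span ℚ {η.e}).mkQ

/-- The grading of the cobar construction: in degree `n` it is spanned by the products
`tc₁ ⋯ tcₖ` with `(|c₁| - 1) + ⋯ + (|cₖ| - 1) = n`. -/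
def cobarGr (n : ℤ) : Submodule ℚ (cobarCarrier C η) :=
  Submodule.span ℚ {a | ∃ l : List (Σ i : ℤ, C.gr i),
    (l.map fun c => c.1 - 1).sum = n ∧ (l.map fun c => cobarT C η c.2).prod = a}

/-- The value `- t(dc) - (-1)^|c₀| tc₀ tc₁` of the differential on `tc`. -/
def cobarDGen : C.carrier →ₗ[ℚ] cobarCarrier C η :=
  - (cobarT C η ∘ₗ C.d) - signedMul C (cobarT C η) ∘ₗ Coalgebra.comul

variable {C η}

@[simp]
theorem cobarT_e : cobarT C η η.e = 0 := by
  have : (Submodule.span ℚ {η.e}).mkQ η.e = 0 := by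
    simp [Submodule.mem_span_singleton_self]
  simp [cobarT, this]

theorem sgn_e : C.sgn η.e = η.e := by
  rw [DGVect.sgn, signMap_of_mem _ η.e_mem]; simp

theorem cobarDGen_e : cobarDGen C η η.e = 0 := by
  simp [cobarDGen, η.d_e, η.comul_e, sgn_e]

/-- Algebra maps out of the cobar construction, from linear maps on `C` killing `e`. -/
def cobarLift {R : Type*} [Ring R] [Algebra ℚ R] (f : C.carrier →ₗ[ℚ] R) (hf : f η.e = 0) :
    cobarCarrier C η →ₐ[ℚ] R :=
  TensorAlgebra.lift ℚ ((Submodule.span ℚ {η.e}).liftQ f (by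
    rw [Submodule.span_le]; rintro _ rfl; exact hf))

@[simp]
theorem cobarLift_cobarT {R : Type*} [Ring R] [Algebra ℚ R] (f : C.carrier →ₗ[ℚ] R)
    (hf : f η.e = 0) (c : C.carrier) : cobarLift f hf (cobarT C η c) = f c := by
  simp [cobarLift, cobarT]

theorem cobar_induction {P : cobarCarrier C η → Prop}
    (algebraMap : ∀ r : ℚ, P (algebraMap ℚ _ r)) (t : ∀ c, P (cobarT C η c))
    (mul : ∀ a b, P a → P b → P (a * b)) (add : ∀ a b, P a → P b → P (a + b))
    (a : cobarCarrier C η) : P a := by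
  induction a using TensorAlgebra.induction with
  | algebraMap r => exact algebraMap r
  | ι x =>
    obtain ⟨c, rfl⟩ := Submodule.mkQ_surjective _ x
    exact t c
  | mul a b ha hb => exact mul a b ha hb
  | add a b ha hb => exact add a b ha hb

theorem one_mem_cobarGr : 1 ∈ cobarGr C η 0 := Submodule.subset_span ⟨[], rfl, rfl⟩

theorem cobarT_mem_cobarGr {n : ℤ} {c : C.carrier} (hc : c ∈ C.gr n) :
    cobarT C η c ∈ cobarGr C η (n - 1) :=
  Submodule.subset_span ⟨[⟨n, c, hc⟩], by simp, by simp⟩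

theorem mul_mem_cobarGr {i j : ℤ} {a b : cobarCarrier C η} (ha : a ∈ cobarGr C η i)
    (hb : b ∈ cobarGr C η j) : a * b ∈ cobarGr C η (i + j) := by
  have h := Submodule.mul_mem_mul ha hb
  rw [cobarGr, cobarGr, Submodule.span_mul_span] at h
  refine Submodule.span_mono ?_ h
  rintro _ ⟨_, ⟨l, hl, rfl⟩, _, ⟨l', hl', rfl⟩, rfl⟩
  exact ⟨l ++ l', by simp [hl, hl'], by simp⟩

/-- To check a statement on homogeneous elements, it suffices to check it on products. -/
theorem cobarGr_induction {P : ℤ → cobarCarrier C η → Prop} (one : P 0 1)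
    (t_mul : ∀ i j, ∀ c ∈ C.gr i, ∀ b ∈ cobarGr C η j, P j b → P (i - 1 + j) (cobarT C η c * b))
    (add : ∀ n a b, P n a → P n b → P n (a + b)) (smul : ∀ n (q : ℚ) a, P n a → P n (q • a))
    (zero : ∀ n, P n 0)
    (n : ℤ) (a : cobarCarrier C η) (ha : a ∈ cobarGr C η n) : P n a := by
  induction ha using Submodule.span_induction with
  | mem a ha =>
    obtain ⟨l, rfl, rfl⟩ := ha
    induction l with
    | nil => simpa using one
    | cons x l ih =>
      simp only [List.map_cons, List.sum_cons, List.prod_cons]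
      exact t_mul x.1 _ x.2 x.2.2 _ (Submodule.subset_span ⟨l, rfl, rfl⟩) ih
  | zero => exact zero n
  | add a b _ _ ha hb => exact add n a b ha hb
  | smul q a _ ha => exact smul n q a ha

theorem iSup_cobarGr : ⨆ n, cobarGr C η n = ⊤ := by
  rw [eq_top_iff]
  rintro a -
  have hmul : ∀ a b : cobarCarrier C η, a ∈ ⨆ n, cobarGr C η n → b ∈ ⨆ n, cobarGr C η n →
      a * b ∈ ⨆ n, cobarGr C η n := by
    intro a b ha hb
    induction ha using Submodule.iSup_induction' with
    | mem i a ha =>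
      induction hb using Submodule.iSup_induction' with
      | mem j b hb => exact Submodule.mem_iSup_of_mem (i + j) (mul_mem_cobarGr ha hb)
      | zero => simp
      | add b b' _ _ h h' => rw [mul_add]; exact add_mem h h'
    | zero => simp
    | add a a' _ _ h h' => rw [add_mul]; exact add_mem h h'
  induction a using cobar_induction with
  | algebraMap r =>
    rw [Algebra.algebraMap_eq_smul_one]
    exact Submodule.smul_mem _ _ (Submodule.mem_iSup_of_mem 0 one_mem_cobarGr)
  | t c =>
    have hc : c ∈ ⨆ n, C.gr n := C.isInternal.submodule_iSup_eq_top ▸ Submodule.mem_top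
    induction hc using Submodule.iSup_induction' with
    | mem i c hc => exact Submodule.mem_iSup_of_mem (i - 1) (cobarT_mem_cobarGr hc)
    | zero => simp
    | add x y _ _ hx hy => rw [map_add]; exact add_mem hx hy
  | mul a b ha hb => exact hmul a b ha hb
  | add a b ha hb => exact add_mem ha hb

variable (C η) in
/-- The algebra map sending a homogeneous element `a` of degree `n` to the monomial `a Tⁿ`. -/
def cobarDetect : cobarCarrier C η →ₐ[ℚ] AddMonoidAlgebra (cobarCarrier C η) ℤ :=
  cobarLift (gradedLift C.gr C.isInternal fun n =>
    { toFun := fun c => AddMonoidAlgebra.single (n - 1) (cobarT C η c)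
      map_add' := fun a b => by simp only [Submodule.coe_add, map_add, AddMonoidAlgebra.single_add]
      map_smul' := fun q a => by
        simp only [Submodule.coe_smul, map_smul, RingHom.id_apply, AddMonoidAlgebra.smul_single] })
    (by
      rw [gradedLift_of_mem _ _ _ η.e_mem]
      change AddMonoidAlgebra.single _ (cobarT C η η.e) = 0
      rw [cobarT_e, AddMonoidAlgebra.single_zero])

theorem cobarDetect_of_mem (n : ℤ) (a : cobarCarrier C η) (ha : a ∈ cobarGr C η n) :
    cobarDetect C η a = AddMonoidAlgebra.single n a := by
  refine cobarGr_induction (P := fun n a => cobarDetect C η a = AddMonoidAlgebra.single n a) ?_ ?_ ?_ ?_ ?_ n a ha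
  · rw [map_one, AddMonoidAlgebra.one_def]
  · intro i j c hc b hb ih
    have : cobarDetect C η (cobarT C η c) = AddMonoidAlgebra.single (i - 1) (cobarT C η c) := by
      rw [cobarDetect, cobarLift_cobarT, gradedLift_of_mem _ _ _ hc]; rfl
    rw [map_mul, this, ih, AddMonoidAlgebra.single_mul_single]
  · intro n a b ha hb
    rw [map_add, ha, hb, AddMonoidAlgebra.single_add]
  · intro n q a ha
    rw [map_smul, ha, AddMonoidAlgebra.smul_single]
  · intro n
    rw [map_zero, AddMonoidAlgebra.single_zero]

theorem isInternal_cobarGr : DirectSum.IsInternal (cobarGr C η) := by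
  refine isInternal_of_detect _
    { toFun := fun a => (cobarDetect C η a).coeff
      map_add' := fun a b => by simp
      map_smul' := fun q a => by simp } ?_ iSup_cobarGr
  intro n a ha
  change (cobarDetect C η a).coeff = _
  rw [cobarDetect_of_mem n a ha, AddMonoidAlgebra.coeff_single]

variable (C η) in
/-- The Koszul sign operator of the cobar construction, as an algebra map. -/
def cobarSgn : cobarCarrier C η →ₐ[ℚ] cobarCarrier C η :=
  cobarLift (- (cobarT C η ∘ₗ C.sgn)) (by simp [sgn_e])

@[simp]
theorem cobarSgn_cobarT (c : C.carrier) : cobarSgn C η (cobarT C η c) = - cobarT C η (C.sgn c) := by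
  simp [cobarSgn]

theorem cobarSgn_of_mem (n : ℤ) (a : cobarCarrier C η) (ha : a ∈ cobarGr C η n) :
    cobarSgn C η a = n.negOnePow • a := by
  refine cobarGr_induction (P := fun n a => cobarSgn C η a = n.negOnePow • a) ?_ ?_ ?_ ?_ ?_ n a ha
  · simp
  · intro i j c hc b hb ih
    rw [map_mul, ih, cobarSgn_cobarT, DGVect.sgn, signMap_of_mem _ hc, Int.negOnePow_add,
      Int.negOnePow_sub, Int.negOnePow_one]
    rcases Int.units_eq_one_or i.negOnePow with h | h <;>
      rcases Int.units_eq_one_or j.negOnePow with h' | h' <;> simp [h, h']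
  · intro n a b ha hb
    simp [ha, hb]
  · intro n q a ha
    rw [map_smul, ha]
    rcases Int.units_eq_one_or n.negOnePow with h | h <;> simp [h]
  · intro n
    simp

theorem cobarSgn_cobarSgn (a : cobarCarrier C η) : cobarSgn C η (cobarSgn C η a) = a := by
  induction a using cobar_induction with
  | algebraMap r => simp
  | t c => simp [C.sgn_sgn]
  | mul a b ha hb => simp [ha, hb]
  | add a b ha hb => simp [ha, hb]

variable (C η) in
/-- The algebra map `a ↦ (±a, da; 0, a)` into upper triangular matrices, which encodes the
derivation `d`. -/
def cobarMat : cobarCarrier C η →ₐ[ℚ] Matrix (Fin 2) (Fin 2) (cobarCarrier C η) :=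
  cobarLift
    { toFun := fun c => !![- cobarT C η (C.sgn c), cobarDGen C η c; 0, cobarT C η c]
      map_add' := fun a b => by
        ext i j; fin_cases i <;> fin_cases j <;> simp [add_comm]
      map_smul' := fun q a => by
        ext i j; fin_cases i <;> fin_cases j <;> simp }
    (by
      ext i j
      fin_cases i <;> fin_cases j <;> simp [sgn_e, cobarDGen_e])

theorem cobarMat_cobarT (c : C.carrier) : cobarMat C η (cobarT C η c) =
    !![- cobarT C η (C.sgn c), cobarDGen C η c; 0, cobarT C η c] := by
  simp [cobarMat]

theorem cobarMat_entries (a : cobarCarrier C η) : cobarMat C η a 0 0 = cobarSgn C η a ∧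
    cobarMat C η a 1 0 = 0 ∧ cobarMat C η a 1 1 = a := by
  induction a using cobar_induction with
  | algebraMap r => simp [Matrix.algebraMap_matrix_apply]
  | t c => simp [cobarMat_cobarT]
  | mul a b ha hb => simp [Matrix.mul_apply, ha, hb]
  | add a b ha hb => simp [ha, hb]

variable (C η) in
/-- The differential of the cobar construction: the derivation with
`d(tc) = - t(dc) - (-1)^|c₀| tc₀ tc₁`. -/
def cobarD : cobarCarrier C η →ₗ[ℚ] cobarCarrier C η :=
  { toFun := fun a => cobarMat C η a 0 1
    map_add' := fun a b => by simp
    map_smul' := fun q a => by simp }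

theorem cobarD_cobarT (c : C.carrier) : cobarD C η (cobarT C η c) =
    - cobarT C η (C.d c) - signedMul C (cobarT C η) (Coalgebra.comul c) := by
  change cobarMat C η _ 0 1 = _
  simp [cobarMat_cobarT, cobarDGen]

theorem cobarD_mul (a b : cobarCarrier C η) : cobarD C η (a * b) =
    cobarD C η a * b + cobarSgn C η a * cobarD C η b := by
  change cobarMat C η _ 0 1 = cobarMat C η _ 0 1 * _ + _ * cobarMat C η _ 0 1
  simp [Matrix.mul_apply, cobarMat_entries, add_comm]

theorem cobarD_algebraMap (r : ℚ) : cobarD C η (algebraMap ℚ _ r) = 0 := by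
  change cobarMat C η (algebraMap ℚ _ r) 0 1 = 0
  simp [Matrix.algebraMap_matrix_apply]

theorem cobarD_one : cobarD C η 1 = 0 := by
  simpa using cobarD_algebraMap (C := C) (η := η) 1

theorem signedMul_mem {n : ℤ} {z : C.carrier ⊗[ℚ] C.carrier} (hz : z ∈ tensorGr C.gr C.gr n) :
    signedMul C (cobarT C η) z ∈ cobarGr C η (n - 2) := by
  refine map_mem_of_tensorGr _ _ ?_ hz
  intro i j hij a ha b hb
  have := mul_mem_cobarGr (cobarT_mem_cobarGr (η := η) (C.sgn_mem ha))
    (cobarT_mem_cobarGr (η := η) hb)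
  rwa [show i - 1 + (j - 1) = n - 2 by omega] at this

theorem cobarD_mem (n : ℤ) (a : cobarCarrier C η) (ha : a ∈ cobarGr C η n) :
    cobarD C η a ∈ cobarGr C η (n - 1) := by
  refine cobarGr_induction (P := fun n a => cobarD C η a ∈ cobarGr C η (n - 1)) ?_ ?_ ?_ ?_ ?_ n a ha
  · rw [cobarD_one]; exact zero_mem _
  · intro i j c hc b hb ih
    rw [cobarD_mul, cobarD_cobarT, cobarSgn_cobarT]
    refine add_mem ?_ ?_
    · rw [show i - 1 + j - 1 = (i - 2) + j by omega]
      refine mul_mem_cobarGr (sub_mem (neg_mem ?_) (signedMul_mem (C.comul_mem i c hc))) hb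
      have := cobarT_mem_cobarGr (η := η) (C.d_mem i c hc)
      rwa [show i - 1 - 1 = i - 2 by omega] at this
    · rw [show i - 1 + j - 1 = (i - 1) + (j - 1) by omega]
      exact mul_mem_cobarGr (neg_mem (cobarT_mem_cobarGr (C.sgn_mem hc))) ih
  · intro n a b ha hb
    rw [map_add]; exact add_mem ha hb
  · intro n q a ha
    rw [map_smul]; exact Submodule.smul_mem _ _ ha
  · intro n
    rw [map_zero]; exact zero_mem _

theorem signedMul_sgn (z : C.carrier ⊗[ℚ] C.carrier) :
    signedMul C (cobarT C η) (TensorProduct.map C.sgn C.sgn z) =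
      cobarSgn C η (signedMul C (cobarT C η) z) := by
  induction z with
  | zero => simp
  | tmul a b => simp
  | add x y hx hy => simp only [map_add, hx, hy]

theorem cobarD_cobarSgn (a : cobarCarrier C η) :
    cobarD C η (cobarSgn C η a) = - cobarSgn C η (cobarD C η a) := by
  induction a using cobar_induction with
  | algebraMap r => simp [cobarD_algebraMap]
  | t c =>
    rw [cobarSgn_cobarT, map_neg, cobarD_cobarT, cobarD_cobarT, C.comul_sgn, signedMul_sgn, C.d_sgn,
      map_sub, map_neg, map_neg, cobarSgn_cobarT]
  | mul a b ha hb =>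
    rw [map_mul, cobarD_mul, ha, hb, cobarD_mul, map_add, map_mul, map_mul]
    simp only [mul_neg, neg_mul]
    abel
  | add a b ha hb => simp only [map_add, ha, hb]; abel

/-- The map `a ⊗ y ↦ ta · signedMul y`. -/
def cobarAux (C : DGCoalg.{u}) (η : Coaugmentation C) :
    C.carrier ⊗[ℚ] (C.carrier ⊗[ℚ] C.carrier) →ₗ[ℚ] cobarCarrier C η :=
  LinearMap.mul' ℚ _ ∘ₗ TensorProduct.map (cobarT C η) (signedMul C (cobarT C η))

theorem cobarD_signedMul (z : C.carrier ⊗[ℚ] C.carrier) :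
    cobarD C η (signedMul C (cobarT C η) z) =
      signedMul C (cobarT C η) (tensorD C.toDGVect C.toDGVect z) -
        cobarAux C η (TensorProduct.assoc ℚ _ _ _
          ((Coalgebra.comul (R := ℚ)).rTensor C.carrier z)) +
        cobarAux C η ((Coalgebra.comul (R := ℚ)).lTensor C.carrier z) := by
  induction z with
  | zero => simp
  | tmul a b =>
    have key : ∀ y : C.carrier ⊗[ℚ] C.carrier,
        signedMul C (cobarT C η) (TensorProduct.map C.sgn C.sgn y) * cobarT C η b =
          cobarAux C η (TensorProduct.assoc ℚ _ _ _ (y ⊗ₜ b)) := by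
      intro y
      induction y with
      | zero => simp
      | tmul u v => simp [cobarAux, C.sgn_sgn, mul_assoc]
      | add x y hx hy => simp only [map_add, add_mul, TensorProduct.add_tmul, hx, hy]
    have key2 : ∀ y : C.carrier ⊗[ℚ] C.carrier,
        cobarAux C η (a ⊗ₜ y) = cobarT C η a * signedMul C (cobarT C η) y := fun y => rfl
    rw [signedMul_tmul, cobarD_mul, cobarD_cobarT, cobarD_cobarT, cobarSgn_cobarT, C.sgn_sgn,
      C.comul_sgn, C.d_sgn, sub_mul, key, LinearMap.rTensor_tmul, LinearMap.lTensor_tmul, key2,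
      tensorD_tmul, map_add, signedMul_tmul, signedMul_tmul, C.sgn_sgn]
    simp only [map_neg, neg_neg, neg_mul, mul_sub, mul_neg]
    abel
  | add x y hx hy => simp only [map_add, hx, hy]; abel

theorem cobarD_cobarD (a : cobarCarrier C η) : cobarD C η (cobarD C η a) = 0 := by
  induction a using cobar_induction with
  | algebraMap r => simp [cobarD_algebraMap]
  | t c =>
    rw [cobarD_cobarT, map_sub, map_neg, cobarD_cobarT, cobarD_signedMul, Coalgebra.coassoc_apply,
      C.d_d, C.comul_d, map_zero]
    abel
  | mul a b ha hb =>
    rw [cobarD_mul, map_add, cobarD_mul, cobarD_mul, ha, hb, cobarD_cobarSgn]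
    simp
  | add a b ha hb => simp [ha, hb]

variable (C η) in
/-- The cobar construction `ΩC`. -/
def cobar : DGAlg.{u} where
  carrier := cobarCarrier C η
  gr := cobarGr C η
  isInternal := isInternal_cobarGr
  d := cobarD C η
  d_mem := cobarD_mem
  d_d := cobarD_cobarD
  one_mem := one_mem_cobarGr
  mul_mem i j a ha b hb := mul_mem_cobarGr ha hb
  d_mul i a ha b := by
    rw [cobarD_mul, cobarSgn_of_mem i a ha]
    rcases Int.units_eq_one_or i.negOnePow with h | h <;> simp [h]

variable (C η) in
/-- The universal twisting chain `t : C ⇝ ΩC`, `c ↦ tc`. -/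
def universalTwist : TwistingChain C (cobar C η) where
  lin := cobarT C η
  mem _ _ hc := cobarT_mem_cobarGr hc
  d_lin := cobarD_cobarT

end Cobar

/-! ### The canonical coaugmentation of a 2-reduced dg coalgebra -/

theorem DGCoalg.IsTwoReduced.exists_e {C : DGCoalg.{u}} (h : C.IsTwoReduced) :
    ∃ e ∈ C.gr 0, Coalgebra.counit (R := ℚ) e = 1 ∧ ∀ x ∈ C.gr 0, ∃ q : ℚ, x = q • e := by
  obtain ⟨⟨v, hv⟩, hv0, hspan⟩ := finrank_eq_one_iff'.1 h.finrank_gr_zero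
  have hspan' : ∀ x ∈ C.gr 0, ∃ q : ℚ, q • v = x := fun x hx => by
    obtain ⟨q, hq⟩ := hspan ⟨x, hx⟩
    exact ⟨q, congrArg Subtype.val hq⟩
  have hε : Coalgebra.counit (R := ℚ) v ≠ 0 := by
    intro h0
    have hz : Coalgebra.counit (R := ℚ) (A := C.carrier) = 0 := by
      refine graded_ext C.isInternal.submodule_iSup_eq_top fun n x hx => ?_
      by_cases hn : n = 0
      · subst hn
        obtain ⟨q, rfl⟩ := hspan' x hx
        simp [h0]
      · rw [C.counit_of_ne n hn x hx]; rfl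
    have h1 := Coalgebra.rTensor_counit_comul (R := ℚ) v
    rw [hz, LinearMap.rTensor_zero, LinearMap.zero_apply] at h1
    have h2 := congrArg (TensorProduct.lid ℚ C.carrier) h1
    simp only [map_zero, TensorProduct.lid_tmul, one_smul] at h2
    exact hv0 (Subtype.ext h2.symm)
  refine ⟨(Coalgebra.counit (R := ℚ) v)⁻¹ • v, Submodule.smul_mem _ _ hv, by simp [hε], ?_⟩
  intro x hx
  obtain ⟨q, rfl⟩ := hspan' x hx
  exact ⟨q * Coalgebra.counit (R := ℚ) v, by rw [smul_smul, mul_assoc, mul_inv_cancel₀ hε, mul_one]⟩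

/-- The canonical coaugmentation: `e` is the element of `C₀ = ℚ` with `ε(e) = 1`. -/
def DGCoalg.IsTwoReduced.coaugmentation {C : DGCoalg.{u}} (h : C.IsTwoReduced) :
    Coaugmentation C where
  e := h.exists_e.choose
  e_mem := h.exists_e.choose_spec.1
  d_e := by
    have := C.d_mem 0 _ h.exists_e.choose_spec.1
    rw [C.connective _ (by norm_num)] at this
    exact this
  comul_e := by
    obtain ⟨he, hε, hspan⟩ := h.exists_e.choose_spec
    set e := h.exists_e.choose
    have h1 : tensorGr C.gr C.gr 0 ≤ Submodule.span ℚ {e ⊗ₜ[ℚ] e} := by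
      refine Submodule.span_le.2 ?_
      rintro _ ⟨i, j, hij, x, hx, y, hy, rfl⟩
      rcases lt_trichotomy i 0 with hi | hi | hi
      · rw [C.connective i hi, Submodule.mem_bot] at hx
        simp [hx]
      · have hj : j = 0 := by omega
        subst hi hj
        obtain ⟨p, rfl⟩ := hspan x hx
        obtain ⟨q, rfl⟩ := hspan y hy
        rw [TensorProduct.smul_tmul_smul]
        exact Submodule.smul_mem _ _ (Submodule.mem_span_singleton_self _)
      · rw [C.connective j (by omega), Submodule.mem_bot] at hy
        simp [hy]
    obtain ⟨q, hq⟩ := Submodule.mem_span_singleton.1 (h1 (C.comul_mem 0 e he))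
    have h2 := Coalgebra.rTensor_counit_comul (R := ℚ) e
    rw [← hq] at h2
    have h3 := congrArg (Coalgebra.counit (R := ℚ) ∘ₗ (TensorProduct.lid ℚ C.carrier).toLinearMap) h2
    simp [hε] at h3
    rw [← hq, h3, one_smul]
  counit_e := h.exists_e.choose_spec.2.1

/-! ### Model categories -/

section Model

variable {𝒞 : Type*} [Category 𝒞] [ModelCategory 𝒞] {𝒟 : Type*} [Category 𝒟] [ModelCategory 𝒟]

/-- A model category is combinatorial if its underlying category is locally presentable and it is
cofibrantly generated: there are sets `I` and `J` of morphisms such that the trivial fibrations and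
the fibrations are the morphisms with the right lifting property against `I` and `J`.
(In a locally presentable category every set of morphisms permits the small object argument.) -/
structure IsCombinatorial (𝒞 : Type*) [Category 𝒞] [ModelCategory 𝒞] : Prop where
  locallyPresentable : IsLocallyPresentable.{u} 𝒞
  cofibrantlyGenerated : ∃ I J : MorphismProperty 𝒞,
    MorphismProperty.IsSmall.{u} I ∧ MorphismProperty.IsSmall.{u} J ∧
      trivialFibrations 𝒞 = I.rlp ∧ fibrations 𝒞 = J.rlp

/-- The model structure on `𝒞` is left-induced along the functor `F`: `F` creates the weak
equivalences and the cofibrations. -/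
structure IsLeftInduced (F : 𝒞 ⥤ 𝒟) : Prop where
  weakEquivalences_eq : weakEquivalences 𝒞 = (weakEquivalences 𝒟).inverseImage F
  cofibrations_eq : cofibrations 𝒞 = (cofibrations 𝒟).inverseImage F

/-- An adjunction `F ⊣ G` of model categories is a Quillen adjunction if `F` preserves cofibrations
and trivial cofibrations. -/
structure IsQuillenAdjunction {F : 𝒞 ⥤ 𝒟} {G : 𝒟 ⥤ 𝒞} (_ : F ⊣ G) : Prop where
  map_cofibration : ∀ ⦃X Y : 𝒞⦄ (f : X ⟶ Y), cofibrations 𝒞 f → cofibrations 𝒟 (F.map f)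
  map_trivialCofibration : ∀ ⦃X Y : 𝒞⦄ (f : X ⟶ Y),
    trivialCofibrations 𝒞 f → trivialCofibrations 𝒟 (F.map f)

/-- A Quillen adjunction `F ⊣ G` is a Quillen equivalence if for all cofibrant `X` and fibrant `Y`,
a morphism `F X ⟶ Y` is a weak equivalence if and only if its adjunct `X ⟶ G Y` is. -/
structure IsQuillenEquivalence {F : 𝒞 ⥤ 𝒟} {G : 𝒟 ⥤ 𝒞} (adj : F ⊣ G) : Prop extends
    IsQuillenAdjunction adj where
  weakEquivalence_iff : ∀ (X : 𝒞) (Y : 𝒟) [IsCofibrant X] [IsFibrant Y] (f : F.obj X ⟶ Y),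
    weakEquivalences 𝒟 f ↔ weakEquivalences 𝒞 (adj.homEquiv X Y f)

end Model

/-- A model structure on dg modules is the projective one if its weak equivalences are the
quasi-isomorphisms and its fibrations are the degreewise epimorphisms. -/
structure IsProjectiveModelStructure (A : DGAlg.{u}) [ModelCategory (DGMod A)] : Prop where
  weakEquivalences_eq : weakEquivalences (DGMod A) = DGMod.quasiIso A
  fibrations_eq : fibrations (DGMod A) = DGMod.degreewiseEpi A

section Universal

variable (C : DGCoalg.{u}) (η : Coaugmentation C)

/-- The functor `t^! : C-Comod ⥤ ΩC-Mod`. -/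
abbrev tShriek : DGComod C ⥤ DGMod (cobar C η) := extFunctor (universalTwist C η)

/-- The functor `t_* : ΩC-Mod ⥤ C-Comod`. -/
abbrev tLowerStar : DGMod (cobar C η) ⥤ DGComod C := coextFunctor (universalTwist C η)

/-- The adjunction `t^! ⊣ t_*`. -/
abbrev tAdj : tShriek C η ⊣ tLowerStar C η := twistAdj (universalTwist C η)

/-- The `t`-equivalences: the morphisms `f` of dg comodules such that `t^! f` is a
quasi-isomorphism. -/
def tEquivalences : MorphismProperty (DGComod C) :=
  (DGMod.quasiIso (cobar C η)).inverseImage (tShriek C η)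

end Universal

end

end DGKoszul

/-! Two facts carry the theorem; the rest is formal or a count of cardinalities.

The first is that the counit `t^! t_* M → M` is a quasi-isomorphism for every module `M`
(`quasiIso_counitHom`). Underneath, `ΩC ⊗ C ⊗ M` contains the standard two-term resolution `0 → ΩC ⊗
C̄ ⊗ M → ΩC ⊗ M → M → 0` of a module over a tensor algebra. This resolution is split by an explicit
crossed homomorphism, and the splitting produces primitives of all cycles in the kernel of the
counit, with no filtration or convergence argument. By the triangle identity the unit is then a
`t`-equivalence. Since a map `t^! X → Y` is `t^!` of its adjunct followed by the counit, the Quillen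
equivalence is two-out-of-three.

The second is that `t^!` turns injections into cofibrations (`hasLiftingProperty_tShriek`). Because
`C` is connected and an element of `C ⊗ N` involves finitely many degrees of `C`, every proper
subcomodule `S` admits a homogeneous element outside it that is primitive modulo `S` and has
differential in `S` (`exists_primitive`). As `te = 0`, adjoining it changes `t^!` by a single cell.
Zorn's lemma on partial lifts then replaces transfinite induction. Conversely, cofibrations of
modules are injective, and an injective `t^! f` has `f` injective, so the cofibrations are exactly
the monomorphisms.

The factorizations are written down without the small object argument. For modules, adding a free
module on disks gives the acyclic one. The other (`DGMod.exists_cell_factorization`) embeds `t_* M`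
in the product of `t_* N` with a cofree comodule on disks, applies `t^!`, and pushes out along the
counit of `M`. For comodules, `cofreeDisks` is right adjoint to the functor to bare vector spaces,
hence injective, and it is contractible: this gives the factorization into a monomorphism and a
trivial fibration. The other one (`DGComod.exists_trivCof_factorization`) factors `t^! f`, applies
`t_*`, and pulls back along the unit of the target.

For combinatoriality, every element lies in a small subcomodule, which can moreover be closed under
chosen solutions of `z = dw` modulo `S`. So lifting against all (trivial) cofibrations reduces to
lifting against those between objects of bounded size, and countable comodules form a strong
generator of presentable objects. Colimits exist because comodules are comonadic over vector spaces.
-/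

open Limits

namespace DGKoszul

set_option linter.unusedVariables false
set_option linter.unusedSectionVars false

noncomputable section

/-! ### Homogeneous components -/

namespace DGVect

/-- The projection of a complex onto its component of degree `n`. -/
def proj (V : DGVect.{u}) (n : ℤ) : V.carrier →ₗ[ℚ] V.carrier :=
  gradedLift V.gr V.isInternal fun m => if m = n then (V.gr m).subtype else 0

variable (V : DGVect.{u})

theorem proj_of_mem {m : ℤ} (n : ℤ) {x : V.carrier} (hx : x ∈ V.gr m) :
    V.proj n x = if m = n then x else 0 := by
  rw [proj, gradedLift_of_mem _ _ _ hx]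
  split_ifs <;> rfl

theorem proj_same {n : ℤ} {x : V.carrier} (hx : x ∈ V.gr n) : V.proj n x = x := by
  rw [V.proj_of_mem n hx, if_pos rfl]

theorem proj_ne {m n : ℤ} (h : m ≠ n) {x : V.carrier} (hx : x ∈ V.gr m) : V.proj n x = 0 := by
  rw [V.proj_of_mem n hx, if_neg h]

theorem homogeneous_induction {P : V.carrier → Prop} (zero : P 0)
    (mem : ∀ n, ∀ x ∈ V.gr n, P x) (add : ∀ x y, P x → P y → P (x + y)) (x : V.carrier) : P x := by
  have hx : x ∈ ⨆ n, V.gr n := V.isInternal.submodule_iSup_eq_top ▸ Submodule.mem_top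
  induction hx using Submodule.iSup_induction' with
  | mem i x hx => exact mem i x hx
  | zero => exact zero
  | add x y _ _ hx hy => exact add x y hx hy

theorem proj_mem (n : ℤ) (x : V.carrier) : V.proj n x ∈ V.gr n := by
  induction x using V.homogeneous_induction with
  | zero => simp
  | mem m x hx =>
    rw [V.proj_of_mem n hx]
    split_ifs with h
    · exact h ▸ hx
    · exact zero_mem _
  | add x y hx hy => rw [map_add]; exact add_mem hx hy

theorem mem_gr_iff {n : ℤ} {x : V.carrier} : x ∈ V.gr n ↔ V.proj n x = x :=
  ⟨V.proj_same, fun h => h ▸ V.proj_mem n x⟩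

/-- An element is the finite sum of its components. `S` is an arbitrary subspace, so any linear
existence statement can be reduced to homogeneous elements. -/
theorem mem_of_proj_mem {S : Submodule ℚ V.carrier} {x : V.carrier}
    (h : ∀ n, V.proj n x ∈ S) : x ∈ S := by
  have key : ∃ s : Finset ℤ, x = ∑ n ∈ s, V.proj n x := by
    -- Asking for all larger index sets lets the supports of two summands be replaced by their
    -- union.
    have : ∃ s : Finset ℤ, ∀ t, s ⊆ t → x = ∑ n ∈ t, V.proj n x := by
      clear h
      induction x using V.homogeneous_induction with
      | zero => exact ⟨∅, by simp⟩
      | mem m x hx =>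
        refine ⟨{m}, fun t ht => ?_⟩
        rw [Finset.sum_eq_single_of_mem m (ht (Finset.mem_singleton_self m))
          fun b _ hb => V.proj_ne (Ne.symm hb) hx, V.proj_same hx]
      | add x y hx hy =>
        obtain ⟨s, hs⟩ := hx
        obtain ⟨t, ht⟩ := hy
        classical
        refine ⟨s ∪ t, fun r hr => ?_⟩
        simp only [map_add, Finset.sum_add_distrib]
        rw [← hs r (Finset.union_subset_left hr), ← ht r (Finset.union_subset_right hr)]
    exact ⟨this.choose, this.choose_spec _ subset_rfl⟩
  obtain ⟨s, hs⟩ := key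
  rw [hs]
  exact Submodule.sum_mem _ fun n _ => h n

theorem map_proj {V W : DGVect.{u}} {f : V.carrier →ₗ[ℚ] W.carrier} {k : ℤ}
    (hf : ∀ n, ∀ x ∈ V.gr n, f x ∈ W.gr (n + k)) (n : ℤ) (x : V.carrier) :
    f (V.proj n x) = W.proj (n + k) (f x) := by
  induction x using V.homogeneous_induction with
  | zero => simp
  | mem m x hx =>
    rw [V.proj_of_mem n hx, W.proj_of_mem (n + k) (hf m x hx)]
    by_cases h : m = n
    · simp [h]
    · rw [if_neg h, if_neg (by omega), map_zero]
  | add x y hx hy => simp only [map_add, hx, hy]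

theorem map_proj₀ {V W : DGVect.{u}} {f : V.carrier →ₗ[ℚ] W.carrier}
    (hf : ∀ n, ∀ x ∈ V.gr n, f x ∈ W.gr n) (n : ℤ) (x : V.carrier) :
    f (V.proj n x) = W.proj n (f x) := by
  have := map_proj (f := f) (k := 0) (fun n x hx => by simpa using hf n x hx) n x
  simpa using this

/-- Commutation with the projections is an equational form of preserving degree: it can be checked
on a generating family of subspaces or at a late stage of a colimit. -/
theorem mem_gr_of_commutes {V W : DGVect.{u}} {f : V.carrier →ₗ[ℚ] W.carrier}
    (hf : ∀ n x, f (V.proj n x) = W.proj n (f x)) (n : ℤ) (x : V.carrier) (hx : x ∈ V.gr n) :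
    f x ∈ W.gr n := by
  rw [mem_gr_iff, ← hf, V.proj_same hx]

theorem d_proj (n : ℤ) (x : V.carrier) : V.d (V.proj n x) = V.proj (n - 1) (V.d x) :=
  map_proj (k := -1) V.d_mem n x

theorem proj_d (n : ℤ) (x : V.carrier) : V.proj n (V.d x) = V.d (V.proj (n + 1) x) := by
  rw [V.d_proj, add_sub_cancel_right]

end DGVect

/-- The additive maps `π n` read off the summands of an element of the external direct sum from its
image, which gives injectivity. -/
theorem isInternal_of_proj {V : Type*} [AddCommGroup V] [Module ℚ V] {𝒱 : ℤ → Submodule ℚ V}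
    (π : ℤ → V → V)
    (hadd : ∀ n x y, π n (x + y) = π n x + π n y)
    (hπ : ∀ m n, ∀ x ∈ 𝒱 m, π n x = if m = n then x else 0)
    (htop : ∀ x, x ∈ ⨆ n, 𝒱 n) : DirectSum.IsInternal 𝒱 := by
  have h0 : ∀ n, π n 0 = 0 := fun n => by simpa using hπ n n 0 (zero_mem _)
  refine ⟨?_, ?_⟩
  · have key : ∀ z : DirectSum ℤ (fun n => 𝒱 n), ∀ n,
        π n (DirectSum.coeLinearMap 𝒱 z) = (z n : V) := by
      intro z n
      induction z using DirectSum.induction_on with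
      | zero => simp [h0]
      | of i x =>
        rw [DirectSum.coeLinearMap_of, hπ i n x x.2]
        split_ifs with h
        · subst h; simp
        · rw [DirectSum.of_eq_of_ne _ _ _ (Ne.symm h)]; simp
      | add x y hx hy => simp [hadd, hx, hy]
    intro z z' hz
    ext n
    rw [← key z n, ← key z' n]
    exact congrArg (fun v => π n v) hz
  · change Function.Surjective (DirectSum.coeLinearMap 𝒱)
    rw [← LinearMap.range_eq_top, DirectSum.range_coeLinearMap, eq_top_iff]
    exact fun x _ => htop x

/-! ### Subcomplexes, quotient complexes and products -/

/-- A subspace of a complex which is graded and closed under the differential. -/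
structure DGVect.IsSub (V : DGVect.{u}) (S : Submodule ℚ V.carrier) : Prop where
  proj_mem : ∀ n, ∀ x ∈ S, V.proj n x ∈ S
  d_mem : ∀ x ∈ S, V.d x ∈ S

/-- A subcomplex. -/
abbrev DGVect.sub (V : DGVect.{u}) (S : Submodule ℚ V.carrier) (h : V.IsSub S) : DGVect.{u} where
  carrier := S
  gr n := (V.gr n).comap S.subtype
  isInternal := by
    refine isInternal_of_proj (fun n => (V.proj n).restrict (h.proj_mem n))
      (fun n x y => map_add _ x y) ?_ ?_
    · rintro m n x hx
      apply Subtype.ext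
      refine (V.proj_of_mem (x := (x : V.carrier)) n hx).trans ?_
      split_ifs <;> rfl
    · intro x
      have : (x : V.carrier) ∈ (⨆ n, (V.gr n).comap S.subtype).map S.subtype :=
        V.mem_of_proj_mem fun n => ⟨⟨V.proj n x, h.proj_mem n x x.2⟩,
          Submodule.mem_iSup_of_mem n (V.proj_mem n x), rfl⟩
      obtain ⟨y, hy, hyx⟩ := this
      rwa [← Subtype.ext hyx]
  d := V.d.restrict h.d_mem
  d_mem n x hx := V.d_mem n x hx
  d_d x := Subtype.ext (V.d_d x)

/-- The product of two complexes. -/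
abbrev DGVect.prod (V W : DGVect.{u}) : DGVect.{u} where
  carrier := V.carrier × W.carrier
  gr n := (V.gr n).prod (W.gr n)
  isInternal := by
    refine isInternal_of_proj (fun n => (V.proj n).prodMap (W.proj n))
      (fun n x y => map_add _ x y) ?_ ?_
    · rintro m n ⟨x, y⟩ ⟨hx, hy⟩
      change (V.proj n x, W.proj n y) = _
      rw [V.proj_of_mem n hx, W.proj_of_mem n hy]
      split_ifs <;> rfl
    · rintro ⟨x, y⟩
      have h1 : ((x, 0) : V.carrier × W.carrier) ∈ ⨆ n, (V.gr n).prod (W.gr n) :=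
        V.mem_of_proj_mem (S := (⨆ n, (V.gr n).prod (W.gr n)).comap (LinearMap.inl ℚ _ _))
          fun n => Submodule.mem_iSup_of_mem n ⟨V.proj_mem n x, zero_mem _⟩
      have h2 : ((0, y) : V.carrier × W.carrier) ∈ ⨆ n, (V.gr n).prod (W.gr n) :=
        W.mem_of_proj_mem (S := (⨆ n, (V.gr n).prod (W.gr n)).comap (LinearMap.inr ℚ _ _))
          fun n => Submodule.mem_iSup_of_mem n ⟨zero_mem _, W.proj_mem n y⟩
      simpa using add_mem h1 h2
  d := V.d.prodMap W.d
  d_mem n x hx := ⟨V.d_mem n _ hx.1, W.d_mem n _ hx.2⟩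
  d_d x := by ext <;> simp [V.d_d, W.d_d]

/-- The zero complex. -/
abbrev DGVect.zero : DGVect.{u} where
  carrier := PUnit
  gr _ := ⊤
  isInternal := isInternal_of_proj (fun _ x => x) (fun _ _ _ => rfl)
    (fun _ _ _ _ => Subsingleton.elim _ _) (fun _ => Submodule.mem_iSup_of_mem 0 trivial)
  d := 0
  d_mem _ _ _ := trivial
  d_d _ := rfl

/-! ### Quasi-isomorphisms, without gradings -/

section QIso

variable {U V W : Type*} [AddCommGroup U] [AddCommGroup V] [AddCommGroup W] [Module ℚ U]
  [Module ℚ V] [Module ℚ W] {dU : U →ₗ[ℚ] U} {dV : V →ₗ[ℚ] V} {dW : W →ₗ[ℚ] W}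

/-- A map of differential spaces inducing a bijection on homology. -/
structure QIso (dV : V →ₗ[ℚ] V) (dW : W →ₗ[ℚ] W) (f : V →ₗ[ℚ] W) : Prop where
  inj : ∀ x, dV x = 0 → ∀ y, dW y = f x → ∃ w, dV w = x
  surj : ∀ y, dW y = 0 → ∃ x, dV x = 0 ∧ ∃ w, f x = y + dW w

/-- A differential space with vanishing homology. -/
def Acyclic (dV : V →ₗ[ℚ] V) : Prop := ∀ x, dV x = 0 → ∃ w, dV w = x

theorem QIso.comp {f : U →ₗ[ℚ] V} {g : V →ₗ[ℚ] W} (hfd : ∀ x, f (dU x) = dV (f x))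
    (hgd : ∀ x, g (dV x) = dW (g x)) (hf : QIso dU dV f) (hg : QIso dV dW g) :
    QIso dU dW (g ∘ₗ f) where
  inj x hx y hy := by
    obtain ⟨w, hw⟩ := hg.inj (f x) (by rw [← hfd, hx, map_zero]) y hy
    exact hf.inj x hx w hw
  surj y hy := by
    obtain ⟨x', hx', w, hw⟩ := hg.surj y hy
    obtain ⟨x, hx, v, hv⟩ := hf.surj x' hx'
    refine ⟨x, hx, w + g v, ?_⟩
    rw [LinearMap.comp_apply, hv, map_add, hw, map_add, hgd, add_assoc]

theorem QIso.of_postcomp {f : U →ₗ[ℚ] V} {g : V →ₗ[ℚ] W} (hfd : ∀ x, f (dU x) = dV (f x))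
    (hgd : ∀ x, g (dV x) = dW (g x)) (hg : QIso dV dW g) (hgf : QIso dU dW (g ∘ₗ f)) :
    QIso dU dV f where
  inj x hx y hy := hgf.inj x hx (g y) (by rw [← hgd, hy]; rfl)
  surj y hy := by
    obtain ⟨x, hx, w, hw⟩ := hgf.surj (g y) (by rw [← hgd, hy, map_zero])
    obtain ⟨v, hv⟩ := hg.inj (f x - y) (by rw [map_sub, ← hfd, hx, hy, map_zero, sub_zero]) w
      (by rw [map_sub, ← LinearMap.comp_apply, hw]; abel)
    exact ⟨x, hx, v, by rw [hv]; abel⟩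

theorem QIso.of_precomp {f : U →ₗ[ℚ] V} {g : V →ₗ[ℚ] W} (hfd : ∀ x, f (dU x) = dV (f x))
    (hgd : ∀ x, g (dV x) = dW (g x)) (hf : QIso dU dV f) (hgf : QIso dU dW (g ∘ₗ f)) :
    QIso dV dW g where
  inj x hx y hy := by
    obtain ⟨x', hx', w, hw⟩ := hf.surj x hx
    obtain ⟨v, hv⟩ := hgf.inj x' hx' (y + g w) (by
      rw [map_add, hy, ← hgd, LinearMap.comp_apply, hw, map_add])
    exact ⟨f v - w, by rw [map_sub, ← hfd, hv, hw]; abel⟩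
  surj y hy := by
    obtain ⟨x, hx, w, hw⟩ := hgf.surj y hy
    exact ⟨f x, by rw [← hfd, hx, map_zero], w, hw⟩

/-- A surjective map with acyclic kernel is a quasi-isomorphism. -/
theorem QIso.of_surjective {f : V →ₗ[ℚ] W} (hfd : ∀ x, f (dV x) = dW (f x))
    (hdd : ∀ x, dV (dV x) = 0) (hf : Function.Surjective f)
    (hk : ∀ x, f x = 0 → dV x = 0 → ∃ w, f w = 0 ∧ dV w = x) : QIso dV dW f where
  inj x hx y hy := by
    obtain ⟨v, rfl⟩ := hf y
    obtain ⟨w, -, hw⟩ := hk (x - dV v) (by rw [map_sub, hfd, hy, sub_self])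
      (by rw [map_sub, hx, hdd, sub_zero])
    exact ⟨w + v, by rw [map_add, hw]; abel⟩
  surj y hy := by
    obtain ⟨v, rfl⟩ := hf y
    obtain ⟨u, hu, hu'⟩ := hk (dV v) (by rw [hfd, hy]) (hdd v)
    exact ⟨v - u, by rw [map_sub, hu', sub_self], 0, by rw [map_sub, hu]; simp⟩

/-- The kernel of a surjective quasi-isomorphism is acyclic. -/
theorem QIso.ker_acyclic {f : V →ₗ[ℚ] W} (hfd : ∀ x, f (dV x) = dW (f x))
    (hf : Function.Surjective f) (h : QIso dV dW f) (hdd : ∀ x, dV (dV x) = 0)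
    (x : V) (hx : f x = 0) (hx' : dV x = 0) :
    ∃ w, f w = 0 ∧ dV w = x := by
  obtain ⟨w, rfl⟩ := h.inj x hx' 0 (by rw [hx, map_zero])
  obtain ⟨v, hv, u, hu⟩ := h.surj (f w) (by rw [← hfd, hx])
  obtain ⟨u, rfl⟩ := hf u
  refine ⟨w - v + dV u, ?_, ?_⟩
  · rw [map_add, map_sub, hu, hfd]; abel
  · rw [map_add, map_sub, hv, hdd, sub_zero, add_zero]

/-- An injective map with acyclic cokernel is a quasi-isomorphism. -/
theorem QIso.iff_of_injective {f : V →ₗ[ℚ] W} (hfd : ∀ x, f (dV x) = dW (f x))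
    (hdd : ∀ x, dW (dW x) = 0) (hf : Function.Injective f) : QIso dV dW f ↔
      ∀ y, dW y ∈ LinearMap.range f → ∃ w, y - dW w ∈ LinearMap.range f := by
  constructor
  · rintro h y ⟨x, hx⟩
    obtain ⟨w, rfl⟩ := h.inj x (hf (by rw [hfd, hx, hdd, map_zero])) y hx.symm
    obtain ⟨v, hv, u, hu⟩ := h.surj (y - f w) (by rw [map_sub, ← hx, hfd, sub_self])
    exact ⟨-u, v + w, by rw [map_add, hu, map_neg]; abel⟩
  · intro h
    refine ⟨fun x hx y hy => ?_, fun y hy => ?_⟩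
    · obtain ⟨w, v, hv⟩ := h y ⟨x, hy.symm⟩
      exact ⟨v, hf (by rw [hfd, hv, map_sub, hdd, sub_zero, hy])⟩
    · obtain ⟨w, v, hv⟩ := h y ⟨0, by rw [hy, map_zero]⟩
      exact ⟨v, hf (by rw [hfd, hv, map_sub, hdd, hy, map_zero, sub_zero]), -w, by
        rw [hv, map_neg, sub_eq_add_neg]⟩

end QIso

/-! ### Quasi-isomorphisms of dg modules -/

/-- The homology of a map of complexes can be computed without the gradings. -/
theorem bijective_homologyMap_iff {V W : DGVect.{u}} (f : V.carrier →ₗ[ℚ] W.carrier)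
    (hf : ∀ n, ∀ x ∈ V.gr n, f x ∈ W.gr n) (hd : ∀ x, f (V.d x) = W.d (f x)) :
    (∀ n, Function.Bijective (homologyMap f hf hd n)) ↔ QIso V.d W.d f := by
  have hp := V.map_proj₀ hf
  constructor
  · intro h
    refine ⟨fun x hx y hy => ?_, fun y hy => ?_⟩
    · change x ∈ LinearMap.range V.d
      refine V.mem_of_proj_mem fun n => ?_
      have hc : V.proj n x ∈ V.cycles n :=
        ⟨V.proj_mem n x, by
          change V.d _ = 0
          rw [V.d_proj, hx, map_zero]⟩
      have h0 : homologyMap f hf hd n (Submodule.Quotient.mk ⟨V.proj n x, hc⟩) = 0 := by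
        refine (Submodule.Quotient.mk_eq_zero _).2 ⟨W.proj (n + 1) y, W.proj_mem _ _, ?_⟩
        rw [← W.proj_d, hy, ← hp]
        rfl
      have h1 := (injective_iff_map_eq_zero _).1 (h n).1 _ h0
      obtain ⟨w, -, hw⟩ := (Submodule.Quotient.mk_eq_zero _).1 h1
      exact ⟨w, hw⟩
    -- Surjectivity on homology says that every cycle `y` lies in this subspace, which can be tested
    -- one degree at a time.
    · let S : Submodule ℚ W.carrier := (LinearMap.ker V.d).map f ⊔ LinearMap.range W.d
      have : y ∈ S := by
        refine W.mem_of_proj_mem fun n => ?_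
        have hc : W.proj n y ∈ W.cycles n :=
          ⟨W.proj_mem n y, by
            change W.d _ = 0
            rw [W.d_proj, hy, map_zero]⟩
        obtain ⟨q, hq⟩ := (h n).2 (Submodule.Quotient.mk ⟨W.proj n y, hc⟩)
        obtain ⟨⟨x, hx⟩, rfl⟩ := Submodule.mkQ_surjective _ q
        obtain ⟨w, -, hw⟩ := (Submodule.Quotient.eq _).1 hq
        have hw' : W.d w = f x - W.proj n y := hw
        refine Submodule.mem_sup.2 ⟨f x, ⟨x, hx.2, rfl⟩, W.d (-w), ⟨-w, rfl⟩, ?_⟩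
        rw [map_neg, hw']; abel
      obtain ⟨_, ⟨x, hx, rfl⟩, _, ⟨w, rfl⟩, hxw⟩ := Submodule.mem_sup.1 this
      exact ⟨x, hx, -w, by rw [← hxw, map_neg]; abel⟩
  · intro h n
    constructor
    · rw [injective_iff_map_eq_zero]
      intro q hq
      obtain ⟨⟨x, hx⟩, rfl⟩ := Submodule.mkQ_surjective _ q
      obtain ⟨y, -, hy⟩ := (Submodule.Quotient.mk_eq_zero _).1 hq
      obtain ⟨w, hw⟩ := h.inj x hx.2 y hy
      refine (Submodule.Quotient.mk_eq_zero _).2 ⟨V.proj (n + 1) w, V.proj_mem _ _, ?_⟩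
      rw [← V.proj_d, hw]
      exact V.proj_same hx.1
    · intro q
      obtain ⟨⟨y, hy⟩, rfl⟩ := Submodule.mkQ_surjective _ q
      obtain ⟨x, hx, w, hw⟩ := h.surj y hy.2
      have hc : V.proj n x ∈ V.cycles n :=
        ⟨V.proj_mem n x, by
          change V.d _ = 0
          rw [V.d_proj, hx, map_zero]⟩
      refine ⟨Submodule.Quotient.mk ⟨V.proj n x, hc⟩, ?_⟩
      refine (Submodule.Quotient.eq _).2 ⟨W.proj (n + 1) w, W.proj_mem _ _, ?_⟩
      change _ = f (V.proj n x) - y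
      rw [← W.proj_d, hp, hw, map_add, W.proj_same hy.1, add_sub_cancel_left]

namespace DGMod

variable {A : DGAlg.{u}} {M N P : DGMod A}

/-- The `ℚ`-linear map underlying a morphism of dg modules. -/
abbrev Hom.linQ (f : M ⟶ N) : M.carrier →ₗ[ℚ] N.carrier := (Hom.lin f).restrictScalars ℚ

theorem quasiIso_iff (f : M ⟶ N) : quasiIso A f ↔ QIso M.d N.d (Hom.linQ f) :=
  bijective_homologyMap_iff _ _ _

instance : (quasiIso A).HasTwoOutOfThreeProperty where
  comp_mem f g hf hg := by
    rw [quasiIso_iff] at *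
    exact hf.comp (Hom.map_d f) (Hom.map_d g) hg
  of_postcomp f g hg hfg := by
    rw [quasiIso_iff] at *
    exact hg.of_postcomp (Hom.map_d f) (Hom.map_d g) hfg
  of_precomp f g hf hfg := by
    rw [quasiIso_iff] at *
    exact hf.of_precomp (Hom.map_d f) (Hom.map_d g) hfg

theorem quasiIso_id (M : DGMod A) : quasiIso A (𝟙 M) := by
  rw [quasiIso_iff]
  exact ⟨fun x _ y hy => ⟨y, hy⟩, fun y hy => ⟨y, hy, 0, by simp⟩⟩

theorem degreewiseEpi_iff (f : M ⟶ N) : degreewiseEpi A f ↔ Function.Surjective (Hom.lin f) := by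
  constructor
  · intro h y
    change y ∈ LinearMap.range (Hom.linQ f)
    refine N.mem_of_proj_mem fun n => ?_
    obtain ⟨x, -, hx⟩ := h n _ (N.proj_mem n y)
    exact ⟨x, hx⟩
  · intro h n y hy
    obtain ⟨x, rfl⟩ := h y
    refine ⟨M.proj n x, M.proj_mem n x, ?_⟩
    have := M.map_proj₀ (f := Hom.linQ f) (Hom.map_mem f) n x
    exact this.trans (N.proj_same hy)

/-! ### Finite limits and colimits of dg modules -/

variable (M) in
/-- The quotient of a dg module by a dg submodule. -/
def quot (S : Submodule A.carrier M.carrier) (h : M.toDGVect.IsSub (S.restrictScalars ℚ)) :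
    DGMod A where
  carrier := M.carrier ⧸ S
  gr n := (M.gr n).map (S.mkQ.restrictScalars ℚ)
  isInternal := by
    refine isInternal_of_proj (fun n => (S.restrictScalars ℚ).mapQ (S.restrictScalars ℚ)
      (M.proj n) (h.proj_mem n)) (fun n x y => map_add _ x y) ?_ ?_
    · rintro m n _ ⟨x, hx, rfl⟩
      refine (congrArg S.mkQ (M.proj_of_mem n hx)).trans ?_
      split_ifs <;> simp
    · intro x
      obtain ⟨x, rfl⟩ := S.mkQ_surjective x
      rw [← Submodule.map_iSup, M.isInternal.submodule_iSup_eq_top]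
      exact ⟨x, trivial, rfl⟩
  d := (S.restrictScalars ℚ).liftQ (S.mkQ.restrictScalars ℚ ∘ₗ M.d) fun x hx =>
    (Submodule.Quotient.mk_eq_zero S).2 (h.d_mem x hx)
  d_mem := by
    rintro n _ ⟨x, hx, rfl⟩
    exact ⟨M.d x, M.d_mem n x hx, rfl⟩
  d_d x := by
    obtain ⟨x, rfl⟩ := S.mkQ_surjective x
    exact congrArg S.mkQ (M.d_d x)
  smul_mem := by
    rintro i j a ha _ ⟨x, hx, rfl⟩
    exact ⟨a • x, M.smul_mem i j a ha x hx, rfl⟩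
  d_smul i a ha x := by
    obtain ⟨x, rfl⟩ := S.mkQ_surjective x
    refine (congrArg S.mkQ (M.d_smul i a ha x)).trans ?_
    rw [map_add]
    rcases Int.units_eq_one_or i.negOnePow with h | h <;> simp [h] <;> rfl

/-- The projection onto a quotient. -/
def quotMk (S : Submodule A.carrier M.carrier) (h : M.toDGVect.IsSub (S.restrictScalars ℚ)) :
    M ⟶ M.quot S h where
  lin := S.mkQ
  map_mem _ x hx := ⟨x, hx, rfl⟩
  map_d _ := rfl

/-- The morphism out of a quotient induced by a morphism. -/
def quotDesc (S : Submodule A.carrier M.carrier) (h : M.toDGVect.IsSub (S.restrictScalars ℚ))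
    (f : M ⟶ N) (hf : ∀ x ∈ S, Hom.lin f x = 0) : M.quot S h ⟶ N where
  lin := S.liftQ (Hom.lin f) hf
  map_mem := by
    rintro n _ ⟨x, hx, rfl⟩
    exact Hom.map_mem f n x hx
  map_d x := by
    obtain ⟨x, rfl⟩ := S.mkQ_surjective x
    exact Hom.map_d f x

theorem quot_hom_ext {S : Submodule A.carrier M.carrier}
    {h : M.toDGVect.IsSub (S.restrictScalars ℚ)} {f g : M.quot S h ⟶ N}
    (hfg : quotMk S h ≫ f = quotMk S h ≫ g) : f = g := by
  apply hom_ext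
  intro x
  obtain ⟨x, rfl⟩ := S.mkQ_surjective x
  exact LinearMap.congr_fun (congrArg Hom.lin hfg) x

variable (M) in
/-- A dg submodule. -/
def sub (S : Submodule A.carrier M.carrier) (h : M.toDGVect.IsSub (S.restrictScalars ℚ)) :
    DGMod A :=
  { M.toDGVect.sub (S.restrictScalars ℚ) h with
    moduleA := inferInstanceAs (Module A.carrier S)
    tower := inferInstanceAs (IsScalarTower ℚ A.carrier S)
    smul_mem := fun i j a ha x hx => M.smul_mem i j a ha x hx
    d_smul := fun i a ha x => Subtype.ext <| by
      refine (M.d_smul i a ha x).trans ?_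
      rcases Int.units_eq_one_or i.negOnePow with h | h
      · simp [h]; rfl
      · simp [h]; rfl }

variable (M N) in
/-- The direct sum of two dg modules. -/
def prod : DGMod A :=
  { M.toDGVect.prod N.toDGVect with
    moduleA := inferInstanceAs (Module A.carrier (M.carrier × N.carrier))
    tower := inferInstanceAs (IsScalarTower ℚ A.carrier (M.carrier × N.carrier))
    smul_mem := fun i j a ha x hx => ⟨M.smul_mem i j a ha x.1 hx.1, N.smul_mem i j a ha x.2 hx.2⟩
    d_smul := fun i a ha x => Prod.ext (M.d_smul i a ha x.1) (N.d_smul i a ha x.2) }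

/-- The zero dg module. -/
def zero (A : DGAlg.{u}) : DGMod A :=
  { DGVect.zero.{u} with
    moduleA := inferInstanceAs (Module A.carrier PUnit.{u + 1})
    tower := inferInstanceAs (IsScalarTower ℚ A.carrier PUnit.{u + 1})
    smul_mem := fun _ _ _ _ _ _ => trivial
    d_smul := fun _ _ _ _ => rfl }

/-- The zero morphism. -/
def zeroHom (M N : DGMod A) : M ⟶ N where
  lin := 0
  map_mem _ _ _ := zero_mem _
  map_d _ := (map_zero N.d).symm

/-- The first projection. -/
def fst : M.prod N ⟶ M where
  lin := LinearMap.fst A.carrier M.carrier N.carrier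
  map_mem _ _ hx := hx.1
  map_d _ := rfl

/-- The second projection. -/
def snd : M.prod N ⟶ N where
  lin := LinearMap.snd A.carrier M.carrier N.carrier
  map_mem _ _ hx := hx.2
  map_d _ := rfl

/-- The first inclusion. -/
def inl : M ⟶ M.prod N where
  lin := LinearMap.inl A.carrier M.carrier N.carrier
  map_mem _ _ hx := ⟨hx, zero_mem _⟩
  map_d x := Prod.ext rfl (map_zero N.d).symm

/-- The second inclusion. -/
def inr : N ⟶ M.prod N where
  lin := LinearMap.inr A.carrier M.carrier N.carrier
  map_mem _ _ hx := ⟨zero_mem _, hx⟩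
  map_d x := Prod.ext (map_zero M.d).symm rfl

/-- The morphism into a direct sum with given components. -/
def lift (f : P ⟶ M) (g : P ⟶ N) : P ⟶ M.prod N where
  lin := (Hom.lin f).prod (Hom.lin g)
  map_mem n x hx := ⟨Hom.map_mem f n x hx, Hom.map_mem g n x hx⟩
  map_d x := Prod.ext (Hom.map_d f x) (Hom.map_d g x)

/-- The morphism out of a direct sum with given components. -/
def desc (f : M ⟶ P) (g : N ⟶ P) : M.prod N ⟶ P where
  lin := (Hom.lin f).coprod (Hom.lin g)
  map_mem n x hx := add_mem (Hom.map_mem f n x.1 hx.1) (Hom.map_mem g n x.2 hx.2)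
  map_d x := by
    refine (congrArg₂ (· + ·) (Hom.map_d f x.1) (Hom.map_d g x.2)).trans (map_add P.d _ _).symm

theorem prod_hom_ext {f g : M.prod N ⟶ P} (h1 : inl ≫ f = inl ≫ g) (h2 : inr ≫ f = inr ≫ g) :
    f = g :=
  Hom.ext (LinearMap.prod_ext (congrArg Hom.lin h1) (congrArg Hom.lin h2))

theorem isSub_eqLocus (f g : M ⟶ N) :
    M.toDGVect.IsSub ((LinearMap.eqLocus (Hom.lin f) (Hom.lin g)).restrictScalars ℚ) where
  proj_mem n x hx := by
    have h1 := M.map_proj₀ (f := Hom.linQ f) (Hom.map_mem f) n x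
    have h2 := M.map_proj₀ (f := Hom.linQ g) (Hom.map_mem g) n x
    have h3 : Hom.linQ f x = Hom.linQ g x := hx
    exact h1.trans ((congrArg _ h3).trans h2.symm)
  d_mem x hx := by
    have h3 : Hom.lin f x = Hom.lin g x := hx
    exact (Hom.map_d f x).trans ((congrArg _ h3).trans (Hom.map_d g x).symm)

theorem isSub_range (f : M ⟶ N) :
    N.toDGVect.IsSub ((LinearMap.range (Hom.lin f)).restrictScalars ℚ) where
  proj_mem := by
    rintro n _ ⟨x, rfl⟩
    exact ⟨M.proj n x, M.map_proj₀ (f := Hom.linQ f) (Hom.map_mem f) n x⟩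
  d_mem := by
    rintro _ ⟨x, rfl⟩
    exact ⟨M.d x, Hom.map_d f x⟩

theorem isSub_ker (f : M ⟶ N) :
    M.toDGVect.IsSub ((LinearMap.ker (Hom.lin f)).restrictScalars ℚ) where
  proj_mem n x hx := by
    have hx : Hom.linQ f x = 0 := hx
    exact (M.map_proj₀ (f := Hom.linQ f) (Hom.map_mem f) n x).trans (by rw [hx, map_zero])
  d_mem x hx := by
    have hx : Hom.lin f x = 0 := hx
    exact (Hom.map_d f x).trans (by rw [hx, map_zero])

theorem isSub_map (f : M ⟶ N) {S : Submodule A.carrier M.carrier}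
    (h : M.toDGVect.IsSub (S.restrictScalars ℚ)) :
    N.toDGVect.IsSub ((S.map (Hom.lin f)).restrictScalars ℚ) where
  proj_mem := by
    rintro n _ ⟨x, hx, rfl⟩
    exact ⟨M.proj n x, h.proj_mem n x hx, M.map_proj₀ (f := Hom.linQ f) (Hom.map_mem f) n x⟩
  d_mem := by
    rintro _ ⟨x, hx, rfl⟩
    exact ⟨M.d x, h.d_mem x hx, Hom.map_d f x⟩

/-- The difference of two morphisms. -/
def hsub (f g : M ⟶ N) : M ⟶ N where
  lin := Hom.lin f - Hom.lin g
  map_mem n x hx := sub_mem (Hom.map_mem f n x hx) (Hom.map_mem g n x hx)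
  map_d x := (congrArg₂ (· - ·) (Hom.map_d f x) (Hom.map_d g x)).trans (map_sub N.d _ _).symm

instance : HasTerminal (DGMod A) :=
  (IsTerminal.ofUniqueHom (Y := zero A) (fun M => zeroHom M _)
    (fun _ _ => hom_ext fun _ => rfl)).hasTerminal

instance : HasInitial (DGMod A) :=
  (IsInitial.ofUniqueHom (X := zero A) (fun M => zeroHom _ M)
    (fun _ m => hom_ext fun x => map_zero (Hom.lin m))).hasInitial

instance (M N : DGMod A) : HasLimit (pair M N) :=
  ⟨⟨_, BinaryFan.IsLimit.mk (BinaryFan.mk (fst (M := M) (N := N)) snd) (fun f g => lift f g)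
    (fun _ _ => rfl) (fun _ _ => rfl) (fun f g m h1 h2 => hom_ext fun x =>
      Prod.ext (LinearMap.congr_fun (congrArg Hom.lin h1) x)
        (LinearMap.congr_fun (congrArg Hom.lin h2) x))⟩⟩

instance (M N : DGMod A) : HasColimit (pair M N) :=
  ⟨⟨_, BinaryCofan.IsColimit.mk (BinaryCofan.mk (inl (M := M) (N := N)) inr) (fun f g => desc f g)
    (fun f g => Hom.ext (LinearMap.coprod_inl _ _)) (fun f g => Hom.ext (LinearMap.coprod_inr _ _))
    (fun f g m h1 h2 => prod_hom_ext
      (h1.trans (Hom.ext (LinearMap.coprod_inl (Hom.lin f) (Hom.lin g)).symm))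
      (h2.trans (Hom.ext (LinearMap.coprod_inr (Hom.lin f) (Hom.lin g)).symm)))⟩⟩

/-- The inclusion of a dg submodule. -/
def subι (S : Submodule A.carrier M.carrier) (h : M.toDGVect.IsSub (S.restrictScalars ℚ)) :
    M.sub S h ⟶ M where
  lin := S.subtype
  map_mem _ _ hx := hx
  map_d _ := rfl

instance (f g : M ⟶ N) : HasLimit (parallelPair f g) :=
  ⟨⟨_, Fork.IsLimit.mk (Fork.ofι (subι _ (isSub_eqLocus f g)) (hom_ext fun x => x.2))
    (fun s =>
      { lin := (Hom.lin s.ι).codRestrict (LinearMap.eqLocus (Hom.lin f) (Hom.lin g)) fun x =>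
          LinearMap.congr_fun (congrArg Hom.lin s.condition) x
        map_mem := fun n x hx => Hom.map_mem s.ι n x hx
        map_d := fun x => Subtype.ext (Hom.map_d s.ι x) })
    (fun s => rfl)
    (fun s m hm => hom_ext fun x => Subtype.ext (LinearMap.congr_fun (congrArg Hom.lin hm) x))⟩⟩

instance (f g : M ⟶ N) : HasColimit (parallelPair f g) :=
  ⟨⟨_, Cofork.IsColimit.mk (Cofork.ofπ (quotMk _ (isSub_range (hsub f g)))
      (hom_ext fun x => (Submodule.Quotient.eq _).2 ⟨x, rfl⟩))
    (fun s => quotDesc _ _ s.π (by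
      rintro _ ⟨x, rfl⟩
      have := LinearMap.congr_fun (congrArg Hom.lin s.condition) x
      exact (map_sub (Hom.lin s.π) _ _).trans (sub_eq_zero.2 this)))
    (fun s => rfl)
    (fun s m hm => quot_hom_ext hm)⟩⟩

instance : HasFiniteLimits (DGMod A) := by
  have : HasEqualizers (DGMod A) := hasEqualizers_of_hasLimit_parallelPair _
  have : HasBinaryProducts (DGMod A) := hasBinaryProducts_of_hasLimit_pair _
  have : HasFiniteProducts (DGMod A) := hasFiniteProducts_of_has_binary_and_terminal
  exact hasFiniteLimits_of_hasEqualizers_and_finite_products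

instance : HasFiniteColimits (DGMod A) := by
  have : HasCoequalizers (DGMod A) := hasCoequalizers_of_hasColimit_parallelPair _
  have : HasBinaryCoproducts (DGMod A) := hasBinaryCoproducts_of_hasColimit_pair _
  have : HasFiniteCoproducts (DGMod A) := hasFiniteCoproducts_of_has_binary_and_initial
  exact hasFiniteColimits_of_hasCoequalizers_and_finite_coproducts

end DGMod

/-! ### Subspaces of tensor products -/

section TensorSub

variable {V W : Type*} [AddCommGroup V] [Module ℚ V] [AddCommGroup W] [Module ℚ W]
  (A : Type*) [AddCommGroup A] [Module ℚ A]

/-- The subspace `A ⊗ S` of `A ⊗ V`. -/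
def tensorSub (S : Submodule ℚ V) : Submodule ℚ (A ⊗[ℚ] V) := LinearMap.range (S.subtype.lTensor A)

variable {A}

theorem tmul_mem_tensorSub {S : Submodule ℚ V} (a : A) {x : V} (hx : x ∈ S) :
    a ⊗ₜ[ℚ] x ∈ tensorSub A S := ⟨a ⊗ₜ ⟨x, hx⟩, rfl⟩

theorem tensorSub_le {S : Submodule ℚ V} {T : Submodule ℚ (A ⊗[ℚ] V)}
    (h : ∀ a, ∀ x ∈ S, a ⊗ₜ[ℚ] x ∈ T) : tensorSub A S ≤ T := by
  rintro _ ⟨z, rfl⟩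
  induction z with
  | zero => simp
  | tmul a x => exact h a x x.2
  | add x y hx hy => rw [map_add]; exact add_mem hx hy

theorem map_mem_of_tensorSub {S : Submodule ℚ V} (f : A ⊗[ℚ] V →ₗ[ℚ] W) {T : Submodule ℚ W}
    (h : ∀ a, ∀ x ∈ S, f (a ⊗ₜ[ℚ] x) ∈ T) {z : A ⊗[ℚ] V} (hz : z ∈ tensorSub A S) : f z ∈ T :=
  tensorSub_le (T := T.comap f) h hz

theorem tensorSub_mono {S T : Submodule ℚ V} (h : S ≤ T) : tensorSub A S ≤ tensorSub A T :=
  tensorSub_le fun a _ hx => tmul_mem_tensorSub a (h hx)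

theorem tensorSub_top : tensorSub A (⊤ : Submodule ℚ V) = ⊤ := by
  rw [eq_top_iff]
  rintro z -
  induction z with
  | zero => simp
  | tmul a x => exact tmul_mem_tensorSub a trivial
  | add x y hx hy => exact add_mem hx hy

theorem tensorSub_sup (S T : Submodule ℚ V) :
    tensorSub A (S ⊔ T) = tensorSub A S ⊔ tensorSub A T := by
  apply le_antisymm
  · refine tensorSub_le fun a x hx => ?_
    obtain ⟨s, hs, t, ht, rfl⟩ := Submodule.mem_sup.1 hx
    rw [TensorProduct.tmul_add]
    exact add_mem (Submodule.mem_sup_left (tmul_mem_tensorSub a hs))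
      (Submodule.mem_sup_right (tmul_mem_tensorSub a ht))
  · exact sup_le (tensorSub_mono le_sup_left) (tensorSub_mono le_sup_right)

theorem lTensor_injective {f : V →ₗ[ℚ] W} (hf : Function.Injective f) :
    Function.Injective (f.lTensor A) :=
  Module.Flat.lTensor_preserves_injective_linearMap f hf

/-- Flatness over a field. Preimages and intersections are kernels or are built from preimages, so
`A ⊗ -` preserves them too. -/
theorem tensorSub_ker (f : V →ₗ[ℚ] W) : tensorSub A (LinearMap.ker f) =
    LinearMap.ker (f.lTensor A) := by
  have h : Function.Exact (LinearMap.ker f).subtype f := by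
    intro x
    simp
  ext z
  exact (Module.Flat.lTensor_exact A h z).symm

theorem mem_tensorSub_iff {S : Submodule ℚ V} {z : A ⊗[ℚ] V} :
    z ∈ tensorSub A S ↔ S.mkQ.lTensor A z = 0 := by
  conv_lhs => rw [← S.ker_mkQ, tensorSub_ker]
  rfl

theorem tensorSub_comap (f : V →ₗ[ℚ] W) (T : Submodule ℚ W) :
    tensorSub A (T.comap f) = (tensorSub A T).comap (f.lTensor A) := by
  have : T.comap f = LinearMap.ker (T.mkQ ∘ₗ f) := by
    rw [LinearMap.ker_comp, T.ker_mkQ]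
  rw [this, tensorSub_ker]
  ext z
  rw [LinearMap.mem_ker, LinearMap.lTensor_comp_apply, Submodule.mem_comap, mem_tensorSub_iff]

theorem tensorSub_map (f : V →ₗ[ℚ] W) (S : Submodule ℚ V) :
    tensorSub A (S.map f) = (tensorSub A S).map (f.lTensor A) := by
  apply le_antisymm
  · refine tensorSub_le ?_
    rintro a _ ⟨x, hx, rfl⟩
    exact ⟨a ⊗ₜ x, tmul_mem_tensorSub a hx, rfl⟩
  · rw [Submodule.map_le_iff_le_comap]
    exact tensorSub_le fun a x hx => tmul_mem_tensorSub a ⟨x, hx, rfl⟩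

theorem lTensor_mem_tensorSub {f : V →ₗ[ℚ] W} {S : Submodule ℚ V} {T : Submodule ℚ W}
    (h : ∀ x ∈ S, f x ∈ T) {z : A ⊗[ℚ] V} (hz : z ∈ tensorSub A S) :
    f.lTensor A z ∈ tensorSub A T :=
  map_mem_of_tensorSub _ (fun a x hx => tmul_mem_tensorSub a (h x hx)) hz

theorem range_lTensor (f : V →ₗ[ℚ] W) :
    LinearMap.range (f.lTensor A) = tensorSub A (LinearMap.range f) := by
  rw [LinearMap.range_eq_map, LinearMap.range_eq_map, tensorSub_map, tensorSub_top]

theorem tensorSub_inf (S T : Submodule ℚ V) :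
    tensorSub A (S ⊓ T) = tensorSub A S ⊓ tensorSub A T := by
  have h1 : S ⊓ T = (T.comap S.subtype).map S.subtype := by
    rw [Submodule.map_comap_subtype]
  rw [h1, tensorSub_map, tensorSub_comap, Submodule.map_comap_eq]
  rfl

/-- Membership in `A ⊗ S` can be tested by contracting with functionals on `A`. -/
theorem mem_tensorSub_of_forall {S : Submodule ℚ V} {z : A ⊗[ℚ] V}
    (h : ∀ φ : A →ₗ[ℚ] ℚ, TensorProduct.lid ℚ V (φ.rTensor V z) ∈ S) : z ∈ tensorSub A S := by
  classical
  -- In an expansion along a basis of `A`, the coordinate functionals return the coefficient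
  -- vectors, which therefore lie in `S`.
  let b := Module.Free.chooseBasis ℚ A
  obtain ⟨c, rfl⟩ := (TensorProduct.equivFinsuppOfBasisLeft (N := V) b).symm.surjective z
  rw [TensorProduct.equivFinsuppOfBasisLeft_symm_apply]
  refine Submodule.sum_mem _ fun i _ => tmul_mem_tensorSub _ ?_
  have := h (b.coord i)
  rw [TensorProduct.equivFinsuppOfBasisLeft_symm_apply, Finsupp.sum, map_sum, map_sum] at this
  simp only [LinearMap.rTensor_tmul, TensorProduct.lid_tmul, Module.Basis.coord_apply,
    Module.Basis.repr_self, Finsupp.single_apply, ite_smul, one_smul, zero_smul] at this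
  rw [Finset.sum_ite_eq'] at this
  split_ifs at this
  exact this

theorem lTensor_fst_add (z : A ⊗[ℚ] V) (w : A ⊗[ℚ] W) : (LinearMap.fst ℚ V W).lTensor A
    ((LinearMap.inl ℚ V W).lTensor A z + (LinearMap.inr ℚ V W).lTensor A w) = z := by
  rw [map_add, ← LinearMap.lTensor_comp_apply, ← LinearMap.lTensor_comp_apply,
    LinearMap.fst_comp_inl, LinearMap.fst_comp_inr]
  simp

theorem lTensor_snd_add (z : A ⊗[ℚ] V) (w : A ⊗[ℚ] W) : (LinearMap.snd ℚ V W).lTensor A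
    ((LinearMap.inl ℚ V W).lTensor A z + (LinearMap.inr ℚ V W).lTensor A w) = w := by
  rw [map_add, ← LinearMap.lTensor_comp_apply, ← LinearMap.lTensor_comp_apply,
    LinearMap.snd_comp_inl, LinearMap.snd_comp_inr]
  simp

theorem lTensor_prod_apply {U : Type*} [AddCommGroup U] [Module ℚ U] (f : U →ₗ[ℚ] V)
    (g : U →ₗ[ℚ] W) (z : A ⊗[ℚ] U) : (f.prod g).lTensor A z =
    (LinearMap.inl ℚ V W).lTensor A (f.lTensor A z) +
      (LinearMap.inr ℚ V W).lTensor A (g.lTensor A z) := by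
  rw [← LinearMap.lTensor_comp_apply, ← LinearMap.lTensor_comp_apply, ← LinearMap.add_apply,
    ← LinearMap.lTensor_add]
  congr 2
  ext y <;> simp

/-- An element of the tensor product involves finitely many vectors of the union, hence only one
stage. This is what makes acyclicity pass to unions of chains. -/
theorem mem_tensorSub_iSup_of_directed {ι : Type*} [Nonempty ι] {S : ι → Submodule ℚ V}
    (hS : Directed (· ≤ ·) S) {z : A ⊗[ℚ] V} (hz : z ∈ tensorSub A (⨆ i, S i)) :
    ∃ i, z ∈ tensorSub A (S i) := by
  have hd : Directed (· ≤ ·) fun i => tensorSub A (S i) := fun i j => by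
    obtain ⟨k, h1, h2⟩ := hS i j
    exact ⟨k, tensorSub_mono h1, tensorSub_mono h2⟩
  have : z ∈ ⨆ i, tensorSub A (S i) := by
    refine tensorSub_le (fun a x hx => ?_) hz
    obtain ⟨i, hi⟩ := (Submodule.mem_iSup_of_directed S hS).1 hx
    exact Submodule.mem_iSup_of_mem i (tmul_mem_tensorSub a hi)
  exact (Submodule.mem_iSup_of_directed _ hd).1 this

end TensorSub

/-- The tensor product of two complexes. -/
def DGVect.tensor (V W : DGVect.{u}) : DGVect.{u} where
  carrier := V.carrier ⊗[ℚ] W.carrier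
  gr := tensorGr V.gr W.gr
  isInternal := isInternal_tensorGr V.isInternal W.isInternal
  d := tensorD V W
  d_mem := tensorD_mem V W
  d_d := tensorD_tensorD V W

theorem lTensor_mem_tensorGr {U V W : DGVect.{u}} {f : V.carrier →ₗ[ℚ] W.carrier}
    (hf : ∀ n, ∀ x ∈ V.gr n, f x ∈ W.gr n) {n : ℤ} {z : U.carrier ⊗[ℚ] V.carrier}
    (hz : z ∈ tensorGr U.gr V.gr n) : f.lTensor U.carrier z ∈ tensorGr U.gr W.gr n :=
  map_mem_of_tensorGr (f.lTensor U.carrier) (tensorGr U.gr W.gr n)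
    (fun _ j hij _ hx _ hy => tmul_mem_tensorGr hx (hf j _ hy) hij) hz

theorem tensorD_lTensor {U V W : DGVect.{u}} {f : V.carrier →ₗ[ℚ] W.carrier}
    (hf : ∀ x, f (V.d x) = W.d (f x)) (z : U.carrier ⊗[ℚ] V.carrier) :
    tensorD U W (f.lTensor U.carrier z) = f.lTensor U.carrier (tensorD U V z) := by
  induction z with
  | zero => simp
  | tmul x y => simp [tensorD_tmul, hf]
  | add x y hx hy => simp only [map_add, hx, hy]

/-- The map `id ⊗ f` is injective and commutes with the projections to each degree, so it reflects
degrees. It puts the coaction of a subcomodule in the right degree. -/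
theorem mem_tensorGr_of_injective {U V W : DGVect.{u}} {f : V.carrier →ₗ[ℚ] W.carrier}
    (hf : ∀ n, ∀ x ∈ V.gr n, f x ∈ W.gr n) (hi : Function.Injective f) {n : ℤ}
    {z : U.carrier ⊗[ℚ] V.carrier} (hz : f.lTensor U.carrier z ∈ tensorGr U.gr W.gr n) :
    z ∈ tensorGr U.gr V.gr n := by
  have h1 := DGVect.map_proj₀ (V := U.tensor V) (W := U.tensor W) (f := f.lTensor U.carrier)
    (fun n x hx => lTensor_mem_tensorGr hf hx) n z
  have h2 := h1.trans ((U.tensor W).proj_same hz)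
  exact ((U.tensor V).mem_gr_iff (x := z)).2 (lTensor_injective hi h2)

theorem assoc_comul_lTensor {C : DGCoalg.{u}} {V W : Type*} [AddCommGroup V] [Module ℚ V]
    [AddCommGroup W] [Module ℚ W] (f : V →ₗ[ℚ] W) (z : C.carrier ⊗[ℚ] V) :
    TensorProduct.assoc ℚ C.carrier C.carrier W
      ((Coalgebra.comul (R := ℚ)).rTensor W (f.lTensor C.carrier z)) =
    (f.lTensor C.carrier).lTensor C.carrier (TensorProduct.assoc ℚ C.carrier C.carrier V
      ((Coalgebra.comul (R := ℚ)).rTensor V z)) := by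
  induction z with
  | zero => simp
  | tmul c v =>
    rw [LinearMap.lTensor_tmul, LinearMap.rTensor_tmul, LinearMap.rTensor_tmul]
    generalize (Coalgebra.comul c : C.carrier ⊗[ℚ] C.carrier) = y
    induction y with
    | zero => simp
    | tmul a b => simp
    | add x y hx hy => simp only [map_add, TensorProduct.add_tmul, hx, hy]
  | add x y hx hy => simp only [map_add, hx, hy]

theorem counit_lTensor {C : DGCoalg.{u}} {V W : Type*} [AddCommGroup V] [Module ℚ V]
    [AddCommGroup W] [Module ℚ W] (f : V →ₗ[ℚ] W) (z : C.carrier ⊗[ℚ] V) :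
    (Coalgebra.counit (R := ℚ)).rTensor W (f.lTensor C.carrier z) =
      f.lTensor ℚ ((Coalgebra.counit (R := ℚ)).rTensor V z) := by
  induction z with
  | zero => simp
  | tmul c v => simp
  | add x y hx hy => simp only [map_add, hx, hy]

namespace DGComod

variable {C : DGCoalg.{u}} {M N P : DGComod C}

/-! ### Subcomodules -/

variable (N) in
/-- A subspace of a dg comodule which is a dg subcomodule. -/
structure IsSub (S : Submodule ℚ N.carrier) : Prop extends N.toDGVect.IsSub S where
  coact_mem : ∀ x ∈ S, N.coact x ∈ tensorSub C.carrier S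

/-- The coaction on a subcomodule. -/
def subCoact {S : Submodule ℚ N.carrier} (h : N.IsSub S) : S →ₗ[ℚ] C.carrier ⊗[ℚ] S :=
  (LinearEquiv.ofInjective _ (lTensor_injective S.injective_subtype)).symm.toLinearMap ∘ₗ
    (N.coact ∘ₗ S.subtype).codRestrict (LinearMap.range (S.subtype.lTensor C.carrier))
      fun x => h.coact_mem x x.2

theorem lTensor_subCoact {S : Submodule ℚ N.carrier} (h : N.IsSub S) (x : S) :
    S.subtype.lTensor C.carrier (subCoact h x) = N.coact x := by
  have := LinearEquiv.ofInjective_apply (S.subtype.lTensor C.carrier)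
    (h := lTensor_injective (A := C.carrier) S.injective_subtype) (subCoact h x)
  rw [← this, subCoact, LinearMap.comp_apply, LinearEquiv.coe_coe, LinearEquiv.apply_symm_apply]
  rfl

theorem lTensor_comp_subCoact {S : Submodule ℚ N.carrier} (h : N.IsSub S) :
    S.subtype.lTensor C.carrier ∘ₗ subCoact h = N.coact ∘ₗ S.subtype :=
  LinearMap.ext (lTensor_subCoact h)

variable (N) in
/-- A dg subcomodule, as a dg comodule. -/
def sub (S : Submodule ℚ N.carrier) (h : N.IsSub S) : DGComod C :=
  { N.toDGVect.sub S h.toIsSub with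
    coact := subCoact h
    coact_mem := fun n x hx =>
      mem_tensorGr_of_injective (U := C.toDGVect) (V := N.toDGVect.sub S h.toIsSub)
        (W := N.toDGVect) (f := S.subtype) (fun _ _ h => h) S.injective_subtype
        ((lTensor_subCoact h x).symm ▸ N.coact_mem n x hx)
    coact_d := fun x => by
      -- Here and below, an identity for the corestricted coaction is checked after an injective map
      -- induced by `S → N`.
      apply lTensor_injective (A := C.carrier) S.injective_subtype
      refine (lTensor_subCoact h _).trans ((N.coact_d x).trans ?_)
      rw [← lTensor_subCoact h x]
      exact tensorD_lTensor (U := C.toDGVect) (V := N.toDGVect.sub S h.toIsSub)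
        (W := N.toDGVect) (f := S.subtype) (fun _ => rfl) _
    coassoc := fun x => by
      apply lTensor_injective (A := C.carrier) (lTensor_injective (A := C.carrier)
        S.injective_subtype)
      rw [← assoc_comul_lTensor, lTensor_subCoact, N.coassoc, ← LinearMap.lTensor_comp_apply,
        lTensor_comp_subCoact, LinearMap.lTensor_comp_apply, lTensor_subCoact]
    counit := fun x => by
      apply lTensor_injective (A := ℚ) S.injective_subtype
      rw [← counit_lTensor, lTensor_subCoact, N.counit]
      rfl }

/-- The inclusion of a subcomodule. -/
def subι (S : Submodule ℚ N.carrier) (h : N.IsSub S) : N.sub S h ⟶ N where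
  lin := S.subtype
  map_mem _ _ hx := hx
  map_d _ := rfl
  map_coact x := (lTensor_subCoact h x).symm

/-- A morphism with values in a subcomodule. -/
def subLift (S : Submodule ℚ N.carrier) (h : N.IsSub S) (f : M ⟶ N)
    (hf : ∀ x, Hom.lin f x ∈ S) : M ⟶ N.sub S h where
  lin := (Hom.lin f).codRestrict S hf
  map_mem n x hx := Hom.map_mem f n x hx
  map_d x := Subtype.ext (Hom.map_d f x)
  map_coact x := by
    apply lTensor_injective (A := C.carrier) S.injective_subtype
    refine (lTensor_subCoact h _).trans ((Hom.map_coact f x).trans ?_)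
    exact LinearMap.lTensor_comp_apply C.carrier S.subtype ((Hom.lin f).codRestrict S hf) _

/-- The inclusion of a subcomodule in a larger one. -/
def subIncl {S T : Submodule ℚ N.carrier} (hS : N.IsSub S) (hT : N.IsSub T) (h : S ≤ T) :
    N.sub S hS ⟶ N.sub T hT :=
  subLift T hT (subι S hS) fun x => h x.2

theorem isSub_range (f : M ⟶ N) : N.IsSub (LinearMap.range (Hom.lin f)) where
  proj_mem := by
    rintro n _ ⟨x, rfl⟩
    exact ⟨M.proj n x, M.map_proj₀ (Hom.map_mem f) n x⟩
  d_mem := by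
    rintro _ ⟨x, rfl⟩
    exact ⟨M.d x, Hom.map_d f x⟩
  coact_mem := by
    rintro _ ⟨x, rfl⟩
    rw [Hom.map_coact, ← range_lTensor]
    exact ⟨_, rfl⟩

theorem isSub_eqLocus (f g : M ⟶ N) : M.IsSub (LinearMap.eqLocus (Hom.lin f) (Hom.lin g)) where
  proj_mem n x hx := by
    have h3 : Hom.lin f x = Hom.lin g x := hx
    exact (M.map_proj₀ (Hom.map_mem f) n x).trans
      ((congrArg _ h3).trans (M.map_proj₀ (Hom.map_mem g) n x).symm)
  d_mem x hx := by
    have h3 : Hom.lin f x = Hom.lin g x := hx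
    exact (Hom.map_d f x).trans ((congrArg _ h3).trans (Hom.map_d g x).symm)
  coact_mem x hx := by
    have h3 : Hom.lin f x = Hom.lin g x := hx
    rw [LinearMap.eqLocus_eq_ker_sub, tensorSub_ker, LinearMap.mem_ker, LinearMap.lTensor_sub,
      LinearMap.sub_apply, ← Hom.map_coact, ← Hom.map_coact, h3, sub_self]

theorem IsSub.comap (f : M ⟶ N) {S : Submodule ℚ N.carrier} (h : N.IsSub S) :
    M.IsSub (S.comap (Hom.lin f)) where
  proj_mem n x hx := by
    have := h.proj_mem n _ hx
    rwa [← M.map_proj₀ (Hom.map_mem f)] at this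
  d_mem x hx := by
    have := h.d_mem _ hx
    rwa [← Hom.map_d] at this
  coact_mem x hx := by
    rw [tensorSub_comap, Submodule.mem_comap, ← Hom.map_coact]
    exact h.coact_mem _ hx

theorem IsSub.sup {S T : Submodule ℚ N.carrier} (hS : N.IsSub S) (hT : N.IsSub T) :
    N.IsSub (S ⊔ T) where
  proj_mem n x hx := by
    obtain ⟨s, hs, t, ht, rfl⟩ := Submodule.mem_sup.1 hx
    rw [map_add]
    exact Submodule.add_mem_sup (hS.proj_mem n s hs) (hT.proj_mem n t ht)
  d_mem x hx := by
    obtain ⟨s, hs, t, ht, rfl⟩ := Submodule.mem_sup.1 hx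
    rw [map_add]
    exact Submodule.add_mem_sup (hS.d_mem s hs) (hT.d_mem t ht)
  coact_mem x hx := by
    obtain ⟨s, hs, t, ht, rfl⟩ := Submodule.mem_sup.1 hx
    rw [map_add, tensorSub_sup]
    exact Submodule.add_mem_sup (hS.coact_mem s hs) (hT.coact_mem t ht)

theorem IsSub.inf {S T : Submodule ℚ N.carrier} (hS : N.IsSub S) (hT : N.IsSub T) :
    N.IsSub (S ⊓ T) where
  proj_mem n x hx := ⟨hS.proj_mem n x hx.1, hT.proj_mem n x hx.2⟩
  d_mem x hx := ⟨hS.d_mem x hx.1, hT.d_mem x hx.2⟩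
  coact_mem x hx := by
    rw [tensorSub_inf]
    exact ⟨hS.coact_mem x hx.1, hT.coact_mem x hx.2⟩

theorem IsSub.iSup_of_directed {ι : Type*} [Nonempty ι] {S : ι → Submodule ℚ N.carrier}
    (hS : Directed (· ≤ ·) S) (h : ∀ i, N.IsSub (S i)) : N.IsSub (⨆ i, S i) where
  proj_mem n x hx := by
    obtain ⟨i, hi⟩ := (Submodule.mem_iSup_of_directed S hS).1 hx
    exact Submodule.mem_iSup_of_mem i ((h i).proj_mem n x hi)
  d_mem x hx := by
    obtain ⟨i, hi⟩ := (Submodule.mem_iSup_of_directed S hS).1 hx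
    exact Submodule.mem_iSup_of_mem i ((h i).d_mem x hi)
  coact_mem x hx := by
    obtain ⟨i, hi⟩ := (Submodule.mem_iSup_of_directed S hS).1 hx
    exact tensorSub_mono (le_iSup S i) ((h i).coact_mem x hi)

/-! ### Monomorphisms and isomorphisms -/

/-- The zero morphism. -/
def zeroHom (M N : DGComod C) : M ⟶ N where
  lin := 0
  map_mem _ _ _ := zero_mem _
  map_d _ := (map_zero N.d).symm
  map_coact _ := by simp

/-- The kernel of a morphism is a subcomodule by flatness, so a monomorphism identifies the
inclusion of its kernel with zero. -/
theorem mono_iff_injective (f : M ⟶ N) : Mono f ↔ Function.Injective (Hom.lin f) := by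
  constructor
  · intro hf
    rw [← LinearMap.ker_eq_bot, Submodule.eq_bot_iff]
    intro x hx
    have hS := isSub_eqLocus f (zeroHom M N)
    have hx' : x ∈ LinearMap.eqLocus (Hom.lin f) (Hom.lin (zeroHom M N)) := hx
    have h : subι _ hS = zeroHom _ _ := by
      rw [← cancel_mono f]
      exact hom_ext fun y => y.2.trans (map_zero (Hom.lin f)).symm
    exact LinearMap.congr_fun (congrArg Hom.lin h) ⟨x, hx'⟩
  · intro hf
    exact ⟨fun g h hgh => hom_ext fun x => hf (LinearMap.congr_fun (congrArg Hom.lin hgh) x)⟩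

theorem isIso_of_bijective (f : M ⟶ N) (hf : Function.Bijective (Hom.lin f)) : IsIso f := by
  let e := LinearEquiv.ofBijective (Hom.lin f) hf
  have he : ∀ x, Hom.lin f (e.symm x) = x := e.apply_symm_apply
  refine ⟨⟨{ lin := e.symm.toLinearMap, map_mem := ?_, map_d := ?_, map_coact := ?_ } ,
    hom_ext e.symm_apply_apply, hom_ext e.apply_symm_apply⟩⟩
  · intro n x hx
    rw [DGVect.mem_gr_iff]
    apply hf.1
    exact (M.map_proj₀ (Hom.map_mem f) n _).trans
      ((congrArg _ (he x)).trans ((N.proj_same hx).trans (he x).symm))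
  · intro x
    apply hf.1
    exact (he _).trans ((congrArg _ (he x).symm).trans (Hom.map_d f _).symm)
  · intro x
    apply lTensor_injective (A := C.carrier) hf.1
    rw [← Hom.map_coact, ← LinearMap.lTensor_comp_apply]
    have : Hom.lin f ∘ₗ e.symm.toLinearMap = LinearMap.id := LinearMap.ext he
    rw [this, LinearMap.lTensor_id]
    exact congrArg N.coact (he x)

/-! ### Finite limits of dg comodules -/

variable (M N) in
/-- The direct sum of two dg comodules. -/
def prod : DGComod C :=
  { M.toDGVect.prod N.toDGVect with
    coact := (LinearMap.inl ℚ M.carrier N.carrier).lTensor C.carrier ∘ₗ M.coact ∘ₗ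
        LinearMap.fst ℚ M.carrier N.carrier +
      (LinearMap.inr ℚ M.carrier N.carrier).lTensor C.carrier ∘ₗ N.coact ∘ₗ
        LinearMap.snd ℚ M.carrier N.carrier
    coact_mem := fun n x hx => add_mem
      (lTensor_mem_tensorGr (U := C.toDGVect) (V := M.toDGVect) (W := M.toDGVect.prod N.toDGVect)
        (f := LinearMap.inl ℚ M.carrier N.carrier)
        (fun n x hx => ⟨hx, zero_mem _⟩) (M.coact_mem n _ hx.1))
      (lTensor_mem_tensorGr (U := C.toDGVect) (V := N.toDGVect) (W := M.toDGVect.prod N.toDGVect)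
        (f := LinearMap.inr ℚ M.carrier N.carrier)
        (fun n x hx => ⟨zero_mem _, hx⟩) (N.coact_mem n _ hx.2))
    coact_d := fun x => by
      have h1 := tensorD_lTensor (U := C.toDGVect) (V := M.toDGVect)
        (W := M.toDGVect.prod N.toDGVect) (f := LinearMap.inl ℚ M.carrier N.carrier)
        (fun x => Prod.ext rfl (map_zero N.d).symm) (M.coact x.1)
      have h2 := tensorD_lTensor (U := C.toDGVect) (V := N.toDGVect)
        (W := M.toDGVect.prod N.toDGVect) (f := LinearMap.inr ℚ M.carrier N.carrier)
        (fun x => Prod.ext (map_zero M.d).symm rfl) (N.coact x.2)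
      refine (congrArg₂ (· + ·) ?_ ?_).trans (map_add _ _ _).symm
      · exact (congrArg _ (M.coact_d x.1)).trans h1.symm
      · exact (congrArg _ (N.coact_d x.2)).trans h2.symm
    coassoc := fun x => by
      simp only [LinearMap.add_apply, LinearMap.comp_apply, map_add, assoc_comul_lTensor]
      simp only [M.coassoc, N.coassoc, ← LinearMap.lTensor_comp_apply]
      congr 3
      · ext y; simp
      · ext y; simp
    counit := fun x => by
      simp only [LinearMap.add_apply, LinearMap.comp_apply, map_add, counit_lTensor, M.counit,
        N.counit]
      rw [LinearMap.lTensor_tmul, LinearMap.lTensor_tmul, ← TensorProduct.tmul_add]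
      simp }

/-- The first projection. -/
def fst : M.prod N ⟶ M where
  lin := LinearMap.fst ℚ M.carrier N.carrier
  map_mem _ _ hx := hx.1
  map_d _ := rfl
  map_coact x := (lTensor_fst_add (M.coact x.1) (N.coact x.2)).symm

/-- The second projection. -/
def snd : M.prod N ⟶ N where
  lin := LinearMap.snd ℚ M.carrier N.carrier
  map_mem _ _ hx := hx.2
  map_d _ := rfl
  map_coact x := (lTensor_snd_add (M.coact x.1) (N.coact x.2)).symm

/-- The morphism into a direct sum with given components. -/
def lift (f : P ⟶ M) (g : P ⟶ N) : P ⟶ M.prod N where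
  lin := (Hom.lin f).prod (Hom.lin g)
  map_mem n x hx := ⟨Hom.map_mem f n x hx, Hom.map_mem g n x hx⟩
  map_d x := Prod.ext (Hom.map_d f x) (Hom.map_d g x)
  map_coact x := by
    refine Eq.trans ?_ (lTensor_prod_apply (Hom.lin f) (Hom.lin g) (P.coact x)).symm
    rw [← Hom.map_coact, ← Hom.map_coact]
    rfl

variable (C) in
/-- The zero dg comodule. -/
def zero : DGComod C :=
  { DGVect.zero.{u} with
    coact := 0
    coact_mem := fun _ _ _ => zero_mem _
    coact_d := fun _ => (map_zero _).symm
    coassoc := fun _ => by simp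
    counit := fun x => by
      rw [Subsingleton.elim x 0]; simp }

instance : HasTerminal (DGComod C) :=
  (IsTerminal.ofUniqueHom (Y := zero C) (fun M => zeroHom M _)
    (fun _ _ => hom_ext fun _ => rfl)).hasTerminal

instance (M N : DGComod C) : HasLimit (pair M N) :=
  ⟨⟨_, BinaryFan.IsLimit.mk (BinaryFan.mk (fst (M := M) (N := N)) snd) (fun f g => lift f g)
    (fun _ _ => rfl) (fun _ _ => rfl) (fun f g m h1 h2 => hom_ext fun x =>
      Prod.ext (LinearMap.congr_fun (congrArg Hom.lin h1) x)
        (LinearMap.congr_fun (congrArg Hom.lin h2) x))⟩⟩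

/-- The equalizer of two morphisms, as a fork. -/
def eqFork (f g : M ⟶ N) : Fork f g :=
  Fork.ofι (subι _ (isSub_eqLocus f g)) (hom_ext fun x => x.2)

/-- The fork `eqFork f g` is an equalizer. -/
def isLimitEqFork (f g : M ⟶ N) : IsLimit (eqFork f g) :=
  Fork.IsLimit.mk _ (fun s => subLift _ _ s.ι fun x =>
      LinearMap.congr_fun (congrArg Hom.lin s.condition) x)
    (fun s => rfl)
    (fun s m hm => hom_ext fun x => Subtype.ext (LinearMap.congr_fun (congrArg Hom.lin hm) x))

instance (f g : M ⟶ N) : HasLimit (parallelPair f g) := ⟨⟨_, isLimitEqFork f g⟩⟩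

instance : HasEqualizers (DGComod C) := hasEqualizers_of_hasLimit_parallelPair _

instance : HasFiniteLimits (DGComod C) := by
  have : HasBinaryProducts (DGComod C) := hasBinaryProducts_of_hasLimit_pair _
  have : HasFiniteProducts (DGComod C) := hasFiniteProducts_of_has_binary_and_terminal
  exact hasFiniteLimits_of_hasEqualizers_and_finite_products

end DGComod

/-! ### Sums of disks -/

section Disks

variable (V : Type u) [AddCommGroup V] [Module ℚ V]

/-- The differential of `disks V`. -/
def disksD : (ℤ →₀ V × V) →ₗ[ℚ] (ℤ →₀ V × V) :=
  Finsupp.lsum ℚ fun n => Finsupp.lsingle (n - 1) ∘ₗ LinearMap.inl ℚ V V ∘ₗ LinearMap.snd ℚ V V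

@[simp]
theorem disksD_single (n : ℤ) (v : V × V) :
    disksD V (Finsupp.single n v) = Finsupp.single (n - 1) (v.2, 0) :=
  Finsupp.lsum_single ..

/-- The sum over all `n` of the `n`-disks on `V`: in each degree it is `V × V`, with differential
`(v, w) ↦ (w, 0)`. -/
def disks : DGVect.{u} where
  carrier := ℤ →₀ V × V
  gr n := LinearMap.range (Finsupp.lsingle n : V × V →ₗ[ℚ] _)
  isInternal := by
    classical
    refine isInternal_of_proj (fun n x => Finsupp.single n (x n)) (fun n x y => by simp) ?_ ?_
    · rintro m n _ ⟨v, rfl⟩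
      by_cases h : m = n
      · subst h; simp
      · simp [h]
    · intro x
      induction x using Finsupp.induction_linear with
      | zero => exact zero_mem _
      | add x y hx hy => exact add_mem hx hy
      | single n v => exact Submodule.mem_iSup_of_mem n ⟨v, rfl⟩
  d := disksD V
  d_mem := by
    rintro n _ ⟨v, rfl⟩
    exact ⟨(v.2, 0), (disksD_single V n v).symm⟩
  d_d x := by
    have : disksD V ∘ₗ disksD V = 0 := Finsupp.lhom_ext fun n v => by simp
    exact LinearMap.congr_fun this x

/-- The contraction of `disks V`. -/
def disksH : (ℤ →₀ V × V) →ₗ[ℚ] (ℤ →₀ V × V) :=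
  Finsupp.lsum ℚ fun n => Finsupp.lsingle (n + 1) ∘ₗ LinearMap.inr ℚ V V ∘ₗ LinearMap.fst ℚ V V

@[simp]
theorem disksH_single (n : ℤ) (v : V × V) :
    disksH V (Finsupp.single n v) = Finsupp.single (n + 1) (0, v.1) :=
  Finsupp.lsum_single ..

theorem disksH_contraction (x : ℤ →₀ V × V) :
    disksD V (disksH V x) + disksH V (disksD V x) = x := by
  have : disksD V ∘ₗ disksH V + disksH V ∘ₗ disksD V = LinearMap.id :=
    Finsupp.lhom_ext fun n v => by simp [← Finsupp.single_add]
  exact LinearMap.congr_fun this x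

variable {V}

/-- The chain map `N → disks V` attached to a linear map `N → V`. -/
def toDisks (N : DGVect.{u}) (φ : N.carrier →ₗ[ℚ] V) : N.carrier →ₗ[ℚ] (ℤ →₀ V × V) :=
  gradedLift N.gr N.isInternal fun n =>
    Finsupp.lsingle n ∘ₗ (φ.prod (φ ∘ₗ N.d)) ∘ₗ (N.gr n).subtype

theorem toDisks_of_mem (N : DGVect.{u}) (φ : N.carrier →ₗ[ℚ] V) {n : ℤ} {x : N.carrier}
    (hx : x ∈ N.gr n) : toDisks N φ x = Finsupp.single n (φ x, φ (N.d x)) :=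
  gradedLift_of_mem _ _ _ hx

theorem toDisks_d (N : DGVect.{u}) (φ : N.carrier →ₗ[ℚ] V) (x : N.carrier) :
    toDisks N φ (N.d x) = disksD V (toDisks N φ x) := by
  induction x using N.homogeneous_induction with
  | zero => simp
  | mem n x hx => simp [toDisks_of_mem N φ hx, toDisks_of_mem N φ (N.d_mem n x hx), N.d_d]
  | add x y hx hy => simp only [map_add, hx, hy]

variable (V) in
/-- The map `disks V → V` adding up the first coordinates. -/
def disksSum : (ℤ →₀ V × V) →ₗ[ℚ] V := Finsupp.lsum ℚ fun _ => LinearMap.fst ℚ V V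

@[simp]
theorem disksSum_single (n : ℤ) (v : V × V) : disksSum V (Finsupp.single n v) = v.1 := by
  simp [disksSum]

theorem disksSum_toDisks (N : DGVect.{u}) (φ : N.carrier →ₗ[ℚ] V) :
    disksSum V ∘ₗ toDisks N φ = φ := by
  refine graded_ext N.isInternal.submodule_iSup_eq_top fun n x hx => ?_
  simp [toDisks_of_mem N φ hx]

/-- For a chain map `θ`, the second coordinate of `θ x` is the first coordinate of `θ (dx)`. Hence
chain maps into `disks V` are the same as linear maps into `V`, with no condition on degrees or
differentials. -/
theorem toDisks_disksSum (N : DGVect.{u}) (θ : N.carrier →ₗ[ℚ] (ℤ →₀ V × V))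
    (hθ : ∀ n, ∀ x ∈ N.gr n, θ x ∈ (disks V).gr n) (hd : ∀ x, θ (N.d x) = disksD V (θ x)) :
    toDisks N (disksSum V ∘ₗ θ) = θ := by
  refine graded_ext N.isInternal.submodule_iSup_eq_top fun n x hx => ?_
  obtain ⟨v, hv⟩ := hθ n x hx
  have hv : Finsupp.single n v = θ x := hv
  rw [toDisks_of_mem _ _ hx, LinearMap.comp_apply, LinearMap.comp_apply, hd, ← hv]
  simp

/-- The chain map out of `disks V` attached to a family of linear maps. -/
def ofDisks (M : DGVect.{u}) (φ : ℤ → V →ₗ[ℚ] M.carrier) : (ℤ →₀ V × V) →ₗ[ℚ] M.carrier :=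
  Finsupp.lsum ℚ fun n => (M.d ∘ₗ φ (n + 1)).coprod (φ n)

@[simp]
theorem ofDisks_single (M : DGVect.{u}) (φ : ℤ → V →ₗ[ℚ] M.carrier) (n : ℤ) (v : V × V) :
    ofDisks M φ (Finsupp.single n v) = M.d (φ (n + 1) v.1) + φ n v.2 := by
  simp [ofDisks]

theorem ofDisks_d (M : DGVect.{u}) (φ : ℤ → V →ₗ[ℚ] M.carrier) (x : ℤ →₀ V × V) :
    ofDisks M φ (disksD V x) = M.d (ofDisks M φ x) := by
  have : ofDisks M φ ∘ₗ disksD V = M.d ∘ₗ ofDisks M φ :=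
    Finsupp.lhom_ext fun n v => by simp [M.d_d]
  exact LinearMap.congr_fun this x

theorem ofDisks_mem (M : DGVect.{u}) (φ : ℤ → V →ₗ[ℚ] M.carrier) (hφ : ∀ n v, φ n v ∈ M.gr n)
    (n : ℤ) (x : ℤ →₀ V × V) (hx : x ∈ (disks V).gr n) : ofDisks M φ x ∈ M.gr n := by
  obtain ⟨v, rfl⟩ := hx
  rw [Finsupp.lsingle_apply, ofDisks_single]
  refine add_mem ?_ (hφ _ _)
  have := M.d_mem _ _ (hφ (n + 1) v.1)
  rwa [add_sub_cancel_right] at this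

end Disks

/-! ### Cofree comodules -/

/-- The dg algebra `ℚ`. -/
def baseAlg : DGAlg.{u} where
  carrier := ULift.{u} ℚ
  gr n := if n = 0 then ⊤ else ⊥
  isInternal := by
    refine isInternal_of_proj (fun n x => if n = 0 then x else 0)
      (fun n x y => by split_ifs <;> simp) ?_
      (fun x => Submodule.mem_iSup_of_mem 0 (by rw [if_pos rfl]; trivial))
    intro m n x hx
    by_cases hm : m = 0
    · subst hm; simp [eq_comm]
    · rw [if_neg hm, Submodule.mem_bot] at hx
      simp [hx]
  d := 0
  d_mem _ _ _ := zero_mem _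
  d_d _ := rfl
  one_mem := by rw [if_pos rfl]; trivial
  mul_mem i j a ha b hb := by
    by_cases hi : i = 0
    · by_cases hj : j = 0
      · rw [if_pos (by omega)]; trivial
      · rw [if_neg hj, Submodule.mem_bot] at hb
        rw [hb, mul_zero]; exact zero_mem _
    · rw [if_neg hi, Submodule.mem_bot] at ha
      rw [ha, zero_mul]; exact zero_mem _
  d_mul i a ha b := by simp

/-- A complex as a dg module over `ℚ`. -/
def DGVect.toBaseMod (W : DGVect.{u}) : DGMod baseAlg.{u} :=
  { W with
    moduleA := inferInstanceAs (Module (ULift.{u} ℚ) W.carrier)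
    tower := inferInstanceAs (IsScalarTower ℚ (ULift.{u} ℚ) W.carrier)
    smul_mem := fun i j (a : ULift.{u} ℚ) ha x hx => by
      by_cases hi : i = 0
      · rw [hi, zero_add]; exact (W.gr j).smul_mem a.down hx
      · have ha : a ∈ (if i = 0 then ⊤ else ⊥ : Submodule ℚ (ULift.{u} ℚ)) := ha
        rw [if_neg hi, Submodule.mem_bot] at ha
        subst ha
        change (0 : ULift.{u} ℚ) • x ∈ _
        rw [zero_smul]; exact zero_mem _
    d_smul := fun i (a : ULift.{u} ℚ) ha x => by
      have ha : a ∈ (if i = 0 then ⊤ else ⊥ : Submodule ℚ (ULift.{u} ℚ)) := ha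
      have h1 : W.d (a • x) = a • W.d x := W.d.map_smul a.down x
      have h2 : W.d (a • x) = (0 : ULift.{u} ℚ) • x + i.negOnePow • (a • W.d x) := by
        rw [h1]
        by_cases hi : i = 0
        · simp [hi]
        · rw [if_neg hi, Submodule.mem_bot] at ha
          simp [ha]
      exact h2 }

/-- The zero twisting chain. -/
def zeroTwist (C : DGCoalg.{u}) : TwistingChain C baseAlg.{u} where
  lin := 0
  mem _ _ _ := zero_mem _
  d_lin c := by
    have : signedMul C (0 : C.carrier →ₗ[ℚ] baseAlg.{u}.carrier) = 0 := by
      refine TensorProduct.ext' fun a b => ?_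
      simp
    rw [this]; simp

/-- The cofree dg comodule `C ⊗ W` on a complex `W`. -/
def cofree (C : DGCoalg.{u}) (W : DGVect.{u}) : DGComod C := coext (zeroTwist C) W.toBaseMod

theorem cofree_d (C : DGCoalg.{u}) (W : DGVect.{u}) (z : C.carrier ⊗[ℚ] W.carrier) :
    (cofree C W).d z = tensorD C.toDGVect W z := by
  have : coextTwist (zeroTwist C) W.toBaseMod = 0 := by
    refine TensorProduct.ext' fun c w => ?_
    rw [coextTwist_tmul]
    generalize (Coalgebra.comul c : C.carrier ⊗[ℚ] C.carrier) = y
    induction y with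
    | zero => simp
    | tmul a b => simp [zeroTwist]
    | add x y hx hy => simp only [map_add, hx, hy]; simp
  refine (LinearMap.congr_fun (congrArg (tensorD C.toDGVect W.toBaseMod.toDGVect + ·) this) z).trans
    (LinearMap.congr_fun (add_zero _) z)

namespace DGComod

variable {C : DGCoalg.{u}}

theorem twistPair_zeroTwist {N : DGComod C} {M : DGMod baseAlg.{u}}
    (θ : N.carrier →ₗ[ℚ] M.carrier) : twistPair (zeroTwist C) θ = 0 := by
  refine TensorProduct.ext' fun c n => ?_
  rw [twistPair_tmul]
  simp [zeroTwist]

variable (C) in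
/-- The functor forgetting the comodule structure, the differential and the grading. -/
def forget : DGComod C ⥤ ModuleCat.{u} ℚ where
  obj N := ModuleCat.of ℚ N.carrier
  map f := ModuleCat.ofHom (Hom.lin f)

variable (C) in
/-- The right adjoint of the forgetful functor. -/
def cofreeDisks (V : Type u) [AddCommGroup V] [Module ℚ V] : DGComod C := cofree C (disks V)

/-- Linear maps `N → V` as modular twists. -/
def disksEquiv (N : DGComod C) (V : Type u) [AddCommGroup V] [Module ℚ V] :
    (N.carrier →ₗ[ℚ] V) ≃ ModularTwist (zeroTwist C) N (disks V).toBaseMod where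
  toFun φ :=
    { lin := toDisks N.toDGVect φ
      mem := fun n x hx => ⟨_, (toDisks_of_mem N.toDGVect φ hx).symm⟩
      d_lin := fun x => (toDisks_d N.toDGVect φ x).symm.trans <| (sub_zero _).symm.trans <|
        congrArg (toDisks N.toDGVect φ (N.d x) - ·)
          (LinearMap.congr_fun (twistPair_zeroTwist (M := (disks V).toBaseMod) _) _).symm }
  invFun θ := disksSum V ∘ₗ θ.lin
  left_inv φ := disksSum_toDisks N.toDGVect φ
  right_inv θ := ModularTwist.ext (toDisks_disksSum N.toDGVect θ.lin θ.mem fun x => by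
    have := θ.d_lin x
    rw [twistPair_zeroTwist, LinearMap.zero_apply, sub_zero] at this
    exact this.symm)

/-- Morphisms into `cofreeDisks C V` are linear maps into `V`. -/
def cofreeDisksEquiv (N : DGComod C) (V : Type u) [AddCommGroup V] [Module ℚ V] :
    (N.carrier →ₗ[ℚ] V) ≃ (N ⟶ cofreeDisks C V) :=
  (disksEquiv N V).trans (coextHomEquiv N (disks V).toBaseMod).symm

theorem cofreeDisksEquiv_apply (N : DGComod C) (V : Type u) [AddCommGroup V] [Module ℚ V]
    (φ : N.carrier →ₗ[ℚ] V) (x : N.carrier) : Hom.lin (cofreeDisksEquiv N V φ) x =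
      (toDisks N.toDGVect φ).lTensor C.carrier (N.coact x) := rfl

theorem comp_cofreeDisksEquiv {M N : DGComod C} (f : M ⟶ N) (V : Type u) [AddCommGroup V]
    [Module ℚ V] (φ : N.carrier →ₗ[ℚ] V) :
    cofreeDisksEquiv M V (φ ∘ₗ Hom.lin f) = f ≫ cofreeDisksEquiv N V φ := by
  apply hom_ext
  intro x
  have : toDisks M.toDGVect (φ ∘ₗ Hom.lin f) = toDisks N.toDGVect φ ∘ₗ Hom.lin f := by
    refine graded_ext M.isInternal.submodule_iSup_eq_top fun n x hx => ?_
    rw [LinearMap.comp_apply, toDisks_of_mem _ _ hx, toDisks_of_mem _ _ (Hom.map_mem f n x hx),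
      ← Hom.map_d]
    rfl
  rw [cofreeDisksEquiv_apply, this, LinearMap.lTensor_comp_apply, ← Hom.map_coact]
  rfl

/-- A linear map into `V` can be recovered from the attached morphism into `cofreeDisks C V`. -/
theorem disksSum_cofreeDisksEquiv (N : DGComod C) (V : Type u) [AddCommGroup V] [Module ℚ V]
    (φ : N.carrier →ₗ[ℚ] V) (x : N.carrier) :
    disksSum V (counitMap C _ (Hom.lin (cofreeDisksEquiv N V φ) x)) = φ x := by
  have h : (twistOfCoextHom (cofreeDisksEquiv N V φ)).lin = toDisks N.toDGVect φ :=
    congrArg ModularTwist.lin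
      ((coextHomEquiv N (disks V).toBaseMod).apply_symm_apply (disksEquiv N V φ))
  have h2 := LinearMap.congr_fun h x
  have h3 := LinearMap.congr_fun (disksSum_toDisks N.toDGVect φ) x
  exact (congrArg (disksSum V) h2).trans h3

theorem injective_cofreeDisksEquiv (N : DGComod C) (V : Type u) [AddCommGroup V] [Module ℚ V]
    {φ : N.carrier →ₗ[ℚ] V} (hφ : Function.Injective φ) :
    Function.Injective (Hom.lin (cofreeDisksEquiv N V φ)) := by
  intro x y hxy
  apply hφ
  rw [← disksSum_cofreeDisksEquiv N V φ x, ← disksSum_cofreeDisksEquiv N V φ y, hxy]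

variable (C) in
/-- Morphisms of modules out of an underlying module, as morphisms of comodules. -/
def forgetHomEquiv (N : DGComod C) (V : ModuleCat.{u} ℚ) :
    ((forget C).obj N ⟶ V) ≃ (N ⟶ cofreeDisks C V) :=
  ModuleCat.homEquiv.trans (cofreeDisksEquiv N V)

theorem forgetHomEquiv_naturality (M N : DGComod C) (V : ModuleCat.{u} ℚ) (f : M ⟶ N)
    (g : (forget C).obj N ⟶ V) :
    forgetHomEquiv C M V ((forget C).map f ≫ g) = f ≫ forgetHomEquiv C N V g :=
  comp_cofreeDisksEquiv f V g.hom

variable (C) in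
/-- The forgetful functor is a left adjoint. -/
def forgetAdj : forget C ⊣ Adjunction.rightAdjointOfEquiv (forgetHomEquiv C)
    forgetHomEquiv_naturality :=
  Adjunction.adjunctionOfEquivRight _ _

instance : (forget C).ReflectsIsomorphisms where
  reflects f hf := isIso_of_bijective f (by
    have := (ConcreteCategory.isIso_iff_bijective ((forget C).map f)).1 hf
    exact this)

instance {M N : DGComod C} (f g : M ⟶ N) : PreservesLimit (parallelPair f g) (forget C) := by
  refine preservesLimit_of_preserves_limit_cone (isLimitEqFork f g) ?_
  refine (isLimitMapConeForkEquiv (forget C) _).symm ?_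
  refine Fork.IsLimit.mk _ (fun s => ModuleCat.ofHom (LinearMap.codRestrict
    (LinearMap.eqLocus (Hom.lin f) (Hom.lin g)) s.ι.hom fun x =>
      LinearMap.congr_fun (congrArg ModuleCat.Hom.hom s.condition) x)) (fun s => ?_)
    (fun s m hm => ?_)
  · rfl
  · ext x
    apply Subtype.ext
    exact LinearMap.congr_fun (congrArg ModuleCat.Hom.hom hm) x

instance : Comonad.PreservesLimitOfIsCoreflexivePair (forget C) where
  out _ _ _ := inferInstance

/-- Beck's theorem: `forget C` has a right adjoint, reflects isomorphisms and preserves equalizers,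
so it is comonadic, and comonadic functors create colimits. -/
instance : HasColimitsOfSize.{u, u} (DGComod C) := by
  have : HasCoreflexiveEqualizers (DGComod C) := ⟨fun _ _ _ => inferInstance⟩
  let := Comonad.comonadicOfHasPreservesCoreflexiveEqualizersOfReflectsIsomorphisms (forgetAdj C)
  let := comonadicCreatesColimits.{u, u} (forget C)
  exact hasColimits_of_hasColimits_createsColimits (forget C)

end DGComod

/-! ### Contractible comodules -/

section Contraction

variable {C : DGCoalg.{u}} {A : DGAlg.{u}} (τ : TwistingChain C A)

/-- The extension of a comodule with a colinear contraction is acyclic. -/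
theorem ext_acyclic (N : DGComod C) (h : N.carrier →ₗ[ℚ] N.carrier)
    (hd : ∀ x, N.d (h x) + h (N.d x) = x)
    (hc : ∀ x, N.coact (h x) = TensorProduct.map C.sgn h (N.coact x)) :
    Acyclic (extD τ N) := by
  -- The contracting homotopy will be `a ⊗ x ↦ (-1)^|a| a ⊗ h x`. This identity says that the two
  -- twisting terms cancel; it applies because `h` is colinear, and its sign comes from `τ` having
  -- degree `-1`.
  have aux : ∀ a (z : C.carrier ⊗[ℚ] N.carrier),
      extAux τ N.carrier a (TensorProduct.map C.sgn h z) +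
        TensorProduct.map A.sgn h (extAux τ N.carrier (A.sgn a) z) = 0 := by
    intro a z
    induction z with
    | zero => simp
    | tmul c x =>
      simp [A.sgn_mul, A.sgn_sgn, τ.lin_sgn, TensorProduct.neg_tmul]
    | add x y hx hy =>
      rw [map_add, map_add, map_add, map_add, add_add_add_comm, hx, hy, add_zero]
  have key : ∀ z, extD τ N (TensorProduct.map A.sgn h z) +
      TensorProduct.map A.sgn h (extD τ N z) = z := by
    intro z
    induction z with
    | zero => simp
    | tmul a x =>
      have h1 : a ⊗ₜ[ℚ] N.d (h x) + a ⊗ₜ[ℚ] h (N.d x) = a ⊗ₜ[ℚ] x := by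
        rw [← TensorProduct.tmul_add, hd]
      have h2 := aux a (N.coact x)
      rw [TensorProduct.map_tmul, extD_tmul, extD_tmul, hc, A.sgn_sgn, A.d_sgn, map_sub, map_add,
        TensorProduct.map_tmul, TensorProduct.map_tmul, A.sgn_sgn, TensorProduct.neg_tmul]
      rw [← h1, ← sub_eq_zero, ← neg_eq_zero, ← h2]
      abel
    | add x y hx hy =>
      rw [map_add, map_add, map_add, map_add, add_add_add_comm, hx, hy]
  intro z hz
  refine ⟨TensorProduct.map A.sgn h z, ?_⟩
  have := key z
  rwa [hz, map_zero, add_zero] at this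

/-- The map `c ⊗ w ↦ (-1)^|c| c ⊗ h w` contracts `C ⊗ W` and is colinear, since it leaves the `C`
factor alone up to sign. -/
theorem ext_cofree_acyclic (W : DGVect.{u}) (h : W.carrier →ₗ[ℚ] W.carrier)
    (hd : ∀ x, W.d (h x) + h (W.d x) = x) : Acyclic (extD τ (cofree C W)) := by
  have h1 : ∀ z : C.carrier ⊗[ℚ] W.carrier, tensorD C.toDGVect W (TensorProduct.map C.sgn h z) +
      TensorProduct.map C.sgn h (tensorD C.toDGVect W z) = z := by
    intro z
    induction z with
    | zero => simp
    | tmul c w =>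
      rw [TensorProduct.map_tmul, tensorD_tmul, tensorD_tmul, map_add, TensorProduct.map_tmul,
        TensorProduct.map_tmul, C.d_sgn, C.sgn_sgn, TensorProduct.neg_tmul]
      have h1 : c ⊗ₜ[ℚ] W.d (h w) + c ⊗ₜ[ℚ] h (W.d w) = c ⊗ₜ[ℚ] w := by
        rw [← TensorProduct.tmul_add, hd]
      rw [← h1]
      abel
    | add x y hx hy =>
      rw [map_add, map_add, map_add, map_add, add_add_add_comm, hx, hy]
  have h2 : ∀ z : C.carrier ⊗[ℚ] W.carrier,
      cofreeCoact C W.carrier (TensorProduct.map C.sgn h z) =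
        TensorProduct.map C.sgn (TensorProduct.map C.sgn h) (cofreeCoact C W.carrier z) := by
    intro z
    induction z with
    | zero => simp
    | tmul c w =>
      rw [TensorProduct.map_tmul]
      simp only [cofreeCoact, LinearMap.comp_apply, LinearMap.rTensor_tmul, LinearEquiv.coe_coe,
        C.comul_sgn]
      generalize (Coalgebra.comul c : C.carrier ⊗[ℚ] C.carrier) = y
      induction y with
      | zero => simp
      | tmul x y => simp
      | add x y hx hy => simp only [map_add, TensorProduct.add_tmul, hx, hy]
    | add x y hx hy => simp only [map_add, hx, hy]
  refine ext_acyclic τ (cofree C W) (TensorProduct.map C.sgn h) (fun z => ?_) h2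
  refine Eq.trans ?_ (h1 z)
  refine congrArg₂ (fun x y : C.carrier ⊗[ℚ] W.carrier => x + y) (cofree_d C W _)
    (congrArg (TensorProduct.map C.sgn h) (cofree_d C W z))

theorem ext_cofreeDisks_acyclic (V : Type u) [AddCommGroup V] [Module ℚ V] :
    Acyclic (extD τ (DGComod.cofreeDisks C V)) :=
  ext_cofree_acyclic τ (disks V) (disksH V) (disksH_contraction V)

end Contraction

/-! ### Trivial comodules and free modules -/

section Free

variable {C : DGCoalg.{u}} (η : Coaugmentation C)

/-- A complex as a comodule with trivial coaction `x ↦ e ⊗ x`. -/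
def trivComod (W : DGVect.{u}) : DGComod C :=
  { W with
    coact := TensorProduct.mk ℚ C.carrier W.carrier η.e
    coact_mem := fun n x hx => tmul_mem_tensorGr η.e_mem hx (zero_add n)
    coact_d := fun x => by
      rw [TensorProduct.mk_apply, TensorProduct.mk_apply, tensorD_tmul, η.d_e, sgn_e,
        TensorProduct.zero_tmul, zero_add]
    coassoc := fun x => by simp [η.comul_e]
    counit := fun x => by simp [η.counit_e] }

variable (V : Type u) [AddCommGroup V] [Module ℚ V]

/-- The free module on a sum of disks. -/
def freeDisks : DGMod (cobar C η) := ext (universalTwist C η) (trivComod η (disks V))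

theorem freeDisks_acyclic : Acyclic (freeDisks η V).d := by
  refine ext_acyclic (universalTwist C η) (trivComod η (disks V)) (disksH V)
    (disksH_contraction V) fun x => ?_
  change η.e ⊗ₜ[ℚ] disksH V x = C.sgn η.e ⊗ₜ[ℚ] disksH V x
  rw [sgn_e]

variable {η V}

/-- Morphisms out of a free module. -/
def freeDisksDesc (M : DGMod (cobar C η)) (φ : ℤ → V →ₗ[ℚ] M.carrier)
    (hφ : ∀ n v, φ n v ∈ M.gr n) : freeDisks η V ⟶ M :=
  extHomOfTwist (τ := universalTwist C η) (N := trivComod η (disks V))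
    { lin := ofDisks M.toDGVect φ
      mem := ofDisks_mem M.toDGVect φ hφ
      d_lin := fun x => by
        have h1 : twistPair (N := trivComod η (disks V)) (universalTwist C η)
            (ofDisks M.toDGVect φ) (η.e ⊗ₜ x) = 0 :=
          (congrArg (fun a : (cobar C η).carrier => a • ofDisks M.toDGVect φ x)
            (cobarT_e (C := C) (η := η))).trans (zero_smul _ _)
        exact (ofDisks_d M.toDGVect φ x).symm.trans ((sub_zero _).symm.trans
          (congrArg (ofDisks M.toDGVect φ (disksD V x) - ·) h1.symm)) }

variable (η V) in
/-- The inclusion of the generating complex in a free module. -/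
def freeDisksInc : (ℤ →₀ V × V) →ₗ[ℚ] (freeDisks η V).carrier :=
  TensorProduct.mk ℚ (cobar C η).carrier (ℤ →₀ V × V) 1

/-- The generators of a free module. -/
def freeDisksGen (n : ℤ) : V →ₗ[ℚ] (freeDisks η V).carrier :=
  freeDisksInc η V ∘ₗ Finsupp.lsingle n ∘ₗ LinearMap.inr ℚ V V

theorem freeDisksGen_mem (n : ℤ) (v : V) : freeDisksGen (η := η) n v ∈ (freeDisks η V).gr n :=
  tmul_mem_tensorGr one_mem_cobarGr (𝒲 := (disks V).gr) ⟨_, rfl⟩ (zero_add n)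

theorem freeDisksDesc_gen (M : DGMod (cobar C η)) (φ : ℤ → V →ₗ[ℚ] M.carrier)
    (hφ : ∀ n v, φ n v ∈ M.gr n) (n : ℤ) (v : V) :
    DGMod.Hom.lin (freeDisksDesc M φ hφ) (freeDisksGen n v) = φ n v := by
  have h : ofDisks M.toDGVect φ (Finsupp.single n (0, v)) = φ n v := by simp
  exact (one_smul (cobar C η).carrier _).trans h

theorem freeDisks_d_inc (x : ℤ →₀ V × V) :
    (freeDisks η V).d (freeDisksInc η V x) = freeDisksInc η V (disksD V x) := by
  have h3 : (universalTwist C η).lin η.e = 0 := cobarT_e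
  have key : ∀ (N : DGComod C) (x : N.carrier), N.coact x = η.e ⊗ₜ x →
      extD (universalTwist C η) N (1 ⊗ₜ x) = 1 ⊗ₜ N.d x := by
    intro N x hx
    rw [extD_tmul, DGAlg.d_one, DGAlg.sgn_one, TensorProduct.zero_tmul, zero_add, hx, extAux_tmul,
      h3, mul_zero, TensorProduct.zero_tmul, sub_zero]
  exact key (trivComod η (disks V)) x rfl

theorem freeDisks_hom_ext {M : DGMod (cobar C η)} {f g : freeDisks η V ⟶ M}
    (h : ∀ n v, DGMod.Hom.lin f (freeDisksGen n v) = DGMod.Hom.lin g (freeDisksGen n v)) :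
    f = g := by
  have h1 : ∀ x, DGMod.Hom.lin f (freeDisksInc η V x) =
      DGMod.Hom.lin g (freeDisksInc η V x) := by
    intro x
    induction x using Finsupp.induction_linear with
    | zero => simp
    | add x y hx hy => rw [map_add, map_add, map_add, hx, hy]
    | single n v =>
      -- The first coordinate in degree `n` is the boundary of the generator in degree `n + 1`, so a
      -- chain map is determined by its values on second coordinates.
      have e1 : Finsupp.single n v = disksD V (Finsupp.single (n + 1) (0, v.1)) +
          Finsupp.single n (0, v.2) := by
        simp [← Finsupp.single_add]
      have e2 : freeDisksInc η V (Finsupp.single n v) =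
          (freeDisks η V).d (freeDisksGen (n + 1) v.1) + freeDisksGen n v.2 := by
        rw [e1, map_add, ← freeDisks_d_inc]
        rfl
      rw [e2, map_add, map_add, DGMod.Hom.map_d, DGMod.Hom.map_d, h, h]
  apply (extHomEquiv (τ := universalTwist C η) (trivComod η (disks V)) M).injective
  exact ModularTwist.ext (LinearMap.ext h1)

/-- Every module is a quotient of a free module. -/
theorem exists_freeDisks_surjective (M : DGMod (cobar C η)) :
    ∃ g : freeDisks η M.carrier ⟶ M, Function.Surjective (DGMod.Hom.lin g) := by
  refine ⟨freeDisksDesc M (fun n => M.toDGVect.proj n) fun n v => M.toDGVect.proj_mem n v, ?_⟩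
  intro x
  refine M.toDGVect.mem_of_proj_mem (S := LinearMap.range (DGMod.Hom.linQ
    (freeDisksDesc M (fun n => M.toDGVect.proj n) fun n v => M.toDGVect.proj_mem n v)))
    fun n => ⟨freeDisksGen n x, freeDisksDesc_gen M (fun n => M.toDGVect.proj n)
      (fun n v => M.toDGVect.proj_mem n v) n x⟩

/-- Free modules are projective. -/
theorem freeDisks_projective {M N : DGMod (cobar C η)} (p : M ⟶ N)
    (hp : Function.Surjective (DGMod.Hom.lin p)) (g : freeDisks η V ⟶ N) :
    ∃ l : freeDisks η V ⟶ M, l ≫ p = g := by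
  -- A section over `ℚ` is enough: after projection to degree `n` it prescribes images of the
  -- generators, and freeness extends these to a morphism of dg modules.
  obtain ⟨s, hs⟩ := (DGMod.Hom.linQ p).exists_rightInverse_of_surjective
    (LinearMap.range_eq_top.2 hp)
  refine ⟨freeDisksDesc M (fun n => M.toDGVect.proj n ∘ₗ s ∘ₗ DGMod.Hom.linQ g ∘ₗ freeDisksGen n)
    fun n v => M.toDGVect.proj_mem n _, ?_⟩
  refine freeDisks_hom_ext fun n v => ?_
  rw [DGMod.comp_lin, LinearMap.comp_apply, freeDisksDesc_gen]
  refine (DGVect.map_proj₀ (DGMod.Hom.map_mem p) (f := DGMod.Hom.linQ p) n _).trans ?_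
  refine (congrArg (N.toDGVect.proj n) (LinearMap.congr_fun hs _)).trans ?_
  exact N.toDGVect.proj_same (DGMod.Hom.map_mem g n _ (freeDisksGen_mem n v))

end Free

/-! ### The counit of the adjunction -/

section Counit

variable {C : DGCoalg.{u}} {η : Coaugmentation C}

/-! ### The splitting of the standard resolution over a tensor algebra. -/

section Contraction

variable {M : Type u} [AddCommGroup M] [Module ℚ M] [Module (cobarCarrier C η) M]
  [IsScalarTower ℚ (cobarCarrier C η) M]

variable (η) in
/-- The projection `c ↦ c - ε(c) e`. -/
def coaugProj : C.carrier →ₗ[ℚ] C.carrier :=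
  LinearMap.id - (Coalgebra.counit (R := ℚ)).smulRight η.e

theorem coaugProj_apply (c : C.carrier) :
    coaugProj η c = c - Coalgebra.counit (R := ℚ) c • η.e := rfl

theorem coaugProj_e : coaugProj η η.e = 0 := by
  rw [coaugProj_apply, η.counit_e, one_smul, sub_self]

theorem counit_coaugProj (c : C.carrier) : Coalgebra.counit (R := ℚ) (coaugProj η c) = 0 := by
  rw [coaugProj_apply, map_sub, map_smul, η.counit_e, smul_eq_mul, mul_one, sub_self]

theorem cobarT_coaugProj (c : C.carrier) : cobarT C η (coaugProj η c) = cobarT C η c := by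
  rw [coaugProj_apply, map_sub, map_smul, cobarT_e, smul_zero, sub_zero]

variable (C η M) in
/-- The action of the generators in `crossedAction`. -/
def crossedGen (a : cobarCarrier C η) (c : C.carrier) :
    Module.End ℚ (M × (cobarCarrier C η ⊗[ℚ] (C.carrier ⊗[ℚ] M))) where
  toFun x := (a • x.1, a • x.2 + 1 ⊗ₜ (c ⊗ₜ x.1))
  map_add' x y := by
    simp only [Prod.fst_add, Prod.snd_add, smul_add, TensorProduct.tmul_add, Prod.mk_add_mk]
    congr 1
    abel
  map_smul' q x := by
    simp [smul_comm a q]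

variable (C η M) in
/-- The action of `ΩC` on `M × (ΩC ⊗ (C ⊗ M))` encoding a crossed homomorphism. -/
def crossedAction : cobarCarrier C η →ₐ[ℚ]
    Module.End ℚ (M × (cobarCarrier C η ⊗[ℚ] (C.carrier ⊗[ℚ] M))) :=
  cobarLift
    { toFun := fun c => crossedGen C η M (cobarT C η c) (coaugProj η c)
      map_add' := fun a b => by
        refine LinearMap.ext fun x => Prod.ext ?_ ?_
        · simp [crossedGen, add_smul]
        · simp only [crossedGen, LinearMap.add_apply, LinearMap.coe_mk, AddHom.coe_mk, map_add,
            add_smul, TensorProduct.add_tmul, TensorProduct.tmul_add, Prod.snd_add]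
          abel
      map_smul' := fun q a => by
        refine LinearMap.ext fun x => Prod.ext ?_ ?_
        · simp [crossedGen]
        · simp only [crossedGen, LinearMap.smul_apply, LinearMap.coe_mk, AddHom.coe_mk, map_smul,
            RingHom.id_apply, Prod.smul_snd, smul_add, smul_assoc, ← TensorProduct.smul_tmul',
            TensorProduct.tmul_smul] }
    (by
      refine LinearMap.ext fun x => Prod.ext ?_ ?_ <;> simp [crossedGen, coaugProj_e])

theorem crossedAction_cobarT (c : C.carrier)
    (x : M × (cobarCarrier C η ⊗[ℚ] (C.carrier ⊗[ℚ] M))) :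
    crossedAction C η M (cobarT C η c) x =
      (cobarT C η c • x.1, cobarT C η c • x.2 + 1 ⊗ₜ (coaugProj η c ⊗ₜ x.1)) := by
  rw [crossedAction, cobarLift_cobarT]
  rfl

/-- The action is lower triangular, with `a` on the diagonal; its off-diagonal entry is the crossed
homomorphism. This form makes the universal property of the tensor algebra define a map that is not
multiplicative. -/
theorem crossedAction_eq (a : cobarCarrier C η)
    (x : M × (cobarCarrier C η ⊗[ℚ] (C.carrier ⊗[ℚ] M))) :
    crossedAction C η M a x = (a • x.1, a • x.2 + (crossedAction C η M a (x.1, 0)).2) := by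
  induction a using cobar_induction generalizing x with
  | algebraMap r => simp [Module.algebraMap_end_apply, Prod.smul_def]
  | t c => simp [crossedAction_cobarT]
  | mul a b ha hb =>
    have h1 := hb (x.1, 0)
    have h2 := ha (b • x.1, (crossedAction C η M b (x.1, 0)).2)
    rw [smul_zero, zero_add] at h1
    rw [map_mul, Module.End.mul_apply, hb, ha, Module.End.mul_apply, h1, h2]
    simp only [mul_smul, smul_add, add_assoc]
  | add a b ha hb =>
    rw [map_add, LinearMap.add_apply, ha, hb, LinearMap.add_apply, Prod.snd_add, add_smul, add_smul,
      Prod.mk_add_mk]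
    congr 1
    abel

variable (C η M) in
/-- The crossed homomorphism `s` with `s(ta ⊗ m) = 1 ⊗ (a - ε(a) e) ⊗ m`. -/
def crossedHom : cobarCarrier C η ⊗[ℚ] M →ₗ[ℚ] cobarCarrier C η ⊗[ℚ] (C.carrier ⊗[ℚ] M) :=
  TensorProduct.lift
    { toFun := fun a => LinearMap.snd ℚ _ _ ∘ₗ crossedAction C η M a ∘ₗ LinearMap.inl ℚ _ _
      map_add' := fun a b => by ext; simp
      map_smul' := fun a b => by ext; simp }

theorem crossedHom_cobarT (c : C.carrier) (m : M) :
    crossedHom C η M (cobarT C η c ⊗ₜ m) = 1 ⊗ₜ (coaugProj η c ⊗ₜ m) := by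
  simp [crossedHom, crossedAction_cobarT]

/-- This cocycle rule is the off-diagonal entry of a product of two triangular operators. -/
theorem crossedHom_mul (a b : cobarCarrier C η) (m : M) :
    crossedHom C η M ((a * b) ⊗ₜ m) =
      a • crossedHom C η M (b ⊗ₜ m) + crossedHom C η M (a ⊗ₜ (b • m)) := by
  simp only [crossedHom, TensorProduct.lift.tmul, LinearMap.coe_mk, AddHom.coe_mk,
    LinearMap.comp_apply, LinearMap.snd_apply, LinearMap.inl_apply, map_mul, Module.End.mul_apply]
  rw [crossedAction_eq b, crossedAction_eq a, smul_zero, zero_add]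

theorem crossedHom_algebraMap (r : ℚ) (m : M) :
    crossedHom C η M (algebraMap ℚ _ r ⊗ₜ m) = 0 := by
  simp [crossedHom, Module.algebraMap_end_apply]

variable (C η M) in
/-- The map `a ⊗ c ⊗ m ↦ a ⊗ (tc • m) - (a tc) ⊗ m`. -/
def crossedDiff : cobarCarrier C η ⊗[ℚ] (C.carrier ⊗[ℚ] M) →ₗ[ℚ] cobarCarrier C η ⊗[ℚ] M :=
  (TensorProduct.lift ((Algebra.lsmul ℚ ℚ M).toLinearMap ∘ₗ cobarT C η)).lTensor _ -
    (LinearMap.mul' ℚ _ ∘ₗ (cobarT C η).lTensor _).rTensor M ∘ₗ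
      (TensorProduct.assoc ℚ _ _ _).symm.toLinearMap

theorem crossedDiff_tmul (a : cobarCarrier C η) (c : C.carrier) (m : M) :
    crossedDiff C η M (a ⊗ₜ (c ⊗ₜ m)) =
      a ⊗ₜ (cobarT C η c • m) - (a * cobarT C η c) ⊗ₜ m := by
  simp [crossedDiff]

theorem crossedDiff_smul (a : cobarCarrier C η)
    (z : cobarCarrier C η ⊗[ℚ] (C.carrier ⊗[ℚ] M)) :
    crossedDiff C η M (a • z) = a • crossedDiff C η M z := by
  induction z with
  | zero => simp
  | add x y hx hy => rw [smul_add, map_add, map_add, smul_add, hx, hy]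
  | tmul b y =>
    induction y with
    | zero => simp
    | add x y hx hy =>
      rw [TensorProduct.tmul_add, smul_add, map_add, map_add, smul_add, hx, hy]
    | tmul c m =>
      simp [TensorProduct.smul_tmul', crossedDiff_tmul, smul_sub, mul_assoc]

variable (C η M) in
/-- The map `a ⊗ c ⊗ m ↦ ε(c) a ⊗ m`. -/
def crossedCounit : cobarCarrier C η ⊗[ℚ] (C.carrier ⊗[ℚ] M) →ₗ[ℚ] cobarCarrier C η ⊗[ℚ] M :=
  (counitMap C M).lTensor _

theorem crossedCounit_smul (a : cobarCarrier C η)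
    (z : cobarCarrier C η ⊗[ℚ] (C.carrier ⊗[ℚ] M)) :
    crossedCounit C η M (a • z) = a • crossedCounit C η M z := by
  induction z with
  | zero => simp
  | add x y hx hy => rw [smul_add, map_add, map_add, smul_add, hx, hy]
  | tmul b y => simp [TensorProduct.smul_tmul', crossedCounit]

/-- A telescoping sum. On a word `tc₁ ⋯ tcₖ ⊗ m` the crossed homomorphism lists the positions of the
tensor sign, and `crossedDiff` takes the difference of the two ways of passing each generator across
it; what survives is the fully multiplied term minus the word itself. -/
theorem crossedDiff_crossedHom (z : cobarCarrier C η ⊗[ℚ] M) :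
    crossedDiff C η M (crossedHom C η M z) =
      1 ⊗ₜ TensorProduct.lift (Algebra.lsmul ℚ ℚ M).toLinearMap z - z := by
  induction z with
  | zero => simp
  | add x y hx hy =>
    rw [map_add, map_add, hx, hy, map_add, TensorProduct.tmul_add]
    abel
  | tmul a m =>
    rw [TensorProduct.lift.tmul]
    change _ = 1 ⊗ₜ (a • m) - a ⊗ₜ m
    induction a using cobar_induction generalizing m with
    | algebraMap r =>
      rw [crossedHom_algebraMap, map_zero, algebraMap_smul, TensorProduct.tmul_smul,
        Algebra.algebraMap_eq_smul_one, TensorProduct.smul_tmul', sub_self]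
    | t c =>
      rw [crossedHom_cobarT, crossedDiff_tmul, cobarT_coaugProj, one_mul]
    | mul a b ha hb =>
      rw [crossedHom_mul, map_add, crossedDiff_smul, hb, ha, mul_smul, smul_sub,
        TensorProduct.smul_tmul', TensorProduct.smul_tmul', smul_eq_mul, smul_eq_mul, mul_one]
      abel
    | add a b ha hb =>
      rw [TensorProduct.add_tmul, map_add, map_add, ha, hb, add_smul, TensorProduct.tmul_add]
      abel

/-- The second half of the splitting. By the cocycle rule the terms in which `a` is taken apart
cancel, leaving the one in which the new generator `tc` is. It shows that `crossedDiff` is injective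
on the part where `ε` vanishes. -/
theorem crossedHom_crossedDiff (z : cobarCarrier C η ⊗[ℚ] (C.carrier ⊗[ℚ] M)) :
    crossedHom C η M (crossedDiff C η M z) =
      - ((coaugProj η).rTensor M).lTensor _ z := by
  induction z with
  | zero => simp
  | add x y hx hy => rw [map_add, map_add, map_add, hx, hy]; abel
  | tmul b y =>
    induction y with
    | zero => simp
    | add x y hx hy =>
      rw [TensorProduct.tmul_add, map_add, map_add, map_add, hx, hy]; abel
    | tmul c m =>
      rw [crossedDiff_tmul, map_sub, crossedHom_mul, crossedHom_cobarT, TensorProduct.smul_tmul']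
      simp

/-- The crossed homomorphism only produces the normalized elements `c - ε(c) e`. -/
theorem crossedCounit_crossedHom (z : cobarCarrier C η ⊗[ℚ] M) :
    crossedCounit C η M (crossedHom C η M z) = 0 := by
  induction z with
  | zero => simp
  | add x y hx hy => rw [map_add, map_add, hx, hy, add_zero]
  | tmul a m =>
    induction a using cobar_induction generalizing m with
    | algebraMap r => rw [crossedHom_algebraMap, map_zero]
    | t c =>
      rw [crossedHom_cobarT, crossedCounit, LinearMap.lTensor_tmul, counitMap_tmul,
        counit_coaugProj, zero_smul, TensorProduct.tmul_zero]
    | mul a b ha hb =>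
      rw [crossedHom_mul, map_add, crossedCounit_smul, hb, ha, smul_zero, add_zero]
    | add a b ha hb => rw [TensorProduct.add_tmul, map_add, map_add, ha, hb, add_zero]

end Contraction

/-- The differential of `A ⊗_τ (C ⊗^τ M)`. -/
def extCoextD {A : DGAlg.{u}} (τ : TwistingChain C A) (M : DGMod A) :
    A.carrier ⊗[ℚ] (C.carrier ⊗[ℚ] M.carrier) →ₗ[ℚ] A.carrier ⊗[ℚ] (C.carrier ⊗[ℚ] M.carrier) :=
  extD τ (coext τ M)

theorem extCoextD_tmul {A : DGAlg.{u}} (τ : TwistingChain C A) (M : DGMod A) (a : A.carrier)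
    (y : C.carrier ⊗[ℚ] M.carrier) : extCoextD τ M (a ⊗ₜ y) =
      A.d a ⊗ₜ y + A.sgn a ⊗ₜ coextD τ M y -
        extAux τ (C.carrier ⊗[ℚ] M.carrier) (A.sgn a) (cofreeCoact C M.carrier y) :=
  extD_tmul τ (coext τ M) a y

/-- The differential of `A ⊗_τ (C ⊗^τ M)` after applying the counit of `C`. -/
theorem lTensor_counitMap_extD {A : DGAlg.{u}} (τ : TwistingChain C A) (M : DGMod A)
    (φ : A.carrier ⊗[ℚ] (C.carrier ⊗[ℚ] M.carrier) →ₗ[ℚ] A.carrier ⊗[ℚ] M.carrier)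
    (hφ : ∀ a c m, φ (a ⊗ₜ (c ⊗ₜ m)) = a ⊗ₜ (τ.lin c • m) - (a * τ.lin c) ⊗ₜ m)
    (z : A.carrier ⊗[ℚ] (C.carrier ⊗[ℚ] M.carrier)) :
    (counitMap C M.carrier).lTensor A.carrier (extCoextD τ M z) =
      tensorD A.toDGVect M.toDGVect ((counitMap C M.carrier).lTensor A.carrier z) +
        φ (A.sgn.rTensor _ z) := by
  induction z with
  | zero => simp
  | add x y hx hy =>
    simp only [map_add, hx, hy]
    abel
  | tmul a y =>
    rw [extCoextD_tmul, map_sub, map_add, LinearMap.lTensor_tmul, LinearMap.lTensor_tmul,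
      LinearMap.lTensor_tmul, tensorD_tmul, LinearMap.rTensor_tmul, counitMap_coextD]
    have h2 : ∀ w : C.carrier ⊗[ℚ] (C.carrier ⊗[ℚ] M.carrier),
        (counitMap C M.carrier).lTensor A.carrier (extAux τ _ (A.sgn a) w) =
          extAux τ M.carrier (A.sgn a) ((counitMap C M.carrier).lTensor C.carrier w) := by
      intro w
      induction w with
      | zero => simp
      | add x y hx hy => simp only [map_add, hx, hy]
      | tmul c m => simp
    have h3 : ∀ y : C.carrier ⊗[ℚ] M.carrier, φ (A.sgn a ⊗ₜ y) = A.sgn a ⊗ₜ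
        (TensorProduct.lift ((Algebra.lsmul ℚ ℚ M.carrier).toLinearMap ∘ₗ τ.lin) y) -
          extAux τ M.carrier (A.sgn a) y := by
      intro y
      induction y with
      | zero => simp
      | add x y hx hy =>
        rw [map_add, map_add, TensorProduct.tmul_add, TensorProduct.tmul_add, map_add, hx, hy]
        abel
      | tmul c m => rw [hφ]; rfl
    have h4 : A.toDGVect.sgn a = A.sgn a := rfl
    rw [h2, h3, lTensor_counitMap_cofreeCoact, TensorProduct.tmul_add, h4]
    abel

/-- The splitting, transported from the tensor algebra to the dg algebra `cobar C η` and reduced to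
the four properties used for the counit. -/
theorem crossedHom_exists (M : DGMod (cobar C η)) :
    ∃ (s : (cobar C η).carrier ⊗[ℚ] M.carrier →ₗ[ℚ]
        (cobar C η).carrier ⊗[ℚ] (C.carrier ⊗[ℚ] M.carrier))
      (φ : (cobar C η).carrier ⊗[ℚ] (C.carrier ⊗[ℚ] M.carrier) →ₗ[ℚ]
        (cobar C η).carrier ⊗[ℚ] M.carrier),
      (∀ a c m, φ (a ⊗ₜ (c ⊗ₜ m)) = a ⊗ₜ ((universalTwist C η).lin c • m) -
        (a * (universalTwist C η).lin c) ⊗ₜ m) ∧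
      (∀ z, φ (s z) = 1 ⊗ₜ TensorProduct.lift
        (Algebra.lsmul ℚ ℚ (A := (cobar C η).carrier) M.carrier).toLinearMap z - z) ∧
      (∀ z, s (φ z) = - ((coaugProj η).rTensor M.carrier).lTensor _ z) ∧
      ∀ z, (counitMap C M.carrier).lTensor _ (s z) = 0 := by
  let i1 : Module (cobarCarrier C η) M.carrier := M.moduleA
  have i2 : IsScalarTower ℚ (cobarCarrier C η) M.carrier := M.tower
  exact ⟨crossedHom C η M.carrier, crossedDiff C η M.carrier, crossedDiff_tmul,
    crossedDiff_crossedHom, crossedHom_crossedDiff, crossedCounit_crossedHom⟩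

/-- The counit `t^! t_* M ⟶ M`. -/
def counitHom (M : DGMod (cobar C η)) : (tShriek C η).obj ((tLowerStar C η).obj M) ⟶ M :=
  (tAdj C η).counit.app M

theorem counitHom_apply (M : DGMod (cobar C η))
    (z : (cobar C η).carrier ⊗[ℚ] (C.carrier ⊗[ℚ] M.carrier)) :
    DGMod.Hom.lin (counitHom M) z = TensorProduct.lift
      (Algebra.lsmul ℚ ℚ (A := (cobar C η).carrier) M.carrier).toLinearMap
        ((counitMap C M.carrier).lTensor _ z) := by
  have h1 : DGMod.Hom.linQ (counitHom M) = TensorProduct.lift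
      (Algebra.lsmul ℚ ℚ (A := (cobar C η).carrier) M.carrier).toLinearMap ∘ₗ
        (counitMap C M.carrier).lTensor _ :=
    TensorProduct.ext' fun a y => rfl
  exact LinearMap.congr_fun h1 z

theorem counitHom_surjective (M : DGMod (cobar C η)) :
    Function.Surjective (DGMod.Hom.lin (counitHom M)) := by
  intro m
  refine ⟨(1 : (cobar C η).carrier) ⊗ₜ[ℚ] (η.e ⊗ₜ[ℚ] m), ?_⟩
  have h1 : TensorProduct.lift (Algebra.lsmul ℚ ℚ (A := (cobar C η).carrier) M.carrier).toLinearMap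
      ((counitMap C M.carrier).lTensor (cobar C η).carrier (1 ⊗ₜ (η.e ⊗ₜ m))) = m := by
    simp [η.counit_e]
  exact (counitHom_apply M _).trans h1

/-- The counit of the adjunction is a quasi-isomorphism. -/
theorem quasiIso_counitHom (M : DGMod (cobar C η)) :
    DGMod.quasiIso (cobar C η) (counitHom M) := by
  rw [DGMod.quasiIso_iff]
  refine QIso.of_surjective (DGMod.Hom.map_d (counitHom M)) (DGVect.d_d _)
    (counitHom_surjective M) ?_
  obtain ⟨s, φ, hφ, h1, h2, h3⟩ := crossedHom_exists M
  set p := (counitMap C M.carrier).lTensor (cobar C η).carrier with hp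
  have hd := lTensor_counitMap_extD (universalTwist C η) M φ hφ
  have hσ : ∀ z : (cobar C η).carrier ⊗[ℚ] (C.carrier ⊗[ℚ] M.carrier),
      (cobar C η).sgn.rTensor _ ((cobar C η).sgn.rTensor (C.carrier ⊗[ℚ] M.carrier) z) = z := by
    intro z
    rw [← LinearMap.rTensor_comp_apply]
    have : (cobar C η).sgn ∘ₗ (cobar C η).sgn = LinearMap.id := LinearMap.ext (cobar C η).sgn_sgn
    rw [this, LinearMap.rTensor_id_apply]
  have hpσ : ∀ z : (cobar C η).carrier ⊗[ℚ] (C.carrier ⊗[ℚ] M.carrier),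
      p ((cobar C η).sgn.rTensor (C.carrier ⊗[ℚ] M.carrier) z) = (cobar C η).sgn.rTensor M.carrier (p z) := by
    intro z
    rw [hp, ← LinearMap.comp_apply, LinearMap.lTensor_comp_rTensor, ← LinearMap.comp_apply,
      LinearMap.rTensor_comp_lTensor]
  suffices key : ∀ x : (cobar C η).carrier ⊗[ℚ] (C.carrier ⊗[ℚ] M.carrier),
      TensorProduct.lift (Algebra.lsmul ℚ ℚ (A := (cobar C η).carrier) M.carrier).toLinearMap (p x) = 0 →
      extCoextD (universalTwist C η) M x = 0 → ∃ w, p w = 0 ∧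
        extCoextD (universalTwist C η) M w = x by
    intro x hx hx'
    obtain ⟨w, hw, hw'⟩ := key x ((counitHom_apply M x).symm.trans hx) hx'
    exact ⟨w, (counitHom_apply M w).trans ((congrArg _ hw).trans (map_zero _)), hw'⟩
  intro x hx hx'
  -- As `p x` is killed by the action map, `φ (s (p x)) = - p x`. Since `p w = 0`, the formula `hd`
  -- then gives `p (dw) = p x`.
  set w := - (cobar C η).sgn.rTensor _ (s (p x)) with hw
  have hpw : p w = 0 := by rw [hw, map_neg, hpσ, h3, map_zero, neg_zero]
  have hφw : φ ((cobar C η).sgn.rTensor _ w) = p x := by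
    rw [hw, map_neg, hσ, map_neg, h1, hx, TensorProduct.tmul_zero, zero_sub, neg_neg]
  have hdw := hd w
  rw [hpw, map_zero, zero_add, hφw] at hdw
  refine ⟨w, hpw, ?_⟩
  -- The remainder is a cycle with `p z = 0`, so `hd` leaves only `φ` of it up to sign, which must
  -- vanish. As `φ` is injective on the kernel of `p`, the remainder is zero and `w` needs no
  -- correction.
  set z := x - extCoextD (universalTwist C η) M w with hz
  have hpz : p z = 0 := by rw [hz, map_sub, hdw, sub_self]
  have hdz : extCoextD (universalTwist C η) M z = 0 := by
    rw [hz, map_sub, hx', zero_sub, neg_eq_zero]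
    exact extD_extD (universalTwist C η) (coext (universalTwist C η) M) w
  have hφz : φ ((cobar C η).sgn.rTensor _ z) = 0 := by
    have := hd z
    rw [hpz, map_zero, zero_add, hdz, map_zero] at this
    exact this.symm
  have h4 := h2 ((cobar C η).sgn.rTensor _ z)
  rw [hφz, map_zero] at h4
  -- On the kernel of `p` the normalization `coaugProj` acts as the identity, so `s` after `φ` is
  -- minus the identity there.
  have hρ : ∀ z : (cobar C η).carrier ⊗[ℚ] (C.carrier ⊗[ℚ] M.carrier),
      ((coaugProj η).rTensor M.carrier).lTensor (cobar C η).carrier z =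
        z - (TensorProduct.mk ℚ C.carrier M.carrier η.e).lTensor (cobar C η).carrier (p z) := by
    intro z
    have : (coaugProj η).rTensor M.carrier = LinearMap.id -
        TensorProduct.mk ℚ C.carrier M.carrier η.e ∘ₗ counitMap C M.carrier := by
      refine TensorProduct.ext' fun c m => ?_
      simp [coaugProj_apply, TensorProduct.sub_tmul, TensorProduct.smul_tmul]
    rw [this, LinearMap.lTensor_sub, LinearMap.lTensor_id, LinearMap.lTensor_comp]
    rfl
  rw [hρ, hpσ, hpz, map_zero, map_zero, sub_zero, zero_eq_neg] at h4
  have hz0 : z = 0 := by rw [← hσ z, h4, map_zero]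
  rw [hz, sub_eq_zero] at hz0
  exact hz0.symm

end Counit

/-! ### Extending lifts along subcomodules -/

namespace DGComod

variable {C : DGCoalg.{u}}

/-- A partial linear map which is a partial solution of a lifting problem. -/
def IsPartialLift {Y E B : DGComod C} (p : E ⟶ B) (b : Y ⟶ B)
    (f : Y.carrier →ₗ.[ℚ] E.carrier) : Prop :=
  ∃ (h : Y.IsSub f.domain) (g : Y.sub f.domain h ⟶ E),
    (∀ x, Hom.lin g x = f x) ∧ g ≫ p = subι f.domain h ≫ b

/-- Every element of the union, together with its components, differential and coaction, lives in
one stage, where the required identities hold. -/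
theorem IsPartialLift.sSup {Y E B : DGComod C} {p : E ⟶ B} {b : Y ⟶ B}
    {c : Set (Y.carrier →ₗ.[ℚ] E.carrier)} (hc : DirectedOn (· ≤ ·) c) (hne : c.Nonempty)
    (h : ∀ f ∈ c, IsPartialLift p b f) : IsPartialLift p b (LinearPMap.sSup c hc) := by
  have hS : Y.IsSub (LinearPMap.sSup c hc).domain := by
    have : Nonempty c := hne.to_subtype
    have e : (LinearPMap.sSup c hc).domain = ⨆ f : c, f.1.domain := by
      rw [LinearPMap.domain_sSup, sSup_image']
    rw [e]
    refine IsSub.iSup_of_directed ?_ fun f => (h f.1 f.2).1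
    intro f g
    obtain ⟨k, hk, h1, h2⟩ := hc f.1 f.2 g.1 g.2
    exact ⟨⟨k, hk⟩, h1.1, h2.1⟩
  have key : ∀ x : (LinearPMap.sSup c hc).domain, ∃ f ∈ c, ∃ (hf : Y.IsSub f.domain)
      (g : Y.sub f.domain hf ⟶ E) (hle : f.domain ≤ (LinearPMap.sSup c hc).domain),
      (∀ y : f.domain, Hom.lin g y = (LinearPMap.sSup c hc) ⟨y, hle y.2⟩) ∧
      (g ≫ p = subι f.domain hf ≫ b) ∧ x.1 ∈ f.domain := by
    intro x
    obtain ⟨f, hf, hx⟩ := (LinearPMap.mem_domain_sSup_iff hne hc).1 x.2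
    obtain ⟨h1, g, hg, hgp⟩ := h f hf
    exact ⟨f, hf, h1, g, (LinearPMap.le_sSup hc hf).1,
      fun y => (hg y).trans (LinearPMap.sSup_apply hc hf y).symm, hgp, hx⟩
  let F : (Y.sub _ hS).carrier →ₗ[ℚ] E.carrier := (LinearPMap.sSup c hc).toFun
  refine ⟨hS, ⟨F, ?_, ?_, ?_⟩, fun x => rfl, ?_⟩
  · intro n x hx
    obtain ⟨f, hf, hfs, g, hle, hg, hgp, hxf⟩ := key x
    have e : Hom.lin g ⟨x.1, hxf⟩ = F x := hg ⟨x.1, hxf⟩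
    exact e ▸ Hom.map_mem g n ⟨x.1, hxf⟩ hx
  · intro x
    obtain ⟨f, hf, hfs, g, hle, hg, hgp, hxf⟩ := key x
    have := Hom.map_d g ⟨x.1, hxf⟩
    exact (hg ⟨Y.d x.1, hfs.d_mem _ hxf⟩).symm.trans (this.trans (congrArg E.d (hg ⟨x.1, hxf⟩)))
  · intro x
    obtain ⟨f, hf, hfs, g, hle, hg, hgp, hxf⟩ := key x
    have h1 := Hom.map_coact g ⟨x.1, hxf⟩
    have h2 := Hom.map_coact (subIncl hfs hS hle) ⟨x.1, hxf⟩
    have h3 : Hom.lin g = F ∘ₗ Hom.lin (subIncl hfs hS hle) :=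
      LinearMap.ext hg
    refine (congrArg E.coact (hg ⟨x.1, hxf⟩)).symm.trans (h1.trans ?_)
    rw [h3, LinearMap.lTensor_comp_apply]
    exact congrArg _ h2.symm
  · apply hom_ext
    intro x
    obtain ⟨f, hf, hfs, g, hle, hg, hgp, hxf⟩ := key x
    have := LinearMap.congr_fun (congrArg Hom.lin hgp) ⟨x.1, hxf⟩
    exact (congrArg (Hom.lin p) (hg ⟨x.1, hxf⟩)).symm.trans this

/-- A lifting problem along an injection can be solved if partial lifts can be extended. -/
theorem hasLiftingProperty_of_step {X Y E B : DGComod C} (i : X ⟶ Y)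
    (hi : Function.Injective (Hom.lin i)) (p : E ⟶ B) (P : Submodule ℚ Y.carrier → Prop)
    (hP : ∀ c : Set (Submodule ℚ Y.carrier), c.Nonempty → IsChain (· ≤ ·) c →
      (∀ S ∈ c, P S) → P (sSup c))
    (h0 : P (LinearMap.range (Hom.lin i)))
    (step : ∀ S (hS : Y.IsSub S), P S → S ≠ ⊤ → ∃ (S' : _) (hS' : Y.IsSub S') (h : S < S'),
      P S' ∧ HasLiftingProperty (subIncl hS hS' h.le) p) : HasLiftingProperty i p := by
  refine ⟨fun {a b} sq => ?_⟩
  -- Replacing `X` by its image turns the given map into a partial lift defined on a subcomodule of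
  -- `Y`.
  let r : X ⟶ Y.sub _ (isSub_range i) := subLift _ (isSub_range i) i fun x => ⟨x, rfl⟩
  have hr : Function.Bijective (Hom.lin r) :=
    ⟨fun x y h => hi (congrArg Subtype.val h), fun ⟨y, x, hx⟩ => ⟨x, Subtype.ext hx⟩⟩
  have := isIso_of_bijective r hr
  let g0 := inv r ≫ a
  let f0 : Y.carrier →ₗ.[ℚ] E.carrier := ⟨LinearMap.range (Hom.lin i), Hom.lin g0⟩
  have hr2 : r ≫ subι _ (isSub_range i) = i := rfl
  have hf0 : IsPartialLift p b f0 := by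
    refine ⟨isSub_range i, g0, fun x => rfl, ?_⟩
    rw [← cancel_epi r, ← Category.assoc, ← Category.assoc, ← Category.assoc,
      IsIso.hom_inv_id, Category.id_comp]
    exact sq.w
  -- The side condition `P` on domains is carried along: it is vacuous for monomorphisms and is
  -- relative acyclicity for trivial cofibrations.
  obtain ⟨f, hf0f, hmax⟩ := zorn_le_nonempty₀ {f | P f.domain ∧ IsPartialLift p b f}
    (fun c hc hchain y hy => ⟨LinearPMap.sSup c hchain.directedOn,
      ⟨by
        rw [LinearPMap.domain_sSup]
        refine hP _ (Set.Nonempty.image _ ⟨y, hy⟩) ?_ ?_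
        · rintro _ ⟨f, hf, rfl⟩ _ ⟨g, hg, rfl⟩ hne
          have hfg : f ≠ g := fun e => hne (by rw [e])
          exact (hchain hf hg hfg).imp (fun h => h.1) fun h => h.1
        · rintro _ ⟨f, hf, rfl⟩
          exact (hc hf).1,
        IsPartialLift.sSup _ ⟨y, hy⟩ fun f hf => (hc hf).2⟩,
      fun z hz => LinearPMap.le_sSup _ hz⟩) f0 ⟨h0, hf0⟩
  obtain ⟨hPf, hfs, g, hg, hgp⟩ := hmax.1
  have htop : f.domain = ⊤ := by
    by_contra hne
    obtain ⟨S', hS', hlt, hPS', hl⟩ := step _ hfs hPf hne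
    have sq' : CommSq g (subIncl hfs hS' hlt.le) p (subι S' hS' ≫ b) := ⟨hgp⟩
    let f' : Y.carrier →ₗ.[ℚ] E.carrier := ⟨S', Hom.lin sq'.lift⟩
    have hle : f ≤ f' := by
      refine ⟨hlt.le, fun x y hxy => ?_⟩
      have h1 := LinearMap.congr_fun (congrArg Hom.lin sq'.fac_left) x
      refine (hg x).symm.trans (h1.symm.trans ?_)
      exact congrArg (Hom.lin sq'.lift) (Subtype.ext hxy)
    have := hmax.2 (y := f') ⟨hPS', hS', sq'.lift, fun x => rfl, sq'.fac_right⟩ hle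
    exact hlt.not_ge this.1
  have hall : ∀ x, x ∈ f.domain := fun x => htop ▸ Submodule.mem_top
  refine ⟨⟨⟨subLift _ hfs (𝟙 Y) hall ≫ g, ?_, ?_⟩⟩⟩
  · apply hom_ext
    intro x
    have h1 : f0 ⟨Hom.lin i x, x, rfl⟩ = f ⟨Hom.lin i x, hall _⟩ := hf0f.2 rfl
    have h2 : Hom.lin (r ≫ g0) x = Hom.lin a x := by
      rw [show r ≫ g0 = a from IsIso.hom_inv_id_assoc r a]
    exact (hg ⟨Hom.lin i x, hall _⟩).trans (h1.symm.trans h2)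
  · rw [Category.assoc, hgp]
    rfl

/-! ### Primitive elements modulo a subcomodule -/

/-- The projection of `C ⊗ V` to the part of degree `k` in `C`. -/
def projTensor (C : DGCoalg.{u}) (V : Type u) [AddCommGroup V] [Module ℚ V] (k : ℤ) :
    C.carrier ⊗[ℚ] V →ₗ[ℚ] C.carrier ⊗[ℚ] V := (C.toDGVect.proj k).rTensor V

section

variable {V : Type u} [AddCommGroup V] [Module ℚ V]

/-- The first part provides a largest degree of `C` occurring in a coaction; the second tests
membership one `C`-degree at a time. -/
theorem exists_finset_projTensor (z : C.carrier ⊗[ℚ] V) : ∃ s : Finset ℤ,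
    (∀ k ∉ s, projTensor C V k z = 0) ∧
      ∀ T : Submodule ℚ (C.carrier ⊗[ℚ] V), (∀ k, projTensor C V k z ∈ T) → z ∈ T := by
  classical
  suffices h : ∃ s : Finset ℤ, (∀ k ∉ s, projTensor C V k z = 0) ∧
      z = ∑ k ∈ s, projTensor C V k z by
    obtain ⟨s, h1, h2⟩ := h
    exact ⟨s, h1, fun T hT => h2 ▸ sum_mem fun k _ => hT k⟩
  suffices h : ∃ s : Finset ℤ, ∀ t, s ⊆ t → z = ∑ k ∈ t, projTensor C V k z by
    obtain ⟨s, hs⟩ := h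
    refine ⟨s, fun k hk => ?_, hs s subset_rfl⟩
    have h1 := hs (insert k s) (Finset.subset_insert k s)
    rw [Finset.sum_insert hk, ← hs s subset_rfl] at h1
    exact right_eq_add.1 h1
  induction z with
  | zero => exact ⟨∅, fun t _ => by simp⟩
  | add x y hx hy =>
    obtain ⟨s, hs⟩ := hx
    obtain ⟨t, ht⟩ := hy
    refine ⟨s ∪ t, fun r hr => ?_⟩
    simp only [map_add, Finset.sum_add_distrib]
    rw [← hs r (Finset.union_subset_left hr), ← ht r (Finset.union_subset_right hr)]
  | tmul c v =>
    induction c using C.toDGVect.homogeneous_induction with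
    | zero => exact ⟨∅, fun t _ => by simp⟩
    | add x y hx hy =>
      obtain ⟨s, hs⟩ := hx
      obtain ⟨t, ht⟩ := hy
      refine ⟨s ∪ t, fun r hr => ?_⟩
      simp only [TensorProduct.add_tmul, map_add, Finset.sum_add_distrib]
      rw [← hs r (Finset.union_subset_left hr), ← ht r (Finset.union_subset_right hr)]
    | mem n c hc =>
      refine ⟨{n}, fun t ht => ?_⟩
      have hn : n ∈ t := ht (Finset.mem_singleton_self n)
      rw [Finset.sum_eq_single_of_mem n hn]
      · simp [projTensor, C.toDGVect.proj_same hc]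
      · intro k _ hk
        simp [projTensor, C.toDGVect.proj_ne (Ne.symm hk) hc]

theorem projTensor_projTensor (j k : ℤ) (z : C.carrier ⊗[ℚ] V) :
    projTensor C V j (projTensor C V k z) = if k = j then projTensor C V k z else 0 := by
  rw [projTensor, projTensor, ← LinearMap.rTensor_comp_apply]
  have : C.toDGVect.proj j ∘ₗ C.toDGVect.proj k = if k = j then C.toDGVect.proj k else 0 := by
    refine LinearMap.ext fun c => ?_
    rw [LinearMap.comp_apply, C.toDGVect.proj_of_mem j (C.toDGVect.proj_mem k c)]
    split_ifs <;> rfl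
  rw [this]
  split_ifs <;> simp

theorem projTensor_of_neg {k : ℤ} (hk : k < 0) (z : C.carrier ⊗[ℚ] V) :
    projTensor C V k z = 0 := by
  have : C.toDGVect.proj k = 0 := by
    refine LinearMap.ext fun c => ?_
    have := C.toDGVect.proj_mem k c
    rw [C.connective k hk] at this
    exact this
  rw [projTensor, this, LinearMap.rTensor_zero, LinearMap.zero_apply]

/-- The coalgebra is connected if its degree zero part is spanned by the coaugmentation. -/
def _root_.DGKoszul.Coaugmentation.IsConnected (η : Coaugmentation C) : Prop :=
  ∀ x ∈ C.gr 0, ∃ q : ℚ, x = q • η.e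

/-- In degree zero an element of `C` is `ε(c) e`, by connectedness. For a coaction this yields the
leading term `e ⊗ x`. -/
theorem projTensor_zero {η : Coaugmentation C} (hη : η.IsConnected) (z : C.carrier ⊗[ℚ] V) :
    projTensor C V 0 z = η.e ⊗ₜ counitMap C V z := by
  induction z with
  | zero => simp
  | add x y hx hy => rw [map_add, map_add, hx, hy, TensorProduct.tmul_add]
  | tmul c v =>
    rw [counitMap_tmul]
    induction c using C.toDGVect.homogeneous_induction with
    | zero => simp
    | add x y hx hy =>
      rw [TensorProduct.add_tmul, map_add, hx, hy, map_add, add_smul, TensorProduct.tmul_add]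
    | mem n c hc =>
      by_cases hn : n = 0
      · subst hn
        obtain ⟨q, rfl⟩ := hη c hc
        rw [projTensor, LinearMap.rTensor_tmul, C.toDGVect.proj_same hc, map_smul, η.counit_e,
          smul_eq_mul, mul_one, TensorProduct.smul_tmul]
      · rw [projTensor, LinearMap.rTensor_tmul, C.toDGVect.proj_ne hn hc, C.counit_of_ne n hn c hc]
        simp

theorem counitMap_coact (N : DGComod C) (x : N.carrier) :
    counitMap C N.carrier (N.coact x) = x := by
  rw [counitMap, LinearMap.comp_apply, N.counit]
  simp

theorem tensorD_mem_tensorSub (N : DGComod C) {S : Submodule ℚ N.carrier}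
    (hS : ∀ x ∈ S, N.d x ∈ S) {z : C.carrier ⊗[ℚ] N.carrier} (hz : z ∈ tensorSub C.carrier S) :
    tensorD C.toDGVect N.toDGVect z ∈ tensorSub C.carrier S :=
  map_mem_of_tensorSub _ (fun c x hx => by
    rw [tensorD_tmul]
    exact add_mem (tmul_mem_tensorSub _ hx) (tmul_mem_tensorSub _ (hS x hx))) hz

/-- Contraction of the coaction against a functional supported in one degree. -/
def contractDeg (N : DGComod C) (φ : C.carrier →ₗ[ℚ] ℚ) (m : ℤ) :
    C.carrier ⊗[ℚ] N.carrier →ₗ[ℚ] N.carrier :=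
  (TensorProduct.lid ℚ N.carrier).toLinearMap ∘ₗ φ.rTensor N.carrier ∘ₗ
    projTensor C N.carrier m

theorem contractDeg_tmul (N : DGComod C) (φ : C.carrier →ₗ[ℚ] ℚ) (m : ℤ) (c : C.carrier)
    (x : N.carrier) : contractDeg N φ m (c ⊗ₜ x) = φ (C.toDGVect.proj m c) • x := by
  simp [contractDeg, projTensor]

theorem contractDeg_mem (N : DGComod C) (φ : C.carrier →ₗ[ℚ] ℚ) (m n : ℤ)
    {z : C.carrier ⊗[ℚ] N.carrier} (hz : z ∈ tensorGr C.gr N.gr n) :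
    contractDeg N φ m z ∈ N.gr (n - m) := by
  refine map_mem_of_tensorGr _ _ ?_ hz
  intro i j hij c hc x hx
  rw [contractDeg_tmul]
  by_cases h : i = m
  · subst h
    rw [show n - i = j by omega]
    exact Submodule.smul_mem _ _ hx
  · rw [C.toDGVect.proj_ne h hc, map_zero, zero_smul]
    exact zero_mem _

/-- The map `c ⊗ c' ↦ φ(πₘ c) πₖ c'`. -/
def contractComul (φ : C.carrier →ₗ[ℚ] ℚ) (m k : ℤ) : C.carrier →ₗ[ℚ] C.carrier :=
  ((TensorProduct.lid ℚ C.carrier).toLinearMap ∘ₗ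
    TensorProduct.map (φ ∘ₗ C.toDGVect.proj m) (C.toDGVect.proj k)) ∘ₗ Coalgebra.comul

theorem contractComul_apply (φ : C.carrier →ₗ[ℚ] ℚ) (m k : ℤ) (c : C.carrier) :
    contractComul φ m k c = TensorProduct.lid ℚ C.carrier
      (TensorProduct.map (φ ∘ₗ C.toDGVect.proj m) (C.toDGVect.proj k) (Coalgebra.comul c)) := rfl

theorem contractComul_proj (φ : C.carrier →ₗ[ℚ] ℚ) (m k : ℤ) (c : C.carrier) :
    contractComul φ m k (C.toDGVect.proj (m + k) c) = contractComul φ m k c := by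
  induction c using C.toDGVect.homogeneous_induction with
  | zero => simp
  | add x y hx hy => simp only [map_add, hx, hy]
  | mem n c hc =>
    by_cases hn : n = m + k
    · subst hn
      rw [C.toDGVect.proj_same hc]
    · rw [C.toDGVect.proj_ne hn hc, map_zero]
      symm
      have : contractComul φ m k c ∈ (⊥ : Submodule ℚ C.carrier) := by
        refine map_mem_of_tensorGr ((TensorProduct.lid ℚ C.carrier).toLinearMap ∘ₗ
          TensorProduct.map (φ ∘ₗ C.toDGVect.proj m) (C.toDGVect.proj k)) _ ?_ (C.comul_mem n c hc)
        intro i j hij a ha b hb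
        rw [Submodule.mem_bot, LinearMap.comp_apply, TensorProduct.map_tmul, LinearMap.comp_apply]
        by_cases hi : i = m
        · rw [C.toDGVect.proj_ne (m := j) (n := k) (by omega) hb, TensorProduct.tmul_zero, map_zero]
        · rw [C.toDGVect.proj_ne hi ha, map_zero, TensorProduct.zero_tmul, map_zero]
      exact this

/-- By coassociativity, the coaction of a contraction is a contraction of the iterated coproduct.
Its part of `C`-degree `k` therefore depends only on the part of `C`-degree `m + k` of the original
coaction. -/
theorem projTensor_coact_contractDeg (N : DGComod C) (φ : C.carrier →ₗ[ℚ] ℚ) (m k : ℤ)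
    (x : N.carrier) :
    projTensor C N.carrier k (N.coact (contractDeg N φ m (N.coact x))) =
      (contractComul φ m k).rTensor N.carrier (projTensor C N.carrier (m + k) (N.coact x)) := by
  let Φ : C.carrier ⊗[ℚ] (C.carrier ⊗[ℚ] N.carrier) →ₗ[ℚ] C.carrier ⊗[ℚ] N.carrier :=
    projTensor C N.carrier k ∘ₗ (TensorProduct.lid ℚ (C.carrier ⊗[ℚ] N.carrier)).toLinearMap ∘ₗ
      (φ ∘ₗ C.toDGVect.proj m).rTensor (C.carrier ⊗[ℚ] N.carrier)
  have h1 : ∀ z : C.carrier ⊗[ℚ] N.carrier,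
      projTensor C N.carrier k (N.coact (contractDeg N φ m z)) = Φ (N.coact.lTensor _ z) := by
    intro z
    induction z with
    | zero => simp
    | add x y hx hy => simp only [map_add, hx, hy]
    | tmul c x => simp [Φ, contractDeg_tmul]
  have h2 : ∀ z : C.carrier ⊗[ℚ] N.carrier,
      Φ (TensorProduct.assoc ℚ C.carrier C.carrier N.carrier
        ((Coalgebra.comul (R := ℚ)).rTensor N.carrier z)) =
      (contractComul φ m k).rTensor N.carrier (projTensor C N.carrier (m + k) z) := by
    intro z
    induction z with
    | zero => simp
    | add x y hx hy => simp only [map_add, hx, hy]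
    | tmul c x =>
      rw [projTensor, LinearMap.rTensor_tmul, LinearMap.rTensor_tmul, LinearMap.rTensor_tmul,
        contractComul_proj, contractComul_apply]
      generalize (Coalgebra.comul c : C.carrier ⊗[ℚ] C.carrier) = y
      induction y with
      | zero => simp
      | add x y hx hy => simp only [map_add, TensorProduct.add_tmul, hx, hy]
      | tmul a b => simp [Φ, projTensor, TensorProduct.smul_tmul']
  rw [h1, ← N.coassoc, h2]

theorem rTensor_mem_tensorSub {S : Submodule ℚ V} (f : C.carrier →ₗ[ℚ] C.carrier)
    {z : C.carrier ⊗[ℚ] V} (hz : z ∈ tensorSub C.carrier S) :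
    f.rTensor V z ∈ tensorSub C.carrier S :=
  map_mem_of_tensorSub _ (fun c x hx => tmul_mem_tensorSub _ hx) hz

/-- Modulo a proper subcomodule there is a homogeneous primitive element. -/
theorem exists_primitive {η : Coaugmentation C} (hη : η.IsConnected) (N : DGComod C)
    {S : Submodule ℚ N.carrier} (hS : N.toDGVect.IsSub S) (hne : S ≠ ⊤) :
    ∃ n, ∃ y ∈ N.gr n, y ∉ S ∧ N.coact y - η.e ⊗ₜ y ∈ tensorSub C.carrier S ∧ N.d y ∈ S := by
  -- If the differential of a primitive `y` is not in `S`, replace `y` by it: it is again primitive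
  -- modulo `S`, because `e` is a cycle, and its own differential is zero.
  suffices h : ∃ n, ∃ y ∈ N.gr n, y ∉ S ∧ N.coact y - η.e ⊗ₜ y ∈ tensorSub C.carrier S by
    obtain ⟨n, y, hy, hyS, hc⟩ := h
    by_cases hd : N.d y ∈ S
    · exact ⟨n, y, hy, hyS, hc, hd⟩
    · refine ⟨n - 1, N.d y, N.d_mem n y hy, hd, ?_, by rw [N.d_d]; exact zero_mem _⟩
      have := tensorD_mem_tensorSub N hS.d_mem hc
      rwa [map_sub, tensorD_tmul, η.d_e, sgn_e, TensorProduct.zero_tmul, zero_add,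
        ← N.coact_d] at this
  obtain ⟨x, hx⟩ : ∃ x, x ∉ S := by
    by_contra! h
    exact hne (eq_top_iff.2 fun x _ => h x)
  obtain ⟨n, hn⟩ : ∃ n, N.toDGVect.proj n x ∉ S := by
    by_contra! h
    exact hx (N.toDGVect.mem_of_proj_mem h)
  set y0 := N.toDGVect.proj n x with hy0
  have hy0n : y0 ∈ N.gr n := N.toDGVect.proj_mem n x
  have h0 : projTensor C N.carrier 0 (N.coact y0) ∉ tensorSub C.carrier S := by
    intro h
    rw [projTensor_zero hη, counitMap_coact] at h
    have h1 := map_mem_of_tensorSub (counitMap C N.carrier) (T := S)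
      (fun a x hx => by rw [counitMap_tmul]; exact S.smul_mem _ hx) h
    rw [counitMap_tmul, η.counit_e, one_smul] at h1
    exact hn h1
  obtain ⟨s, hs, -⟩ := exists_finset_projTensor (N.coact y0)
  have hfin : {m | projTensor C N.carrier m (N.coact y0) ∉ tensorSub C.carrier S}.Finite :=
    s.finite_toSet.subset fun m hm => by
      by_contra h
      exact hm (by rw [hs m h]; exact zero_mem _)
  -- The largest `C`-degree in which the coaction of `y0` is nonzero modulo `S`. Degree `0` is a
  -- candidate, its component being `e ⊗ y0`.
  obtain ⟨m, hm, hmax⟩ := hfin.exists_maximal ⟨0, h0⟩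
  have hm0 : 0 ≤ m := by
    rcases le_total m 0 with h | h
    · exact hmax h0 h
    · exact h
  -- Contracting the top component with a functional that detects it yields the primitive element.
  obtain ⟨φ, hφ⟩ : ∃ φ : C.carrier →ₗ[ℚ] ℚ, contractDeg N φ m (N.coact y0) ∉ S := by
    by_contra! h
    exact hm (mem_tensorSub_of_forall h)
  refine ⟨n - m, _, contractDeg_mem N φ m n (N.coact_mem n y0 hy0n), hφ, ?_⟩
  set y := contractDeg N φ m (N.coact y0)
  obtain ⟨t, -, ht⟩ := exists_finset_projTensor (N.coact y - η.e ⊗ₜ y)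
  refine ht _ fun k => ?_
  have he : η.e ⊗ₜ y = projTensor C N.carrier 0 (N.coact y) := by
    rw [projTensor_zero hη, counitMap_coact]
  rw [he, map_sub, projTensor_projTensor]
  rcases lt_trichotomy k 0 with hk | hk | hk
  · rw [projTensor_of_neg hk, if_neg (by omega), sub_zero]
    exact zero_mem _
  · rw [if_pos hk.symm, hk, sub_self]
    exact zero_mem _
  -- The component in degree `k > 0` comes from `C`-degree `m + k > m` of the coaction of `y0`,
  -- which lies in `C ⊗ S` by maximality of `m`.
  · rw [if_neg (by omega), sub_zero, projTensor_coact_contractDeg]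
    refine rTensor_mem_tensorSub _ ?_
    by_contra h
    have := hmax h (by omega)
    omega

end

/-- Adding a homogeneous primitive element to a subcomodule. -/
theorem IsSub.sup_span {η : Coaugmentation C} {N : DGComod C} {S : Submodule ℚ N.carrier}
    (hS : N.IsSub S) {n : ℤ} {y : N.carrier} (hy : y ∈ N.gr n)
    (hc : N.coact y - η.e ⊗ₜ y ∈ tensorSub C.carrier S) (hd : N.d y ∈ S) :
    N.IsSub (S ⊔ Submodule.span ℚ {y}) := by
  have hyT : y ∈ S ⊔ Submodule.span ℚ {y} :=
    Submodule.mem_sup_right (Submodule.mem_span_singleton_self y)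
  have aux : ∀ (f : N.carrier →ₗ[ℚ] N.carrier), (∀ x ∈ S, f x ∈ S) →
      f y ∈ S ⊔ Submodule.span ℚ {y} → ∀ x ∈ S ⊔ Submodule.span ℚ {y},
        f x ∈ S ⊔ Submodule.span ℚ {y} := by
    intro f h1 h2 x hx
    have : S ⊔ Submodule.span ℚ {y} ≤ (S ⊔ Submodule.span ℚ {y}).comap f :=
      sup_le (fun x hx => Submodule.mem_sup_left (h1 x hx))
        ((Submodule.span_singleton_le_iff_mem _ _).2 h2)
    exact this hx
  refine ⟨⟨fun n' x hx => ?_, ?_⟩, ?_⟩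
  · refine aux _ (fun x hx => hS.proj_mem _ _ hx) ?_ x hx
    rw [N.toDGVect.proj_of_mem _ hy]
    split_ifs
    · exact hyT
    · exact zero_mem _
  · exact aux _ hS.d_mem (Submodule.mem_sup_left hd)
  · have : S ⊔ Submodule.span ℚ {y} ≤
        (tensorSub C.carrier (S ⊔ Submodule.span ℚ {y})).comap N.coact := by
      refine sup_le (fun x hx => tensorSub_mono le_sup_left (hS.coact_mem x hx))
        ((Submodule.span_singleton_le_iff_mem _ _).2 ?_)
      have := add_mem (tensorSub_mono le_sup_left hc) (tmul_mem_tensorSub η.e hyT)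
      rwa [sub_add_cancel] at this
    exact this

end DGComod

/-! ### Twisted extensions of monomorphisms are cofibrations -/

section Cell

variable {C : DGCoalg.{u}} {A : DGAlg.{u}} {τ : TwistingChain C A}

theorem extFunctor_map_injective {M N : DGComod C} {f : M ⟶ N}
    (hf : Function.Injective (DGComod.Hom.lin f)) :
    Function.Injective (DGMod.Hom.lin ((extFunctor τ).map f)) :=
  lTensor_injective (A := A.carrier) hf

theorem coextFunctor_map_surjective {M N : DGMod A} {f : M ⟶ N}
    (hf : Function.Surjective (DGMod.Hom.lin f)) :
    Function.Surjective (DGComod.Hom.lin ((coextFunctor τ).map f)) :=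
  LinearMap.lTensor_surjective C.carrier (g := DGMod.Hom.linQ f) hf

/-- A retraction of an injection whose image has a one-dimensional complement. -/
theorem exists_retraction {V W : Type*} [AddCommGroup V] [Module ℚ V] [AddCommGroup W] [Module ℚ W]
    (j : V →ₗ[ℚ] W) (hj : Function.Injective j) (y : W) (hy : y ∉ LinearMap.range j)
    (hW : ∀ x, ∃ v, ∃ c : ℚ, x = j v + c • y) :
    ∃ (r : W →ₗ[ℚ] V) (l : W →ₗ[ℚ] ℚ), ∀ v (c : ℚ), r (j v + c • y) = v ∧ l (j v + c • y) = c := by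
  obtain ⟨f, hf, hjf⟩ := Submodule.exists_le_ker_of_notMem hy
  have hfj : ∀ v, f (j v) = 0 := fun v => hjf ⟨v, rfl⟩
  let l : W →ₗ[ℚ] ℚ := (f y)⁻¹ • f
  have hl : ∀ v (c : ℚ), l (j v + c • y) = c := by
    intro v c
    change (f y)⁻¹ * f (j v + c • y) = c
    rw [map_add, hfj, map_smul, zero_add, smul_eq_mul, mul_left_comm, inv_mul_cancel₀ hf, mul_one]
  have hr : ∀ x, (LinearMap.id - l.smulRight y : W →ₗ[ℚ] W) x ∈ LinearMap.range j := by
    intro x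
    obtain ⟨v, c, rfl⟩ := hW x
    refine ⟨v, ?_⟩
    rw [LinearMap.sub_apply, LinearMap.smulRight_apply, hl]
    simp
  refine ⟨(LinearEquiv.ofInjective j hj).symm.toLinearMap ∘ₗ LinearMap.codRestrict _ _ hr, l,
    fun v c => ⟨?_, hl v c⟩⟩
  rw [LinearMap.comp_apply, LinearEquiv.coe_coe, LinearEquiv.symm_apply_eq]
  apply Subtype.ext
  change (j v + c • y) - l (j v + c • y) • y = j v
  rw [hl, add_sub_cancel_right]

/-- Attaching one cell is a cofibration. -/
theorem hasLiftingProperty_cell {K N : DGComod C} (j : K ⟶ N)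
    (hj : Function.Injective (DGComod.Hom.lin j)) {n : ℤ} {y : N.carrier} (hyn : y ∈ N.gr n)
    (hy : y ∉ LinearMap.range (DGComod.Hom.lin j))
    (hN : ∀ x, ∃ v, ∃ c : ℚ, x = DGComod.Hom.lin j v + c • y)
    (hu : ∃ u, (DGComod.Hom.lin j).lTensor A.carrier u = extD τ N (1 ⊗ₜ y))
    {M B : DGMod A} (p : M ⟶ B) (hp : Function.Surjective (DGMod.Hom.lin p))
    (hp' : DGMod.quasiIso A p) : HasLiftingProperty ((extFunctor τ).map j) p := by
  refine ⟨fun {F G} sq => ?_⟩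
  obtain ⟨u, hu⟩ := hu
  obtain ⟨r, l, hrl⟩ := exists_retraction (DGComod.Hom.lin j) hj y hy hN
  rw [DGMod.quasiIso_iff] at hp'
  have hj' := lTensor_injective (A := A.carrier) hj
  have hsq : ∀ z : A.carrier ⊗[ℚ] K.carrier,
      DGMod.Hom.lin p (DGMod.Hom.lin F z) = DGMod.Hom.lin G
        ((DGComod.Hom.lin j).lTensor A.carrier z) := fun z =>
    LinearMap.congr_fun (congrArg DGMod.Hom.lin sq.w) z
  have hju : ∀ z : A.carrier ⊗[ℚ] K.carrier,
      (DGComod.Hom.lin j).lTensor A.carrier (extD τ K z) =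
        extD τ N ((DGComod.Hom.lin j).lTensor A.carrier z) := fun z =>
    DGMod.Hom.map_d ((extFunctor τ).map j) z
  have hdu : extD τ K u = 0 := by
    apply hj'
    rw [hju, hu, extD_extD, map_zero]
  let g : B.carrier := DGMod.Hom.lin G (show A.carrier ⊗[ℚ] N.carrier from 1 ⊗ₜ y)
  have hgn : g ∈ B.gr n :=
    DGMod.Hom.map_mem G n _ (tmul_mem_tensorGr A.one_mem hyn (zero_add n))
  have hun : u ∈ tensorGr A.gr K.gr (n - 1) := by
    refine mem_tensorGr_of_injective (U := A.toDGVect) (V := K.toDGVect) (W := N.toDGVect)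
      (DGComod.Hom.map_mem j) hj ?_
    refine hu.symm ▸ (ext τ N).d_mem n _ (tmul_mem_tensorGr A.one_mem hyn (zero_add n))
  have hFu : M.d (DGMod.Hom.lin F u) = 0 :=
    (DGMod.Hom.map_d F u).symm.trans ((congrArg (DGMod.Hom.lin F) hdu).trans (map_zero _))
  have hpFu : DGMod.Hom.lin p (DGMod.Hom.lin F u) = B.d g :=
    (hsq u).trans ((congrArg (DGMod.Hom.lin G) hu).trans (DGMod.Hom.map_d G _))
  -- The only choice in the lift is the image `m` of the new cell: it must bound `F u` and lie over
  -- `g`. A preimage of `g` is corrected by an element of the acyclic kernel of `p`.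
  obtain ⟨m, hmn, hdm, hpm⟩ : ∃ m ∈ M.gr n, M.d m = DGMod.Hom.lin F u ∧ DGMod.Hom.lin p m = g := by
    obtain ⟨w0, hw0⟩ := hp g
    obtain ⟨w', hw', hdw'⟩ := QIso.ker_acyclic (f := DGMod.Hom.linQ p) (DGMod.Hom.map_d p) hp hp'
      M.d_d (DGMod.Hom.lin F u - M.d w0)
      (by
        change DGMod.Hom.lin p _ = 0
        rw [map_sub, DGMod.Hom.map_d, hw0, hpFu, sub_self])
      (by rw [map_sub, hFu, M.d_d, sub_self])
    have h1 : M.d (w0 + w') = DGMod.Hom.lin F u := by rw [map_add, hdw']; abel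
    have h2 : DGMod.Hom.lin p (w0 + w') = g := by
      rw [map_add, hw0]
      exact (congrArg (g + ·) hw').trans (add_zero g)
    -- Both equations are homogeneous, so they survive projection to degree `n`.
    refine ⟨M.toDGVect.proj n (w0 + w'), M.toDGVect.proj_mem n _, ?_, ?_⟩
    · rw [DGVect.d_proj, h1]
      exact M.toDGVect.proj_same (DGMod.Hom.map_mem F _ _ hun)
    · refine (DGVect.map_proj₀ (f := DGMod.Hom.linQ p) (DGMod.Hom.map_mem p) n _).trans ?_
      exact (congrArg (B.toDGVect.proj n) h2).trans (B.toDGVect.proj_same hgn)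
  -- The lift on generators: `F` on `K` and `m` on the cell `y`.
  let θ : N.carrier →ₗ[ℚ] M.carrier := (twistOfExtHom F).lin ∘ₗ r + l.smulRight m
  have hθ : ∀ v (c : ℚ), θ (DGComod.Hom.lin j v + c • y) =
      DGMod.Hom.lin F (show A.carrier ⊗[ℚ] K.carrier from 1 ⊗ₜ v) + c • m := by
    intro v c
    change DGMod.Hom.lin F (show A.carrier ⊗[ℚ] K.carrier from 1 ⊗ₜ r _) + l _ • m = _
    rw [(hrl v c).1, (hrl v c).2]
  have hθj : ∀ v, θ (DGComod.Hom.lin j v) =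
      DGMod.Hom.lin F (show A.carrier ⊗[ℚ] K.carrier from 1 ⊗ₜ v) := by
    intro v
    have := hθ v 0
    rwa [zero_smul, zero_smul, add_zero, add_zero] at this
  have hθy : θ y = m := by
    have := hθ 0 1
    rw [map_zero, one_smul, one_smul, zero_add, TensorProduct.tmul_zero] at this
    rw [this]
    exact (congrArg (· + m) (map_zero (DGMod.Hom.lin F))).trans (zero_add m)
  let L : A.carrier ⊗[ℚ] N.carrier →ₗ[A.carrier] M.carrier := extLinOfTwist θ
  have hLj : ∀ z : A.carrier ⊗[ℚ] K.carrier,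
      L ((DGComod.Hom.lin j).lTensor A.carrier z) = DGMod.Hom.lin F z := by
    intro z
    have : L.restrictScalars ℚ ∘ₗ (DGComod.Hom.lin j).lTensor A.carrier = DGMod.Hom.linQ F := by
      refine TensorProduct.ext' fun a v => ?_
      exact (extLinOfTwist_tmul θ a _).trans
        ((congrArg (a • ·) (hθj v)).trans (extHomLin_tmul (τ := τ) F a v).symm)
    exact LinearMap.congr_fun this z
  -- The decomposition `x = j v + c y` is not given as homogeneous. Comparison with the degree `k`
  -- component shows that `v` has degree `k`, and that `c = 0` unless `k = n`, since `y` is not in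
  -- the image of `j`.
  have hθn : ∀ k, ∀ x ∈ N.gr k, θ x ∈ M.gr k := by
    intro k x hx
    obtain ⟨v, c, rfl⟩ := hN x
    have hxk := N.toDGVect.proj_same hx
    rw [map_add, map_smul, ← DGVect.map_proj₀ (f := DGComod.Hom.lin j) (DGComod.Hom.map_mem j),
      N.toDGVect.proj_of_mem k hyn] at hxk
    rw [hθ]
    have hv : c • y = c • (if n = k then y else 0) → v ∈ K.gr k := by
      intro h
      rw [← h] at hxk
      exact K.toDGVect.mem_gr_iff.2 (hj (add_right_cancel hxk))
    by_cases hnk : n = k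
    · subst hnk
      rw [if_pos rfl] at hv
      exact add_mem (DGMod.Hom.map_mem F n _ (tmul_mem_tensorGr A.one_mem (hv rfl) (zero_add n)))
        (Submodule.smul_mem _ _ hmn)
    · rw [if_neg hnk, smul_zero] at hv hxk
      have hc : c = 0 := by
        by_contra hc
        have h1 : c • y ∈ LinearMap.range (DGComod.Hom.lin j) := by
          rw [add_zero] at hxk
          exact ⟨K.toDGVect.proj k v - v, by rw [map_sub, hxk]; abel⟩
        exact hy (by simpa [hc] using (LinearMap.range (DGComod.Hom.lin j)).smul_mem c⁻¹ h1)
      rw [hc, zero_smul, add_zero]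
      exact DGMod.Hom.map_mem F k _
        (tmul_mem_tensorGr A.one_mem (hv (by rw [hc, zero_smul])) (zero_add k))
  -- By the Leibniz rule, compatibility with the differentials needs checking only on `1 ⊗ x`. On
  -- the cell it is the equation `dm = F u`.
  have hLd1 : ∀ x : N.carrier, L (extD τ N (1 ⊗ₜ x)) = M.d (L (1 ⊗ₜ x)) := by
    intro x
    obtain ⟨v, c, rfl⟩ := hN x
    rw [TensorProduct.tmul_add, TensorProduct.tmul_smul, map_add, map_add, map_add, map_add]
    congr 1
    · have e : (1 : A.carrier) ⊗ₜ[ℚ] DGComod.Hom.lin j v =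
        (DGComod.Hom.lin j).lTensor A.carrier (1 ⊗ₜ v) := rfl
      rw [e, ← hju, hLj, hLj]
      exact DGMod.Hom.map_d F _
    · rw [map_smul]
      have e1 : ∀ z, L (c • z) = c • L z := fun z => (L.restrictScalars ℚ).map_smul c z
      rw [e1, e1, map_smul, ← hu, hLj, extLinOfTwist_tmul, one_smul, hθy, hdm]
  have hLd : ∀ z : A.carrier ⊗[ℚ] N.carrier, L (extD τ N z) = M.d (L z) := by
    intro z
    induction z with
    | zero => simp
    | add x y hx hy => simp only [map_add, hx, hy]
    | tmul a x =>
      have e1 : a ⊗ₜ[ℚ] x = a • ((1 : A.carrier) ⊗ₜ[ℚ] x) := by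
        rw [TensorProduct.smul_tmul', smul_eq_mul, mul_one]
      have e2 : extD τ N (a • ((1 : A.carrier) ⊗ₜ[ℚ] x)) =
          A.d a • ((1 : A.carrier) ⊗ₜ[ℚ] x) + A.sgn a • extD τ N (1 ⊗ₜ[ℚ] x) :=
        (ext τ N).d_smul' a _
      rw [e1, e2, map_add, map_smul, map_smul, map_smul, M.d_smul', hLd1]
  let H : ext τ N ⟶ M :=
    { lin := L
      map_mem := fun k z hz => by
        refine map_mem_of_tensorGr (L.restrictScalars ℚ) _ ?_ hz
        intro i i' hij a ha x hx
        rw [← hij]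
        exact M.smul_mem i i' a ha _ (hθn i' x hx)
      map_d := hLd }
  refine ⟨⟨⟨H, DGMod.hom_ext hLj, ?_⟩⟩⟩
  apply (extHomEquiv (τ := τ) N B).injective
  refine ModularTwist.ext (LinearMap.ext fun x => ?_)
  obtain ⟨v, c, rfl⟩ := hN x
  change DGMod.Hom.lin p ((1 : A.carrier) • θ _) = extHomLin G ((1 : A.carrier) ⊗ₜ[ℚ] _)
  rw [one_smul, hθ, map_add, hsq, TensorProduct.tmul_add, TensorProduct.tmul_smul, map_add]
  have e1 : DGMod.Hom.lin p (c • m) = c • g := by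
    rw [← hpm]
    exact (DGMod.Hom.linQ p).map_smul c m
  rw [e1]
  exact congrArg _ (((extHomLin G).restrictScalars ℚ).map_smul c (1 ⊗ₜ y)).symm

end Cell

/-- The degreewise surjective quasi-isomorphisms. -/
def DGMod.trivFib (A : DGAlg.{u}) : MorphismProperty (DGMod A) :=
  DGMod.degreewiseEpi A ⊓ DGMod.quasiIso A

section

variable {C : DGCoalg.{u}} {η : Coaugmentation C}

/-- Adding a primitive element to a subcomodule induces a cofibration. -/
theorem hasLiftingProperty_primitive (N : DGComod C) {S : Submodule ℚ N.carrier} (hS : N.IsSub S)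
    {n : ℤ} {y : N.carrier} (hy : y ∈ N.gr n) (hyS : y ∉ S)
    (hc : N.coact y - η.e ⊗ₜ y ∈ tensorSub C.carrier S) (hd : N.d y ∈ S)
    (hS' : N.IsSub (S ⊔ Submodule.span ℚ {y}))
    {M B : DGMod (cobar C η)} (p : M ⟶ B) (hp : DGMod.trivFib _ p) :
    HasLiftingProperty ((tShriek C η).map (DGComod.subIncl hS hS' le_sup_left)) p := by
  have hyT : y ∈ S ⊔ Submodule.span ℚ {y} :=
    Submodule.mem_sup_right (Submodule.mem_span_singleton_self y)
  have hrange : LinearMap.range (DGComod.Hom.lin (DGComod.subIncl hS hS' le_sup_left)) =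
      S.comap (S ⊔ Submodule.span ℚ {y}).subtype := by
    ext x
    constructor
    · rintro ⟨v, rfl⟩
      exact v.2
    · intro hx
      exact ⟨⟨x.1, hx⟩, rfl⟩
  refine hasLiftingProperty_cell (τ := universalTwist C η) _ ?_ (n := n) 
    (y := (⟨y, hyT⟩ : ↥(S ⊔ Submodule.span ℚ {y}))) hy ?_ ?_ ?_ p
    ((DGMod.degreewiseEpi_iff p).1 hp.1) hp.2
  · intro a b hab
    exact Subtype.ext (congrArg (DGComod.Hom.lin (DGComod.subι _ hS')) hab)
  · rw [hrange]
    exact hyS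
  · rintro ⟨x, hx⟩
    obtain ⟨s, hs, t, ht, rfl⟩ := Submodule.mem_sup.1 hx
    obtain ⟨c, rfl⟩ := Submodule.mem_span_singleton.1 ht
    exact ⟨(⟨s, hs⟩ : S), c, Subtype.ext rfl⟩
  · let N' := N.sub _ hS'
    let y' : N'.carrier := ⟨y, hyT⟩
    let ι : N' ⟶ N := DGComod.subι _ hS'
    let S₀ : Submodule ℚ N'.carrier := S.comap (DGComod.Hom.lin ι)
    change extD (universalTwist C η) N' (1 ⊗ₜ y') ∈ LinearMap.range _
    rw [range_lTensor, hrange]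
    change _ ∈ tensorSub _ S₀
    have h1 : N'.coact y' - η.e ⊗ₜ y' ∈ tensorSub C.carrier S₀ := by
      rw [tensorSub_comap, Submodule.mem_comap, map_sub, ← DGComod.Hom.map_coact]
      exact hc
    -- The twisted differential of `1 ⊗ x` is `1 ⊗ dx` minus `t ⊗ id` of the coaction. The leading
    -- term `e ⊗ x` disappears because `te = 0`, so the boundary of the cell is attached to `T`.
    have h3 : ∀ (K : DGComod C) (T : Submodule ℚ K.carrier) (x : K.carrier), K.d x ∈ T →
        K.coact x - η.e ⊗ₜ x ∈ tensorSub C.carrier T →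
        extD (universalTwist C η) K (1 ⊗ₜ x) ∈ tensorSub (cobar C η).carrier T := by
      intro K T x h1 h2
      have h4 : extAux (universalTwist C η) K.carrier 1 (K.coact x - η.e ⊗ₜ x) ∈
          tensorSub (cobar C η).carrier T := by
        refine map_mem_of_tensorSub _ (fun c x hx => ?_) h2
        rw [extAux_tmul]
        exact tmul_mem_tensorSub _ hx
      have h5 : (universalTwist C η).lin η.e = 0 := cobarT_e
      rw [map_sub, extAux_tmul, h5, mul_zero, TensorProduct.zero_tmul, sub_zero] at h4
      rw [extD_tmul, DGAlg.d_one, DGAlg.sgn_one, TensorProduct.zero_tmul, zero_add]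
      exact sub_mem (tmul_mem_tensorSub _ h1) h4
    exact h3 N' S₀ y' hd h1

/-- Twisted extensions of injections lift against surjective quasi-isomorphisms. -/
theorem hasLiftingProperty_tShriek (hη : η.IsConnected) {X Y : DGComod C} (i : X ⟶ Y)
    (hi : Function.Injective (DGComod.Hom.lin i)) {M B : DGMod (cobar C η)} (p : M ⟶ B)
    (hp : DGMod.trivFib _ p) : HasLiftingProperty ((tShriek C η).map i) p := by
  -- Across the adjunction the problem becomes one for comodules, where Zorn's lemma runs over
  -- subcomodules; each single step is transported back to modules.
  rw [(tAdj C η).hasLiftingProperty_iff]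
  refine DGComod.hasLiftingProperty_of_step i hi _ (fun _ => True) (fun _ _ _ _ => trivial)
    trivial fun S hS _ hne => ?_
  obtain ⟨n, y, hy, hyS, hc, hd⟩ := DGComod.exists_primitive hη Y hS.toIsSub hne
  have hS' := hS.sup_span hy hc hd
  refine ⟨_, hS', left_lt_sup.2 fun h => hyS (h (Submodule.mem_span_singleton_self y)), trivial, ?_⟩
  rw [← (tAdj C η).hasLiftingProperty_iff]
  exact hasLiftingProperty_primitive Y hS hy hyS hc hd hS' p hp

end

/-! ### The projective model structure on dg modules -/

theorem QIso.of_retract {V W V' W' : Type*} [AddCommGroup V] [AddCommGroup W] [AddCommGroup V']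
    [AddCommGroup W'] [Module ℚ V] [Module ℚ W] [Module ℚ V'] [Module ℚ W']
    {dV : V →ₗ[ℚ] V} {dW : W →ₗ[ℚ] W} {dV' : V' →ₗ[ℚ] V'} {dW' : W' →ₗ[ℚ] W'}
    {f : V →ₗ[ℚ] W} {g : V' →ₗ[ℚ] W'} {a : V →ₗ[ℚ] V'} {b : W →ₗ[ℚ] W'} {r : V' →ₗ[ℚ] V}
    {s : W' →ₗ[ℚ] W} (ha : ∀ x, a (dV x) = dV' (a x)) (hb : ∀ x, b (dW x) = dW' (b x))
    (hr : ∀ x, r (dV' x) = dV (r x)) (hs : ∀ x, s (dW' x) = dW (s x))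
    (h1 : ∀ x, g (a x) = b (f x)) (h2 : ∀ x, f (r x) = s (g x)) (h3 : ∀ x, r (a x) = x)
    (h4 : ∀ x, s (b x) = x) (hg : QIso dV' dW' g) : QIso dV dW f where
  inj x hx y hy := by
    obtain ⟨w, hw⟩ := hg.inj (a x) (by rw [← ha, hx, map_zero]) (b y) (by rw [← hb, hy, h1])
    exact ⟨r w, by rw [← hr, hw, h3]⟩
  surj y hy := by
    obtain ⟨x, hx, w, hw⟩ := hg.surj (b y) (by rw [← hb, hy, map_zero])
    exact ⟨r x, by rw [← hr, hx, map_zero], s w, by rw [h2, hw, map_add, h4, hs]⟩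

/-- The retract argument. -/
theorem retractArrow_of_comp {𝒞 : Type*} [Category 𝒞] {X Y Z : 𝒞} {f : X ⟶ Y} {i : X ⟶ Z}
    {p : Z ⟶ Y} (fac : i ≫ p = f) (h : HasLiftingProperty f p) : Nonempty (RetractArrow f i) :=
  ⟨RetractArrow.ofLeftLiftingProperty fac⟩

namespace DGMod

variable {A : DGAlg.{u}} {M N P : DGMod A}

instance : (quasiIso A).IsStableUnderRetracts where
  of_retract {X Y Z W f g} h hg := by
    rw [quasiIso_iff] at *
    have e1 : ∀ x, Hom.lin g (Hom.lin h.i.left x) = Hom.lin h.i.right (Hom.lin f x) := fun x =>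
      LinearMap.congr_fun (congrArg Hom.lin h.i_w) x
    have e2 : ∀ x, Hom.lin f (Hom.lin h.r.left x) = Hom.lin h.r.right (Hom.lin g x) := fun x =>
      LinearMap.congr_fun (congrArg Hom.lin h.r_w) x
    have e3 : ∀ x, Hom.lin h.r.left (Hom.lin h.i.left x) = x := fun x =>
      LinearMap.congr_fun (congrArg Hom.lin h.retract_left) x
    have e4 : ∀ x, Hom.lin h.r.right (Hom.lin h.i.right x) = x := fun x =>
      LinearMap.congr_fun (congrArg Hom.lin h.retract_right) x
    exact QIso.of_retract (f := Hom.linQ f) (g := Hom.linQ g) (a := Hom.linQ h.i.left) (b := Hom.linQ h.i.right)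
      (r := Hom.linQ h.r.left) (s := Hom.linQ h.r.right) (Hom.map_d _) (Hom.map_d _) (Hom.map_d _)
      (Hom.map_d _) e1 e2 e3 e4 hg

instance : (degreewiseEpi A).IsStableUnderRetracts where
  of_retract {X Y Z W f g} h hg := by
    rw [degreewiseEpi_iff] at *
    intro y
    obtain ⟨x, hx⟩ := hg (Hom.lin h.i.right y)
    refine ⟨Hom.lin h.r.left x, ?_⟩
    have e2 : Hom.lin f (Hom.lin h.r.left x) = Hom.lin h.r.right (Hom.lin g x) :=
      LinearMap.congr_fun (congrArg Hom.lin h.r_w) x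
    rw [e2, hx]
    exact LinearMap.congr_fun (congrArg Hom.lin h.retract_right) y

instance : (trivFib A).IsStableUnderRetracts :=
  inferInstanceAs (degreewiseEpi A ⊓ quasiIso A).IsStableUnderRetracts

/-- Morphisms out of a quotient. -/
theorem exists_desc (p : M ⟶ N) (hp : Function.Surjective (Hom.lin p)) (g : M ⟶ P)
    (hg : ∀ x, Hom.lin p x = 0 → Hom.lin g x = 0) : ∃ h : N ⟶ P, p ≫ h = g := by
  let l : N.carrier →ₗ[A.carrier] P.carrier :=
    (LinearMap.ker (Hom.lin p)).liftQ (Hom.lin g) hg ∘ₗ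
      ((Hom.lin p).quotKerEquivOfSurjective hp).symm.toLinearMap
  have hl : ∀ x, l (Hom.lin p x) = Hom.lin g x := by
    intro x
    have : ((Hom.lin p).quotKerEquivOfSurjective hp).symm (Hom.lin p x) =
        Submodule.Quotient.mk x := by
      rw [LinearEquiv.symm_apply_eq]
      rfl
    change (LinearMap.ker (Hom.lin p)).liftQ (Hom.lin g) hg _ = _
    rw [LinearEquiv.coe_coe, this]
    rfl
  refine ⟨⟨l, fun n x hx => ?_, fun x => ?_⟩, hom_ext hl⟩
  · obtain ⟨z, rfl⟩ := hp x
    have h1 : Hom.lin p (M.toDGVect.proj n z) = Hom.lin p z :=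
      (DGVect.map_proj₀ (f := Hom.linQ p) (Hom.map_mem p) n z).trans (N.toDGVect.proj_same hx)
    rw [← h1, hl]
    exact Hom.map_mem g n _ (M.toDGVect.proj_mem n z)
  · obtain ⟨z, rfl⟩ := hp x
    rw [← Hom.map_d, hl, hl, Hom.map_d]

theorem epi_of_surjective (p : M ⟶ N) (hp : Function.Surjective (Hom.lin p)) : Epi p where
  left_cancellation f g hfg := by
    apply hom_ext
    intro x
    obtain ⟨z, rfl⟩ := hp x
    exact LinearMap.congr_fun (congrArg Hom.lin hfg) z

/-- The inclusion of a summand with acyclic complement is a quasi-isomorphism. -/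
theorem quasiIso_inl (hN : Acyclic N.d) : quasiIso A (inl : M ⟶ M.prod N) := by
  rw [quasiIso_iff]
  refine ⟨?_, ?_⟩
  · rintro x hx ⟨y1, y2⟩ hy
    exact ⟨y1, congrArg Prod.fst hy⟩
  · rintro ⟨y1, y2⟩ hy
    have h1 : M.d y1 = 0 := congrArg Prod.fst hy
    obtain ⟨w, hw⟩ := hN y2 (congrArg Prod.snd hy)
    refine ⟨y1, h1, (0, -w), ?_⟩
    refine Prod.ext ?_ ?_
    · change y1 = y1 + M.d 0
      rw [map_zero, add_zero]
    · change 0 = y2 + N.d (-w)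
      rw [map_neg, hw, add_neg_cancel]

end DGMod

/-- The projection away from a comodule with acyclic twisted extension. -/
theorem trivFib_fst {C : DGCoalg.{u}} {A : DGAlg.{u}} {τ : TwistingChain C A} {M N : DGComod C}
    (hN : Acyclic (extD τ N)) :
    DGMod.trivFib A ((extFunctor τ).map (DGComod.fst : M.prod N ⟶ M)) := by
  have hs : Function.Surjective
      (DGMod.Hom.lin ((extFunctor τ).map (DGComod.fst : M.prod N ⟶ M))) :=
    LinearMap.lTensor_surjective A.carrier (g := LinearMap.fst ℚ M.carrier N.carrier)
      Prod.fst_surjective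
  refine ⟨(DGMod.degreewiseEpi_iff _).2 hs, ?_⟩
  rw [DGMod.quasiIso_iff]
  refine QIso.of_surjective (DGMod.Hom.map_d _) (DGVect.d_d _) hs ?_
  intro (x : A.carrier ⊗[ℚ] (M.carrier × N.carrier)) hx hdx
  have hx : (LinearMap.fst ℚ M.carrier N.carrier).lTensor A.carrier x = 0 := hx
  obtain ⟨w, hw⟩ := hN ((LinearMap.snd ℚ M.carrier N.carrier).lTensor A.carrier x) (by
    have h1 := DGMod.Hom.map_d ((extFunctor τ).map (DGComod.snd : M.prod N ⟶ N)) x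
    exact h1.symm.trans ((congrArg _ hdx).trans (map_zero _)))
  have h2 := lTensor_prod_apply (A := A.carrier) (LinearMap.fst ℚ M.carrier N.carrier)
    (LinearMap.snd ℚ M.carrier N.carrier) x
  have h3 : (LinearMap.fst ℚ M.carrier N.carrier).prod (LinearMap.snd ℚ M.carrier N.carrier) =
    LinearMap.id := LinearMap.prod_ext rfl rfl
  rw [h3, LinearMap.lTensor_id_apply, hx, map_zero, zero_add, ← hw] at h2
  refine ⟨(LinearMap.inr ℚ M.carrier N.carrier).lTensor A.carrier w, ?_, ?_⟩
  · change (LinearMap.fst ℚ M.carrier N.carrier).lTensor A.carrier _ = 0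
    rw [← LinearMap.lTensor_comp_apply, LinearMap.fst_comp_inr, LinearMap.lTensor_zero,
      LinearMap.zero_apply]
  · refine Eq.trans ?_ h2.symm
    exact (DGMod.Hom.map_d ((extFunctor τ).map
      (DGComod.lift (DGComod.zeroHom N M) (𝟙 N))) w).symm

namespace DGMod

section

variable {C : DGCoalg.{u}} {η : Coaugmentation C}

/-- Adding a free summand is an acyclic cell extension. -/
theorem inl_freeDisks_llp (M : DGMod (cobar C η)) (V : Type u) [AddCommGroup V] [Module ℚ V] :
    (degreewiseEpi (cobar C η)).llp (inl : M ⟶ M.prod (freeDisks η V)) := by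
  intro X Y p hp
  refine ⟨fun {f g} sq => ?_⟩
  obtain ⟨l, hl⟩ := freeDisks_projective p ((degreewiseEpi_iff p).1 hp) (inr ≫ g)
  refine ⟨⟨⟨desc f l, Hom.ext (LinearMap.coprod_inl _ _), prod_hom_ext ?_ ?_⟩⟩⟩
  · rw [← sq.w]
    refine hom_ext fun x => ?_
    change Hom.lin p (Hom.lin f x + Hom.lin l 0) = _
    rw [map_zero, add_zero]
    rfl
  · rw [← hl]
    refine hom_ext fun x => ?_
    change Hom.lin p (Hom.lin f 0 + Hom.lin l x) = _
    rw [map_zero, zero_add]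
    rfl

theorem llp_degreewiseEpi_le : (degreewiseEpi (cobar C η)).llp ≤ (trivFib (cobar C η)).llp :=
  MorphismProperty.antitone_llp inf_le_left

/-- Add to `M` a free module on disks mapping onto `N`: the summand is acyclic, which makes the
inclusion a quasi-isomorphism, and projective, which gives the lifting property. -/
theorem exists_acyclic_cell_factorization {M N : DGMod (cobar C η)} (f : M ⟶ N) :
    ∃ (Z : DGMod (cobar C η)) (i : M ⟶ Z) (p : Z ⟶ N), i ≫ p = f ∧
      (degreewiseEpi (cobar C η)).llp i ∧ quasiIso _ i ∧ degreewiseEpi _ p := by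
  obtain ⟨g, hg⟩ := exists_freeDisks_surjective N
  refine ⟨M.prod (freeDisks η N.carrier), inl, desc f g, Hom.ext (LinearMap.coprod_inl _ _),
    inl_freeDisks_llp _ _, quasiIso_inl (freeDisks_acyclic η _), ?_⟩
  rw [degreewiseEpi_iff]
  intro y
  obtain ⟨x, rfl⟩ := hg y
  refine ⟨(0, x), ?_⟩
  change Hom.lin f 0 + Hom.lin g x = _
  rw [map_zero, zero_add]

/-- Comodules replace the small object argument. The injection `j` of `t_* M` into `t_* N × R`, with
`R` cofree on disks, becomes a cofibration under `t^!`; its pushout along the surjective counit of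
`M` is the left factor. Its injectivity is recorded because it later shows that all cofibrations are
injective. -/
theorem exists_cell_factorization (hη : η.IsConnected) {M N : DGMod (cobar C η)} (f : M ⟶ N) :
    ∃ (Z : DGMod (cobar C η)) (i : M ⟶ Z) (p : Z ⟶ N), i ≫ p = f ∧
      (trivFib (cobar C η)).llp i ∧ trivFib _ p ∧ Function.Injective (Hom.lin i) := by
  let R : DGComod C := DGComod.cofreeDisks C ((tLowerStar C η).obj M).carrier
  let j : (tLowerStar C η).obj M ⟶ ((tLowerStar C η).obj N).prod R :=
    DGComod.lift ((tLowerStar C η).map f) (DGComod.cofreeDisksEquiv _ _ LinearMap.id)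
  have hj : Function.Injective (DGComod.Hom.lin j) := fun x y h =>
    DGComod.injective_cofreeDisksEquiv _ _ (φ := LinearMap.id) Function.injective_id
      (congrArg Prod.snd h)
  let i := (tShriek C η).map j
  have hi : Function.Injective (Hom.lin i) := extFunctor_map_injective hj
  -- Since the counit is surjective, the pushout is the quotient by the image of its kernel.
  let S : Submodule _ ((tShriek C η).obj (((tLowerStar C η).obj N).prod R)).carrier :=
    (LinearMap.ker (Hom.lin (counitHom M))).map (Hom.lin i)
  have hS := isSub_map i (isSub_ker (counitHom M))
  let q := quotMk S hS
  have hqs : Function.Surjective (Hom.lin q) := Submodule.mkQ_surjective S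
  have hq0 : ∀ x, Hom.lin q x = 0 ↔ x ∈ S := fun x => Submodule.Quotient.mk_eq_zero S
  obtain ⟨k, hk⟩ := exists_desc (counitHom M) (counitHom_surjective M) (i ≫ q) fun x hx =>
    (hq0 _).2 ⟨x, hx, rfl⟩
  let π₀ := (tShriek C η).map (DGComod.fst : ((tLowerStar C η).obj N).prod R ⟶ _)
  have hπ₀ : trivFib _ π₀ := trivFib_fst (ext_cofreeDisks_acyclic _ _)
  have hiπ : i ≫ π₀ ≫ counitHom N = counitHom M ≫ f := by
    rw [← Category.assoc, ← Functor.map_comp]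
    exact (tAdj C η).counit.naturality f
  obtain ⟨p, hp⟩ := exists_desc q hqs (π₀ ≫ counitHom N) fun x hx => by
    obtain ⟨z, hz, rfl⟩ := (hq0 x).1 hx
    have h1 := LinearMap.congr_fun (congrArg Hom.lin hiπ) z
    refine h1.trans ?_
    change Hom.lin f (Hom.lin (counitHom M) z) = 0
    rw [show Hom.lin (counitHom M) z = 0 from hz, map_zero]
  have hepi := epi_of_surjective _ (counitHom_surjective M)
  have hqepi := epi_of_surjective q hqs
  refine ⟨_, k, p, ?_, ?_, ⟨?_, ?_⟩, ?_⟩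
  · rw [← cancel_epi (counitHom M), ← Category.assoc, hk, Category.assoc, hp, hiπ]
  -- A lift for `i` kills the image of the kernel of the counit, so it descends to the quotient:
  -- cofibrations are stable under pushout.
  · intro X Y t ht
    refine ⟨fun {F G} sq => ?_⟩
    have hl := hasLiftingProperty_tShriek hη j hj t ht
    have sq' : CommSq (counitHom M ≫ F) i t (q ≫ G) := ⟨by
      rw [Category.assoc, sq.w, ← Category.assoc, hk, Category.assoc]⟩
    obtain ⟨l', hl'⟩ := exists_desc q hqs sq'.lift fun x hx => by
      obtain ⟨z, hz, rfl⟩ := (hq0 x).1 hx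
      have h1 := LinearMap.congr_fun (congrArg Hom.lin sq'.fac_left) z
      refine h1.trans ?_
      change Hom.lin F (Hom.lin (counitHom M) z) = 0
      rw [show Hom.lin (counitHom M) z = 0 from hz, map_zero]
    refine ⟨⟨⟨l', ?_, ?_⟩⟩⟩
    · rw [← cancel_epi (counitHom M), ← Category.assoc, hk, Category.assoc, hl', sq'.fac_left]
    · rw [← cancel_epi q, ← Category.assoc, hl', sq'.fac_right]
  · rw [degreewiseEpi_iff]
    intro y
    obtain ⟨x, rfl⟩ := counitHom_surjective N y
    obtain ⟨z, rfl⟩ := (degreewiseEpi_iff _).1 hπ₀.1 x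
    exact ⟨Hom.lin q z, LinearMap.congr_fun (congrArg Hom.lin hp) z⟩
  -- The kernel of `q` is a copy of the kernel of the counit of `M`, hence acyclic. Then `p` is a
  -- quasi-isomorphism by two-out-of-three, as `q ≫ p` is a trivial fibration followed by the counit
  -- of `N`.
  · have hq : quasiIso _ q := by
      rw [quasiIso_iff]
      refine QIso.of_surjective (Hom.map_d q) (DGVect.d_d _) hqs fun x hx hdx => ?_
      obtain ⟨z, hz, rfl⟩ := (hq0 x).1 hx
      have hdz : ((tShriek C η).obj ((tLowerStar C η).obj M)).d z = 0 := by
        apply hi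
        rw [Hom.map_d, hdx, map_zero]
      obtain ⟨w, hw, hdw⟩ := QIso.ker_acyclic (f := Hom.linQ (counitHom M))
        (Hom.map_d (counitHom M)) (counitHom_surjective M)
        ((quasiIso_iff _).1 (quasiIso_counitHom M)) (DGVect.d_d _) z hz hdz
      refine ⟨Hom.lin i w, (hq0 _).2 ⟨w, hw, rfl⟩, ?_⟩
      rw [← Hom.map_d, hdw]
    have h1 : quasiIso _ (q ≫ p) := by
      rw [hp]
      exact (quasiIso _).comp_mem _ _ hπ₀.2 (quasiIso_counitHom N)
    exact (quasiIso _).of_precomp _ _ hq h1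
  · rw [injective_iff_map_eq_zero]
    intro x hx
    obtain ⟨z, rfl⟩ := counitHom_surjective M x
    have h1 : Hom.lin k (Hom.lin (counitHom M) z) = Hom.lin q (Hom.lin i z) :=
      LinearMap.congr_fun (congrArg Hom.lin hk) z
    obtain ⟨w, hw, hwz⟩ := (hq0 _).1 (h1.symm.trans hx)
    rw [← hi hwz]
    exact hw

variable (η) in
/-- The projective model structure. -/
@[reducible]
def modelCategory (hη : η.IsConnected) : ModelCategory (DGMod (cobar C η)) :=
  letI : CategoryWithFibrations (DGMod (cobar C η)) := ⟨degreewiseEpi _⟩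
  letI : CategoryWithCofibrations (DGMod (cobar C η)) := ⟨(trivFib _).llp⟩
  letI : CategoryWithWeakEquivalences (DGMod (cobar C η)) := ⟨quasiIso _⟩
  haveI : (weakEquivalences (DGMod (cobar C η))).HasTwoOutOfThreeProperty :=
    inferInstanceAs (quasiIso _).HasTwoOutOfThreeProperty
  haveI : (trivialFibrations (DGMod (cobar C η))).IsStableUnderRetracts :=
    inferInstanceAs (trivFib _).IsStableUnderRetracts
  haveI : (cofibrations (DGMod (cobar C η))).IsStableUnderRetracts :=
    inferInstanceAs (trivFib _).llp.IsStableUnderRetracts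
  haveI : (fibrations (DGMod (cobar C η))).IsStableUnderRetracts :=
    inferInstanceAs (degreewiseEpi _).IsStableUnderRetracts
  haveI : (trivialCofibrations (DGMod (cobar C η))).IsStableUnderRetracts :=
    inferInstanceAs ((trivFib _).llp ⊓ quasiIso _).IsStableUnderRetracts
  haveI : MorphismProperty.HasFactorization (cofibrations (DGMod (cobar C η)))
      (trivialFibrations (DGMod (cobar C η))) := ⟨fun f => by
    obtain ⟨Z, i, p, hf, hi, hp, -⟩ := exists_cell_factorization hη f
    exact ⟨⟨Z, i, p, hf, hi, hp⟩⟩⟩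
  haveI : MorphismProperty.HasFactorization (trivialCofibrations (DGMod (cobar C η)))
      (fibrations (DGMod (cobar C η))) := ⟨fun f => by
    obtain ⟨Z, i, p, hf, hi, hi', hp⟩ := exists_acyclic_cell_factorization f
    exact ⟨⟨Z, i, p, hf, ⟨llp_degreewiseEpi_le _ hi, hi'⟩, hp⟩⟩⟩
  haveI : MorphismProperty.IsWeakFactorizationSystem (cofibrations (DGMod (cobar C η)))
      (trivialFibrations (DGMod (cobar C η))) :=
    .mk' _ _ fun i p hi hp => hi p hp
  haveI : MorphismProperty.IsWeakFactorizationSystem (trivialCofibrations (DGMod (cobar C η)))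
      (fibrations (DGMod (cobar C η))) :=
    .mk' _ _ fun i p hi hp => by
      -- Two-out-of-three makes `q` a trivial fibration, so the trivial cofibration `i` is a retract
      -- of `j`, which lifts against all surjections.
      obtain ⟨Z, j, q, hf, hj, hj', hq⟩ := exists_acyclic_cell_factorization i
      have hq' : quasiIso _ q := (quasiIso _).of_precomp j q hj' (by rw [hf]; exact hi.2)
      obtain ⟨r⟩ := retractArrow_of_comp hf (hi.1 q ⟨hq, hq'⟩)
      exact (MorphismProperty.of_retract r hj) p hp
  ModelCategory.mk' _

/-- Cofibrations are injective. -/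
theorem injective_of_llp (hη : η.IsConnected) {M N : DGMod (cobar C η)} {i : M ⟶ N}
    (hi : (trivFib (cobar C η)).llp i) : Function.Injective (Hom.lin i) := by
  -- A cofibration is a retract of the injective left factor of its own factorization.
  obtain ⟨Z, j, q, hf, hj, hq, hji⟩ := exists_cell_factorization hη i
  obtain ⟨r⟩ := retractArrow_of_comp hf (hi q hq)
  intro x y hxy
  have h1 : ∀ x, Hom.lin j (Hom.lin r.i.left x) = Hom.lin r.i.right (Hom.lin i x) := fun x =>
    LinearMap.congr_fun (congrArg Hom.lin r.i_w) x
  have h2 : ∀ x, Hom.lin r.r.left (Hom.lin r.i.left x) = x := fun x =>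
    LinearMap.congr_fun (congrArg Hom.lin r.retract_left) x
  rw [← h2 x, ← h2 y, hji ((h1 x).trans ((congrArg _ hxy).trans (h1 y).symm))]

end

end DGMod

/-! ### The `t`-local model structure on dg comodules -/

namespace DGComod

variable {C : DGCoalg.{u}} {η : Coaugmentation C} {X Y : DGComod C}

theorem monomorphisms_iff (f : X ⟶ Y) :
    MorphismProperty.monomorphisms (DGComod C) f ↔ Function.Injective (Hom.lin f) :=
  mono_iff_injective f

/-- Injections are isomorphic to the inclusion of their image. -/
theorem exists_rangeInv (i : X ⟶ Y) (hi : Function.Injective (Hom.lin i)) :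
    ∃ r : Y.sub _ (isSub_range i) ⟶ X, r ≫ i = subι _ (isSub_range i) := by
  let s : X ⟶ Y.sub _ (isSub_range i) := subLift _ (isSub_range i) i fun x => ⟨x, rfl⟩
  have hs : Function.Bijective (Hom.lin s) :=
    ⟨fun x y h => hi (congrArg Subtype.val h), fun ⟨y, x, hx⟩ => ⟨x, Subtype.ext hx⟩⟩
  have := isIso_of_bijective s hs
  refine ⟨inv s, ?_⟩
  rw [IsIso.inv_comp_eq]
  rfl

/-- The comodules `cofreeDisks C V` are injective. -/
theorem rlp_fst_cofreeDisks (Y : DGComod C) (V : Type u) [AddCommGroup V] [Module ℚ V] :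
    (MorphismProperty.monomorphisms (DGComod C)).rlp
      (fst : Y.prod (cofreeDisks C V) ⟶ Y) := by
  intro K L i hi
  rw [monomorphisms_iff] at hi
  refine ⟨fun {f g} sq => ?_⟩
  -- Morphisms into `cofreeDisks C V` are bare linear maps into `V`, and these extend along `i` by a
  -- linear retraction.
  obtain ⟨r, hr⟩ := LinearMap.exists_leftInverse_of_injective (Hom.lin i)
    (LinearMap.ker_eq_bot.2 hi)
  obtain ⟨φ, hφ⟩ := (cofreeDisksEquiv K V).surjective (f ≫ snd)
  refine ⟨⟨⟨lift g (cofreeDisksEquiv L V (φ ∘ₗ r)), ?_, rfl⟩⟩⟩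
  have h1 : i ≫ cofreeDisksEquiv L V (φ ∘ₗ r) = f ≫ snd := by
    rw [← comp_cofreeDisksEquiv, LinearMap.comp_assoc, hr, LinearMap.comp_id, hφ]
  refine hom_ext fun x => Prod.ext ?_ ?_
  · exact (LinearMap.congr_fun (congrArg Hom.lin sq.w) x).symm
  · exact LinearMap.congr_fun (congrArg Hom.lin h1) x

variable (η) in
-- Embed `X` in the cofree comodule on its underlying space. That comodule is injective and
-- contractible, so the projection to `Y` lifts against monomorphisms and is a `t`-equivalence.
theorem exists_mono_factorization (f : X ⟶ Y) :
    ∃ (Z : DGComod C) (i : X ⟶ Z) (p : Z ⟶ Y), i ≫ p = f ∧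
      MorphismProperty.monomorphisms _ i ∧ (MorphismProperty.monomorphisms _).rlp p ∧
        tEquivalences C η p := by
  refine ⟨Y.prod (cofreeDisks C X.carrier), lift f (cofreeDisksEquiv X _ LinearMap.id), fst,
    rfl, ?_, rlp_fst_cofreeDisks Y _, (trivFib_fst (ext_cofreeDisks_acyclic _ _)).2⟩
  rw [monomorphisms_iff]
  intro x y h
  exact injective_cofreeDisksEquiv X _ (φ := LinearMap.id) Function.injective_id
    (congrArg Prod.snd h)

variable (η) in
-- The algebra map `ΩC → ℚ` killing every `tc` gives a retraction.
theorem injective_one_tmul (V : Type u) [AddCommGroup V] [Module ℚ V] :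
    Function.Injective fun x : V => (1 : (cobar C η).carrier) ⊗ₜ[ℚ] x := by
  intro x y h
  let φ : (cobar C η).carrier →ₗ[ℚ] ℚ := (cobarLift (C := C) (η := η) (R := ℚ) 0 rfl).toLinearMap
  have hφ : φ 1 = 1 := map_one (cobarLift (C := C) (η := η) (R := ℚ) 0 rfl)
  have h1 := congrArg (fun z => TensorProduct.lid ℚ V (φ.rTensor V z)) h
  simpa [hφ] using h1

/-- By the triangle identity, `t^!` of the unit is a section of a counit, and counits are
quasi-isomorphisms. -/
theorem tEquivalences_unit (Y : DGComod C) :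
    tEquivalences C η ((tAdj C η).unit.app Y) := by
  have h1 : (tShriek C η).map ((tAdj C η).unit.app Y) ≫ counitHom ((tShriek C η).obj Y) = 𝟙 _ :=
    (tAdj C η).left_triangle_components Y
  refine (DGMod.quasiIso _).of_postcomp _ _ (quasiIso_counitHom ((tShriek C η).obj Y)) ?_
  rw [h1]
  exact DGMod.quasiIso_id _

/-- `t^!` of the unit is split by a counit; injectivity is then read off on the elements `1 ⊗ y`. -/
theorem injective_unit (Y : DGComod C) :
    Function.Injective (Hom.lin ((tAdj C η).unit.app Y)) := by
  have h1 : (tShriek C η).map ((tAdj C η).unit.app Y) ≫ counitHom ((tShriek C η).obj Y) = 𝟙 _ :=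
    (tAdj C η).left_triangle_components Y
  intro x y h
  apply injective_one_tmul η Y.carrier
  have h2 : ∀ z, DGMod.Hom.lin (counitHom ((tShriek C η).obj Y))
      (DGMod.Hom.lin ((tShriek C η).map ((tAdj C η).unit.app Y)) z) = z := fun z =>
    LinearMap.congr_fun (congrArg DGMod.Hom.lin h1) z
  refine (h2 _).symm.trans (Eq.trans ?_ (h2 _))
  refine congrArg (DGMod.Hom.lin (counitHom ((tShriek C η).obj Y))) ?_
  exact congrArg (fun z => (1 : (cobar C η).carrier) ⊗ₜ[ℚ] z) h

theorem injective_of_tShriek {f : X ⟶ Y}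
    (h : Function.Injective (DGMod.Hom.lin ((tShriek C η).map f))) :
    Function.Injective (Hom.lin f) := by
  intro x y hxy
  apply injective_one_tmul η X.carrier
  apply h
  exact congrArg (fun z => (1 : (cobar C η).carrier) ⊗ₜ[ℚ] z) hxy

variable (C η) in
/-- The trivial cofibrations: the injective `t`-equivalences. -/
def trivCof : MorphismProperty (DGComod C) :=
  MorphismProperty.monomorphisms (DGComod C) ⊓ tEquivalences C η

/-- The functor `t_*` sends degreewise epimorphisms to fibrations. -/
theorem rlp_tLowerStar (hη : η.IsConnected) {M N : DGMod (cobar C η)} (p : M ⟶ N)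
    (hp : DGMod.degreewiseEpi _ p) : (trivCof C η).rlp ((tLowerStar C η).map p) := by
  intro K L i hi
  rw [← (tAdj C η).hasLiftingProperty_iff]
  let := DGMod.modelCategory η hη
  have h1 : (DGMod.trivFib (cobar C η)).llp ((tShriek C η).map i) := fun _ _ q hq =>
    hasLiftingProperty_tShriek hη i ((monomorphisms_iff i).1 hi.1) q hq
  have h2 : trivialCofibrations _ ((tShriek C η).map i) := ⟨h1, hi.2⟩
  exact MorphismProperty.hasLiftingProperty_of_wfs _ _ h2
    (show fibrations (DGMod (cobar C η)) p from hp)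

/-- Factor `t^! f` as `j` followed by a surjection `p : W → t^! Y`, and pull `t_* p` back along the
unit of `Y`. The projection to `Y` is a fibration as a pullback of one, and the map from `X` is
compared with `j` through the counit of `W`. -/
theorem exists_trivCof_factorization (hη : η.IsConnected) (f : X ⟶ Y) :
    ∃ (Z : DGComod C) (i : X ⟶ Z) (p : Z ⟶ Y), i ≫ p = f ∧ trivCof C η i ∧
      (trivCof C η).rlp p := by
  obtain ⟨W, j, p, hjp, hj, hj', hp⟩ :=
    DGMod.exists_acyclic_cell_factorization ((tShriek C η).map f)
  have hji : Function.Injective (DGMod.Hom.lin j) :=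
    DGMod.injective_of_llp hη (DGMod.llp_degreewiseEpi_le _ hj)
  let uX := (tAdj C η).unit.app X
  let uY := (tAdj C η).unit.app Y
  have huY : Function.Injective (Hom.lin uY) := injective_unit Y
  let P := (tLowerStar C η).map p
  have hPs : Function.Surjective (Hom.lin P) :=
    coextFunctor_map_surjective ((DGMod.degreewiseEpi_iff p).1 hp)
  -- As the unit of `Y` is injective, the pullback is the preimage of its image, a subcomodule of
  -- `t_* W`.
  have hS := (isSub_range uY).comap P
  obtain ⟨r, hr⟩ := exists_rangeInv uY huY
  let ι := subι _ hS
  let q := subLift _ (isSub_range uY) (ι ≫ P) (fun z => z.2) ≫ r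
  have hq : q ≫ uY = ι ≫ P := by
    rw [Category.assoc, hr]
    rfl
  have hmono : Mono uY := (mono_iff_injective uY).2 huY
  have hιmono : Mono ι := (mono_iff_injective ι).2 Subtype.val_injective
  have hk0 : (uX ≫ (tLowerStar C η).map j) ≫ P = f ≫ uY := by
    rw [Category.assoc, ← Functor.map_comp, hjp]
    exact ((tAdj C η).unit.naturality f).symm
  let k := subLift _ hS (uX ≫ (tLowerStar C η).map j) fun x =>
    ⟨Hom.lin f x, (LinearMap.congr_fun (congrArg Hom.lin hk0) x).symm⟩
  have hk : k ≫ ι = uX ≫ (tLowerStar C η).map j := rfl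
  refine ⟨_, k, q, ?_, ⟨?_, ?_⟩, ?_⟩
  · rw [← cancel_mono uY, Category.assoc, hq, ← Category.assoc, hk, hk0]
  · rw [monomorphisms_iff]
    have h1 : Function.Injective (Hom.lin (k ≫ ι)) := by
      rw [hk]
      exact (lTensor_injective (A := C.carrier) (f := DGMod.Hom.linQ j) hji).comp (injective_unit X)
    exact fun x y hxy => h1 (congrArg (Hom.lin ι) hxy)
  -- Since `P` is surjective, the inclusion of a preimage has the same cokernel as the inclusion of
  -- the original subcomodule. So acyclicity of the cokernel passes from `t^! uY` to `t^! ι`.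
  · have hι : tEquivalences C η ι := by
      have hu := (DGMod.quasiIso_iff _).1 (tEquivalences_unit (η := η) Y)
      refine (DGMod.quasiIso_iff _).2 ?_
      rw [QIso.iff_of_injective (DGMod.Hom.map_d _) (DGVect.d_d _)
        (extFunctor_map_injective huY)] at hu
      rw [QIso.iff_of_injective (DGMod.Hom.map_d _) (DGVect.d_d _)
        (extFunctor_map_injective (f := ι) Subtype.val_injective)]
      have hrι : ∀ z, z ∈ LinearMap.range (DGMod.Hom.linQ ((tShriek C η).map ι)) ↔
          DGMod.Hom.lin ((tShriek C η).map P) z ∈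
            LinearMap.range (DGMod.Hom.linQ ((tShriek C η).map uY)) := by
        intro z
        have e1 : LinearMap.range (DGMod.Hom.linQ ((tShriek C η).map ι)) =
            tensorSub (cobar C η).carrier ((LinearMap.range (Hom.lin uY)).comap (Hom.lin P)) := rfl
        have e2 : LinearMap.range (DGMod.Hom.linQ ((tShriek C η).map uY)) =
            tensorSub (cobar C η).carrier (LinearMap.range (Hom.lin uY)) :=
          range_lTensor (Hom.lin uY)
        rw [e1, e2, tensorSub_comap]
        rfl
      intro y hy
      rw [hrι] at hy
      obtain ⟨w', hw'⟩ := hu (DGMod.Hom.lin ((tShriek C η).map P) y)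
        (by rw [← DGMod.Hom.map_d]; exact hy)
      obtain ⟨w, rfl⟩ : ∃ w, DGMod.Hom.lin ((tShriek C η).map P) w = w' :=
        LinearMap.lTensor_surjective (cobar C η).carrier (g := Hom.lin P) hPs w'
      refine ⟨w, (hrι _).2 ?_⟩
      rw [map_sub, DGMod.Hom.map_d]
      exact hw'
    -- The map `k ≫ ι` is the adjunct of `j`. Both `j` and the counit are quasi-isomorphisms, hence
    -- `k ≫ ι` is a `t`-equivalence, and so is `k`.
    have h1 : (tShriek C η).map (k ≫ ι) ≫ counitHom W = j := by
      rw [hk]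
      have h2 := (tAdj C η).homEquiv_counit (X := X) (Y := W)
        (g := (tAdj C η).homEquiv _ _ j)
      rw [Equiv.symm_apply_apply, Adjunction.homEquiv_unit] at h2
      exact h2.symm
    have h3 : DGMod.quasiIso _ ((tShriek C η).map (k ≫ ι)) := by
      refine (DGMod.quasiIso _).of_postcomp _ _ (quasiIso_counitHom W) ?_
      rw [h1]
      exact hj'
    rw [Functor.map_comp] at h3
    exact (DGMod.quasiIso _).of_postcomp _ _ hι h3
  · intro K L i hi
    refine ⟨fun {a b} sq => ?_⟩
    have := rlp_tLowerStar hη p hp i hi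
    have sq' : CommSq (a ≫ ι) i P (b ≫ uY) := ⟨by
      rw [Category.assoc, ← hq, ← Category.assoc, sq.w, Category.assoc]⟩
    let l := subLift _ hS sq'.lift fun x =>
      ⟨Hom.lin b x, (LinearMap.congr_fun (congrArg Hom.lin sq'.fac_right) x).symm⟩
    have hl : l ≫ ι = sq'.lift := rfl
    refine ⟨⟨⟨l, ?_, ?_⟩⟩⟩
    · rw [← cancel_mono ι, Category.assoc, hl, sq'.fac_left]
    · rw [← cancel_mono uY, Category.assoc, hq, ← Category.assoc, hl, sq'.fac_right]

instance : (tEquivalences C η).HasTwoOutOfThreeProperty :=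
  inferInstanceAs ((DGMod.quasiIso _).inverseImage _).HasTwoOutOfThreeProperty

instance : (tEquivalences C η).IsStableUnderRetracts :=
  inferInstanceAs ((DGMod.quasiIso _).inverseImage _).IsStableUnderRetracts

instance : (trivCof C η).IsStableUnderRetracts :=
  inferInstanceAs (MorphismProperty.monomorphisms _ ⊓ tEquivalences C η).IsStableUnderRetracts

/-- Trivial fibrations have the right lifting property with respect to monomorphisms. -/
theorem rlp_trivCof_inf_tEquivalences :
    (trivCof C η).rlp ⊓ tEquivalences C η = (MorphismProperty.monomorphisms (DGComod C)).rlp := by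
  apply le_antisymm
  · intro X Y p hp
    obtain ⟨Z, i, q, hiq, hi, hq, hq'⟩ := exists_mono_factorization η p
    -- Two-out-of-three makes `i` a trivial cofibration, so `p` lifts against it and is a retract of
    -- `q`. The converse inclusion uses the same retract to see that `p` is a `t`-equivalence.
    have hi' : tEquivalences C η i := (tEquivalences C η).of_postcomp i q hq' (hiq ▸ hp.2)
    have := hp.1 i ⟨hi, hi'⟩
    exact MorphismProperty.of_retract (RetractArrow.ofRightLiftingProperty hiq) hq
  · intro X Y p hp
    refine ⟨fun K L i hi => hp i hi.1, ?_⟩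
    obtain ⟨Z, i, q, hiq, hi, hq, hq'⟩ := exists_mono_factorization η p
    have := hp i hi
    exact MorphismProperty.of_retract (RetractArrow.ofRightLiftingProperty hiq) hq'

instance : HasFiniteColimits (DGComod C) :=
  hasFiniteColimits_of_hasColimitsOfSize _

variable (η) in
/-- The `t`-local model structure. -/
@[reducible]
def modelCategory (hη : η.IsConnected) : ModelCategory (DGComod C) :=
  let : CategoryWithFibrations (DGComod C) := ⟨(trivCof C η).rlp⟩
  let : CategoryWithCofibrations (DGComod C) := ⟨MorphismProperty.monomorphisms _⟩
  let : CategoryWithWeakEquivalences (DGComod C) := ⟨tEquivalences C η⟩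
  have htf : trivialFibrations (DGComod C) = (MorphismProperty.monomorphisms _).rlp :=
    rlp_trivCof_inf_tEquivalences (η := η)
  haveI : (weakEquivalences (DGComod C)).HasTwoOutOfThreeProperty :=
    inferInstanceAs (tEquivalences C η).HasTwoOutOfThreeProperty
  haveI : (trivialFibrations (DGComod C)).IsStableUnderRetracts := by
    rw [htf]; infer_instance
  haveI : (cofibrations (DGComod C)).IsStableUnderRetracts :=
    inferInstanceAs (MorphismProperty.monomorphisms (DGComod C)).IsStableUnderRetracts
  haveI : (fibrations (DGComod C)).IsStableUnderRetracts :=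
    inferInstanceAs (trivCof C η).rlp.IsStableUnderRetracts
  haveI : (trivialCofibrations (DGComod C)).IsStableUnderRetracts :=
    inferInstanceAs (trivCof C η).IsStableUnderRetracts
  haveI : MorphismProperty.HasFactorization (cofibrations (DGComod C))
      (trivialFibrations (DGComod C)) := ⟨fun f => by
    obtain ⟨Z, i, p, hf, hi, hp, -⟩ := exists_mono_factorization η f
    exact ⟨⟨Z, i, p, hf, hi, htf ▸ hp⟩⟩⟩
  haveI : MorphismProperty.HasFactorization (trivialCofibrations (DGComod C))
      (fibrations (DGComod C)) := ⟨fun f => by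
    obtain ⟨Z, i, p, hf, hi, hp⟩ := exists_trivCof_factorization hη f
    exact ⟨⟨Z, i, p, hf, hi, hp⟩⟩⟩
  haveI : MorphismProperty.IsWeakFactorizationSystem (cofibrations (DGComod C))
      (trivialFibrations (DGComod C)) :=
    .mk' _ _ fun i p hi hp => (htf ▸ hp : (MorphismProperty.monomorphisms _).rlp p) i hi
  haveI : MorphismProperty.IsWeakFactorizationSystem (trivialCofibrations (DGComod C))
      (fibrations (DGComod C)) :=
    .mk' _ _ fun i p hi hp => hp i hi
  ModelCategory.mk' _

/-- For cofibrations, one direction is the cell-by-cell lifting of `hasLiftingProperty_tShriek`; the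
other is that cofibrations of modules are injective and that `f` sits inside `t^! f` as the elements
`1 ⊗ x`. -/
theorem isLeftInduced (hη : η.IsConnected) :
    let := modelCategory η hη
    let := DGMod.modelCategory η hη
    IsLeftInduced (tShriek C η) := by
  let := modelCategory η hη
  let := DGMod.modelCategory η hη
  refine ⟨rfl, ?_⟩
  ext X Y f
  change MorphismProperty.monomorphisms _ f ↔ (DGMod.trivFib _).llp ((tShriek C η).map f)
  rw [monomorphisms_iff]
  exact ⟨fun h _ _ q hq => hasLiftingProperty_tShriek hη f h q hq,
    fun h => injective_of_tShriek (DGMod.injective_of_llp hη h)⟩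

/-- A map `t^! X → Y` is `t^!` of its adjunct followed by the counit of `Y`, a quasi-isomorphism, so
two-out-of-three applies. -/
theorem isQuillenEquivalence (hη : η.IsConnected) :
    let := modelCategory η hη
    let := DGMod.modelCategory η hη
    IsQuillenEquivalence (tAdj C η) := by
  let := modelCategory η hη
  let := DGMod.modelCategory η hη
  have h : ∀ ⦃X Y : DGComod C⦄ (f : X ⟶ Y), cofibrations (DGComod C) f →
      cofibrations (DGMod (cobar C η)) ((tShriek C η).map f) := by
    intro X Y f hf
    rw [(isLeftInduced hη).cofibrations_eq] at hf
    exact hf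
  refine { map_cofibration := h
           map_trivialCofibration := fun X Y f hf => ⟨h f hf.1, hf.2⟩
           weakEquivalence_iff := fun X Y _ _ f => ?_ }
  change DGMod.quasiIso _ f ↔ DGMod.quasiIso _ ((tShriek C η).map _)
  have h1 : (tShriek C η).map ((tAdj C η).homEquiv X Y f) ≫ counitHom Y = f := by
    have h2 := (tAdj C η).homEquiv_counit (X := X) (Y := Y)
      (g := (tAdj C η).homEquiv _ _ f)
    rw [Equiv.symm_apply_apply] at h2
    exact h2.symm
  constructor
  · intro hf
    refine (DGMod.quasiIso _).of_postcomp _ _ (quasiIso_counitHom Y) ?_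
    rw [h1]
    exact hf
  · intro hf
    rw [← h1]
    exact (DGMod.quasiIso _).comp_mem _ _ hf (quasiIso_counitHom Y)

end DGComod

open Limits

/-! ### Small subcomodules and the gluing of lifts. -/

section Closure

open Cardinal

/-- A subset is contained in a subset of controlled cardinality which is closed under a given family
of finitary operations. -/
theorem exists_closed_superset {Y : Type u} (K : ℕ → Type u) (g : ∀ n, K n → (Fin n → Y) → Y)
    (s : Set Y) : ∃ T : Set Y, s ⊆ T ∧ (∀ n k x, (∀ i, x i ∈ T) → g n k x ∈ T) ∧
      #T ≤ max ℵ₀ (#s + #(Σ n, K n)) := by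
  -- The operations become function symbols of a first-order language, so that the cardinality bound
  -- for generated substructures applies.
  let L : FirstOrder.Language.{u, 0} := ⟨K, fun _ => Empty⟩
  let _ : L.Structure Y := ⟨fun {n} k x => g n k x, fun {n} r => r.elim⟩
  refine ⟨FirstOrder.Language.Substructure.closure L s,
    FirstOrder.Language.Substructure.subset_closure, fun n k x hx =>
      (FirstOrder.Language.Substructure.closure L s).fun_mem (n := n) k x hx, ?_⟩
  have h := FirstOrder.Language.Substructure.lift_card_closure_le (L := L) (s := s)
  simpa using h

/-- Counts the operations that close a subcomodule under solutions of `z = dw`: a tuple of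
coefficients and the index of a vector. -/
theorem mk_list_prod_le (A : Type u) : #(Σ n : ℕ, (Fin n → A) × ULift.{u} ℕ) ≤ max ℵ₀ #A := by
  let e : (Σ n : ℕ, (Fin n → A) × ULift.{u} ℕ) ≃ List A × ULift.{u} ℕ :=
    (Equiv.sigmaProdDistrib _ _).symm.trans (List.equivSigmaTuple.symm.prodCongr (Equiv.refl _))
  rw [Cardinal.mk_congr e, mk_prod]
  simp only [lift_id, mk_uLift, mk_nat, lift_aleph0]
  refine (mul_le_max_of_aleph0_le_right le_rfl).trans ?_
  exact max_le (Cardinal.mk_list_le_max A) (le_max_left _ _)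

end Closure

/-- A sequence, rather than a finite set, has the same index type for every `z`, so choosing it
yields countably many honest operations. -/
theorem exists_mem_tensorSub_range {A : Type*} [AddCommGroup A] [Module ℚ A] {V : Type*}
    [AddCommGroup V] [Module ℚ V] (z : A ⊗[ℚ] V) :
    ∃ e : ℕ → V, z ∈ tensorSub A (Submodule.span ℚ (Set.range e)) := by
  induction z with
  | zero => exact ⟨0, zero_mem _⟩
  | tmul a v => exact ⟨fun _ => v, tmul_mem_tensorSub a (Submodule.subset_span ⟨0, rfl⟩)⟩
  | add x y hx hy =>
    obtain ⟨e, he⟩ := hx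
    obtain ⟨e', he'⟩ := hy
    refine ⟨fun n => if Even n then e (n / 2) else e' (n / 2), add_mem
      (tensorSub_mono (Submodule.span_mono ?_) he) (tensorSub_mono (Submodule.span_mono ?_) he')⟩
    · rintro _ ⟨n, rfl⟩
      exact ⟨2 * n, by simp⟩
    · rintro _ ⟨n, rfl⟩
      refine ⟨2 * n + 1, ?_⟩
      have h1 : ¬ Even (2 * n + 1) := by simp
      have h2 : (2 * n + 1) / 2 = n := by omega
      simp only [if_neg h1, h2]

theorem exists_sum_tmul_of_mem_tensorSub {A : Type*} [AddCommGroup A] [Module ℚ A] {V : Type*}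
    [AddCommGroup V] [Module ℚ V] {S : Submodule ℚ V} {z : A ⊗[ℚ] V} (hz : z ∈ tensorSub A S) :
    ∃ (n : ℕ) (a : Fin n → A) (x : Fin n → V), (∀ i, x i ∈ S) ∧ z = ∑ i, a i ⊗ₜ x i := by
  obtain ⟨z, rfl⟩ := hz
  obtain ⟨n, a, x, rfl⟩ := TensorProduct.exists_sum_tmul_eq z
  exact ⟨n, a, fun i => x i, fun i => (x i).2, by simp⟩

namespace DGComod

variable {C : DGCoalg.{u}} {η : Coaugmentation C}

open Cardinal in
/-- An element of a comodule lies in a subcomodule of controlled cardinality which is closed under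
a given family of finitary operations. -/
theorem exists_closed_isSub (N : DGComod C) (K : ℕ → Type u)
    (g : ∀ n, K n → (Fin n → N.carrier) → N.carrier) (y : N.carrier) :
    ∃ T : Submodule ℚ N.carrier, N.IsSub T ∧ y ∈ T ∧
      (∀ n k x, (∀ i, x i ∈ T) → g n k x ∈ T) ∧ #T ≤ max ℵ₀ #(Σ n, K n) := by
  -- A subspace closed under all `x ↦ e x m` contains the vectors that the coaction of each of its
  -- elements needs.
  choose e he using fun x : N.carrier => exists_mem_tensorSub_range (N.coact x)
  let U : Option (Option (ℤ ⊕ ℕ)) → N.carrier → N.carrier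
    | none => id
    | some none => N.d
    | some (some (Sum.inl m)) => N.proj m
    | some (some (Sum.inr m)) => fun x => e x m
  -- Besides the given operations: the identity, the differential, the projections and the maps `e ·
  -- m`, each applied to rational linear combinations. The identity alone makes the closure a
  -- subspace.
  let K' : ℕ → Type u := fun n => K n ⊕ ULift ((Fin n → ℚ) × Option (Option (ℤ ⊕ ℕ)))
  obtain ⟨T, hyT, hT, hcard⟩ := exists_closed_superset K' (fun n k x => k.elim (fun k => g n k x)
    fun q => U q.down.2 (∑ i, q.down.1 i • x i)) {y}
  have hU : ∀ j n (q : Fin n → ℚ) (x : Fin n → N.carrier), (∀ i, x i ∈ T) → U j (∑ i, q i • x i) ∈ T :=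
    fun j n q x hx => hT n (Sum.inr ⟨q, j⟩) x hx
  let T' : Submodule ℚ N.carrier :=
    { carrier := T
      zero_mem' := by
        have := hU none 0 0 0 (fun i => i.elim0)
        simpa [U] using this
      add_mem' := fun {a b} ha hb => by
        have := hU none 2 ![1, 1] ![a, b] (fun i => by fin_cases i <;> simpa)
        simpa [U] using this
      smul_mem' := fun c x hx => by
        have := hU none 1 ![c] ![x] (fun i => by fin_cases i; simpa)
        simpa [U] using this }
  have hU' : ∀ j x, x ∈ T' → U j x ∈ T' := fun j x hx => by
    have := hU j 1 ![1] ![x] (fun i => by fin_cases i; simpa)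
    change U j x ∈ T
    simpa using this
  refine ⟨T', ⟨⟨fun m x hx => hU' (some (some (Sum.inl m))) x hx,
    fun x hx => hU' (some none) x hx⟩, fun x hx => tensorSub_mono (Submodule.span_le.2 ?_) (he x)⟩,
    hyT rfl, fun n k x hx => hT n (Sum.inl k) x hx, hcard.trans ?_⟩
  · rintro _ ⟨m, rfl⟩
    exact hU' (some (some (Sum.inr m))) x hx
  · have h1 : #(Σ n, K' n) = #(Σ n, K n) +
        #(Σ n : ℕ, ULift.{u} ((Fin n → ℚ) × Option (Option (ℤ ⊕ ℕ)))) := by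
      rw [Cardinal.add_def]
      exact Cardinal.mk_congr (Equiv.sigmaSumDistrib _ _)
    have h2 : #(Σ n : ℕ, ULift.{u} ((Fin n → ℚ) × Option (Option (ℤ ⊕ ℕ)))) ≤ ℵ₀ :=
      mk_le_aleph0
    rw [mk_singleton, h1]
    refine max_le (le_max_left _ _) ?_
    have h3 := le_max_left ℵ₀ #(Σ n, K n)
    refine add_le_of_le h3 (one_le_aleph0.trans h3) (add_le_of_le h3 (le_max_right _ _)
      (h2.trans h3))

/-- A linear map out of a comodule which restricts to morphisms on two morphisms that jointly
cover it is a morphism. -/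
def homOfCover {U V M N : DGComod C} (i : U ⟶ M) (j : V ⟶ M)
    (hij : ∀ x, ∃ a b, Hom.lin i a + Hom.lin j b = x) (k : M.carrier →ₗ[ℚ] N.carrier) (f : U ⟶ N)
    (g : V ⟶ N) (hf : ∀ a, k (Hom.lin i a) = Hom.lin f a)
    (hg : ∀ b, k (Hom.lin j b) = Hom.lin g b) : M ⟶ N where
  lin := k
  map_mem := DGVect.mem_gr_of_commutes (V := M.toDGVect) (W := N.toDGVect) fun n x => by
    obtain ⟨a, b, rfl⟩ := hij x
    rw [map_add, map_add, map_add, map_add, hf, hg,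
      ← DGVect.map_proj₀ (V := U.toDGVect) (Hom.map_mem i),
      ← DGVect.map_proj₀ (V := V.toDGVect) (Hom.map_mem j), hf, hg,
      DGVect.map_proj₀ (V := U.toDGVect) (Hom.map_mem f),
      DGVect.map_proj₀ (V := V.toDGVect) (Hom.map_mem g)]
  map_d x := by
    obtain ⟨a, b, rfl⟩ := hij x
    rw [map_add, map_add, map_add, map_add, hf, hg, ← Hom.map_d, ← Hom.map_d, hf, hg, Hom.map_d,
      Hom.map_d]
  map_coact x := by
    obtain ⟨a, b, rfl⟩ := hij x
    have h1 : k ∘ₗ Hom.lin i = Hom.lin f := LinearMap.ext hf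
    have h2 : k ∘ₗ Hom.lin j = Hom.lin g := LinearMap.ext hg
    rw [map_add, map_add, map_add, map_add, hf, hg, Hom.map_coact, Hom.map_coact, Hom.map_coact,
      Hom.map_coact, ← LinearMap.lTensor_comp_apply, ← LinearMap.lTensor_comp_apply, h1, h2]

/-- The inclusion of `S` in `S + T` is the pushout of that of `S ∩ T` in `T`. This is how a large
inclusion is enlarged by a small one. -/
theorem hasLiftingProperty_subIncl_sup {Y E B : DGComod C} {S T : Submodule ℚ Y.carrier}
    (hS : Y.IsSub S) (hT : Y.IsSub T) (p : E ⟶ B)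
    [HasLiftingProperty (subIncl (hS.inf hT) hT inf_le_right) p] :
    HasLiftingProperty (subIncl hS (hS.sup hT) le_sup_left) p := by
  refine ⟨fun {f b} sq => ?_⟩
  have sq' : CommSq (subIncl (hS.inf hT) hS inf_le_left ≫ f) (subIncl (hS.inf hT) hT inf_le_right) p
      (subIncl hT (hS.sup hT) le_sup_right ≫ b) := ⟨by
    rw [Category.assoc, sq.w]
    rfl⟩
  let F : Y.carrier →ₗ.[ℚ] E.carrier := ⟨S, Hom.lin f⟩
  let G : Y.carrier →ₗ.[ℚ] E.carrier := ⟨T, Hom.lin sq'.lift⟩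
  have hFG : ∀ (x : F.domain) (y : G.domain), (x : Y.carrier) = y → F x = G y := by
    rintro ⟨x, hx⟩ ⟨y, hy⟩ (rfl : x = y)
    exact (LinearMap.congr_fun (congrArg Hom.lin sq'.fac_left) (⟨x, hx, hy⟩ : ↥(S ⊓ T))).symm
  let k : ↥(S ⊔ T) →ₗ[ℚ] E.carrier := (F.sup G hFG).toFun
  have hk1 : ∀ a : S, k ⟨a, le_sup_left (a := S) a.2⟩ = Hom.lin f a := fun a =>
    (LinearPMap.sup_apply hFG a (0 : T) _ (add_zero _)).trans
      ((congrArg (_ + ·) (map_zero (Hom.lin sq'.lift))).trans (add_zero _))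
  have hk2 : ∀ b : T, k ⟨b, le_sup_right (a := S) b.2⟩ = Hom.lin sq'.lift b := fun b =>
    (LinearPMap.sup_apply hFG (0 : S) b _ (zero_add _)).trans
      ((congrArg (· + _) (map_zero (Hom.lin f))).trans (zero_add _))
  have hcov : ∀ x, ∃ a b, Hom.lin (subIncl hS (hS.sup hT) le_sup_left) a +
      Hom.lin (subIncl hT (hS.sup hT) le_sup_right) b = x := by
    rintro ⟨x, hx⟩
    obtain ⟨a, ha, b, hb, rfl⟩ := Submodule.mem_sup.1 hx
    exact ⟨(⟨a, ha⟩ : S), (⟨b, hb⟩ : T), Subtype.ext rfl⟩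
  let l := homOfCover (subIncl hS (hS.sup hT) le_sup_left) (subIncl hT (hS.sup hT) le_sup_right)
    hcov k f sq'.lift hk1 hk2
  refine ⟨⟨⟨l, DGComod.hom_ext hk1, ?_⟩⟩⟩
  refine DGComod.hom_ext fun x => ?_
  obtain ⟨a, b', rfl⟩ := hcov x
  have h1 : Hom.lin p (Hom.lin f a) = Hom.lin b (Hom.lin (subIncl hS (hS.sup hT) le_sup_left) a) :=
    LinearMap.congr_fun (congrArg Hom.lin sq.w) a
  have h2 : Hom.lin p (Hom.lin sq'.lift b') =
      Hom.lin b (Hom.lin (subIncl hT (hS.sup hT) le_sup_right) b') :=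
    LinearMap.congr_fun (congrArg Hom.lin sq'.fac_right) b'
  have h3 : Hom.lin (l ≫ p) (Hom.lin (subIncl hS (hS.sup hT) le_sup_left) a) =
      Hom.lin p (Hom.lin f a) := congrArg (Hom.lin p) (hk1 a)
  have h4 : Hom.lin (l ≫ p) (Hom.lin (subIncl hT (hS.sup hT) le_sup_right) b') =
      Hom.lin p (Hom.lin sq'.lift b') :=
    congrArg (Hom.lin p) (hk2 b')
  rw [map_add, map_add]
  exact congrArg₂ (· + ·) (h3.trans h1) (h4.trans h2)

end DGComod

open Limits

namespace DGComod

variable {C : DGCoalg.{u}} {η : Coaugmentation C}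

theorem injective_subIncl {N : DGComod C} {S T : Submodule ℚ N.carrier} (hS : N.IsSub S)
    (hT : N.IsSub T) (h : S ≤ T) : Function.Injective (Hom.lin (subIncl hS hT h)) :=
  Submodule.inclusion_injective h

/-! ### Generating sets of cofibrations. -/

section Generating

open Cardinal

/-- A comodule which contains a copy of every comodule of cardinality at most `κ`. -/
def envelope (C : DGCoalg.{u}) (κ : Cardinal.{u}) : DGComod C := cofreeDisks C (κ.out →₀ ℚ)

/-- A small skeleton of a category of comodules containing those of cardinality at most `κ`. -/
def skeleton (C : DGCoalg.{u}) (κ : Cardinal.{u})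
    (S : {S : Submodule ℚ (envelope C κ).carrier // (envelope C κ).IsSub S}) : DGComod C :=
  (envelope C κ).sub S.1 S.2

/-- A basis of `N` has at most `κ` elements, so `N` embeds linearly in the free space on `κ`, hence
as a comodule in the cofree comodule on it. The subcomodules of that one comodule form a set. -/
theorem exists_iso_skeleton {κ : Cardinal.{u}} (N : DGComod C) (h : #N.carrier ≤ κ) :
    ∃ S, Nonempty (N ≅ skeleton C κ S) := by
  let b := Module.Basis.ofVectorSpace ℚ N.carrier
  have h1 : #(Module.Basis.ofVectorSpaceIndex ℚ N.carrier) ≤ #κ.out :=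
    (Cardinal.mk_subtype_le _).trans (h.trans (mk_out κ).ge)
  obtain ⟨f⟩ := h1
  let φ : N.carrier →ₗ[ℚ] (κ.out →₀ ℚ) := Finsupp.lmapDomain ℚ ℚ f ∘ₗ b.repr.toLinearMap
  have hφ : Function.Injective φ :=
    (Finsupp.mapDomain_injective f.injective).comp b.repr.injective
  let i : N ⟶ envelope C κ := cofreeDisksEquiv N _ φ
  have hi : Function.Injective (Hom.lin i) := injective_cofreeDisksEquiv N _ hφ
  let k := subLift _ (isSub_range i) i fun x => ⟨x, rfl⟩
  have : IsIso k := isIso_of_bijective k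
    ⟨fun x y hxy => hi (congrArg Subtype.val hxy), fun ⟨y, x, hx⟩ => ⟨x, Subtype.ext hx⟩⟩
  exact ⟨⟨_, isSub_range i⟩, ⟨@asIso _ _ _ _ k this⟩⟩

/-- The morphisms of a class between the objects of the skeleton. -/
def generating (W : MorphismProperty (DGComod C)) (κ : Cardinal.{u}) :
    MorphismProperty (DGComod C) :=
  MorphismProperty.ofHoms (ι := Σ S T, {f : skeleton C κ S ⟶ skeleton C κ T // W f})
    fun x => x.2.2.1

instance (W : MorphismProperty (DGComod C)) (κ : Cardinal.{u}) :
    MorphismProperty.IsSmall.{u} (generating W κ) := by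
  unfold generating
  infer_instance

theorem generating_le (W : MorphismProperty (DGComod C)) (κ : Cardinal.{u}) :
    generating W κ ≤ W := by
  rintro _ _ _ ⟨x⟩
  exact x.2.2.2

theorem hasLiftingProperty_of_rlp_generating {W : MorphismProperty (DGComod C)} [W.RespectsIso]
    {κ : Cardinal.{u}} {E B : DGComod C} {p : E ⟶ B} (hp : (generating W κ).rlp p)
    {X Y : DGComod C} (f : X ⟶ Y) (hf : W f) (hX : #X.carrier ≤ κ) (hY : #Y.carrier ≤ κ) :
    HasLiftingProperty f p := by
  obtain ⟨S, ⟨eX⟩⟩ := exists_iso_skeleton X hX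
  obtain ⟨T, ⟨eY⟩⟩ := exists_iso_skeleton Y hY
  have e : Arrow.mk f ≅ Arrow.mk (eX.inv ≫ f ≫ eY.hom) :=
    Arrow.isoMk eX eY (by simp)
  have := hp _ (MorphismProperty.ofHoms.mk (⟨S, T, _, (W.arrow_mk_iso_iff e).1 hf⟩ :
    Σ S T, {f : skeleton C κ S ⟶ skeleton C κ T // W f}))
  exact HasLiftingProperty.of_arrow_iso_left e.symm p

/-- A missing element lies in a countable subcomodule `T`, and passing from `S` to `S + T` is a
pushout of a monomorphism between countable comodules. -/
theorem rlp_generating_monomorphisms {κ : Cardinal.{u}} (hκ : ℵ₀ ≤ κ) :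
    (generating (MorphismProperty.monomorphisms (DGComod C)) κ).rlp =
      (MorphismProperty.monomorphisms (DGComod C)).rlp := by
  refine le_antisymm (fun E B p hp => ?_) (MorphismProperty.antitone_rlp (generating_le _ _))
  intro X Y i hi
  refine hasLiftingProperty_of_step i ((monomorphisms_iff i).1 hi) p (fun _ => True)
    (fun _ _ _ _ => trivial) trivial fun S hS _ hne => ?_
  obtain ⟨y, -, hy⟩ := SetLike.exists_of_lt (lt_top_iff_ne_top.2 hne)
  -- With no extra operations the closure is countable.
  obtain ⟨T, hT, hyT, -, hcard⟩ := exists_closed_isSub Y (fun _ => PEmpty) (fun n k => k.elim) y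
  have hT' : #T ≤ κ := hcard.trans (max_le hκ (by simp))
  have := hasLiftingProperty_of_rlp_generating hp (subIncl (hS.inf hT) hT inf_le_right)
    ((monomorphisms_iff _).2 (injective_subIncl _ _ _))
    ((Cardinal.mk_le_mk_of_subset (inf_le_right : S ⊓ T ≤ T)).trans hT') hT'
  exact ⟨S ⊔ T, hS.sup hT, lt_of_le_of_ne le_sup_left fun h =>
    hy (h ▸ Submodule.mem_sup_right hyT), trivial, hasLiftingProperty_subIncl_sup hS hT p⟩

end Generating

/-! ### Generating sets of trivial cofibrations. -/

section RelAcyclic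

variable (η) in
/-- The quotient of `t^!Y` by the image of `t^!S` is acyclic. -/
def RelAcyclic (Y : DGComod C) (S : Submodule ℚ Y.carrier) : Prop :=
  ∀ z, extD (universalTwist C η) Y z ∈ tensorSub (cobar C η).carrier S →
    ∃ w, z - extD (universalTwist C η) Y w ∈ tensorSub (cobar C η).carrier S

theorem tEquivalences_iff_relAcyclic {X Y : DGComod C} {i : X ⟶ Y}
    (hi : Function.Injective (Hom.lin i)) :
    tEquivalences C η i ↔ RelAcyclic η Y (LinearMap.range (Hom.lin i)) := by
  refine (DGMod.quasiIso_iff _).trans ?_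
  rw [QIso.iff_of_injective (DGMod.Hom.map_d _) (DGVect.d_d _) (extFunctor_map_injective hi)]
  have e : LinearMap.range (DGMod.Hom.linQ ((tShriek C η).map i)) =
      tensorSub (cobar C η).carrier (LinearMap.range (Hom.lin i)) := range_lTensor (Hom.lin i)
  rw [e]
  rfl

theorem lTensor_extD {X Y : DGComod C} (f : X ⟶ Y) (z : (cobar C η).carrier ⊗[ℚ] X.carrier) :
    (Hom.lin f).lTensor (cobar C η).carrier (extD (universalTwist C η) X z) =
      extD (universalTwist C η) Y ((Hom.lin f).lTensor (cobar C η).carrier z) :=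
  DGMod.Hom.map_d ((tShriek C η).map f) z

theorem extD_mem_tensorSub {Y : DGComod C} {S : Submodule ℚ Y.carrier} (hS : Y.IsSub S)
    {z : (cobar C η).carrier ⊗[ℚ] Y.carrier} (hz : z ∈ tensorSub (cobar C η).carrier S) :
    extD (universalTwist C η) Y z ∈ tensorSub (cobar C η).carrier S := by
  obtain ⟨z, rfl⟩ := hz
  exact ⟨_, lTensor_extD (subι S hS) z⟩

/-- The hypothesis is acyclicity of `t^! T` modulo `t^! S`, written inside `t^! Y` so that it can be
produced by a closure argument there. -/
theorem tEquivalences_subIncl {Y : DGComod C} {S T : Submodule ℚ Y.carrier} (hS : Y.IsSub S)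
    (hT : Y.IsSub T) (h : S ≤ T)
    (hST : ∀ z ∈ tensorSub (cobar C η).carrier T,
      extD (universalTwist C η) Y z ∈ tensorSub (cobar C η).carrier S →
      ∃ w ∈ tensorSub (cobar C η).carrier T,
        z - extD (universalTwist C η) Y w ∈ tensorSub (cobar C η).carrier S) :
    tEquivalences C η (subIncl hS hT h) := by
  rw [tEquivalences_iff_relAcyclic (injective_subIncl hS hT h)]
  have e : ∀ z : (cobar C η).carrier ⊗[ℚ] (Y.sub T hT).carrier,
      z ∈ tensorSub (cobar C η).carrier (LinearMap.range (Hom.lin (subIncl hS hT h))) ↔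
      (Hom.lin (subι T hT)).lTensor (cobar C η).carrier z ∈ tensorSub (cobar C η).carrier S := by
    intro z
    have e1 : LinearMap.range (Hom.lin (subIncl hS hT h)) = S.comap (Hom.lin (subι T hT)) := by
      ext x
      exact ⟨fun ⟨a, ha⟩ => ha ▸ a.2, fun hx => ⟨(⟨x.1, hx⟩ : S), rfl⟩⟩
    rw [e1, tensorSub_comap]
    rfl
  intro z hz
  rw [e, lTensor_extD] at hz
  obtain ⟨_, ⟨w, rfl⟩, hw⟩ := hST _ ⟨z, rfl⟩ hz
  let w' : (cobar C η).carrier ⊗[ℚ] (Y.sub T hT).carrier := w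
  refine ⟨w', ?_⟩
  rw [e, map_sub, lTensor_extD]
  exact hw

/-- If the quotients of `Y` and of `S + T` by `S` become acyclic under `t^!`, so does that of `Y` by
`S + T`. Subtracting from `z` a `w` supported on `T` makes it a cycle modulo `S`. -/
theorem RelAcyclic.sup {Y : DGComod C} {S T : Submodule ℚ Y.carrier} (hS : Y.IsSub S)
    (h : RelAcyclic η Y S)
    (hST : ∀ z ∈ tensorSub (cobar C η).carrier T,
      extD (universalTwist C η) Y z ∈ tensorSub (cobar C η).carrier S →
      ∃ w ∈ tensorSub (cobar C η).carrier T,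
        z - extD (universalTwist C η) Y w ∈ tensorSub (cobar C η).carrier S) :
    RelAcyclic η Y (S ⊔ T) := by
  intro z hz
  rw [tensorSub_sup] at hz ⊢
  obtain ⟨s, hs, t, ht, hst⟩ := Submodule.mem_sup.1 hz
  have h1 : extD (universalTwist C η) Y t = - extD (universalTwist C η) Y s := by
    have := congrArg (extD (universalTwist C η) Y) hst
    rw [map_add, extD_extD] at this
    exact eq_neg_of_add_eq_zero_right this
  obtain ⟨w, hw, hw'⟩ := hST t ht (h1 ▸ neg_mem (extD_mem_tensorSub hS hs))
  obtain ⟨v, hv⟩ := h (z - w) (by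
    rw [map_sub, ← hst, add_sub_assoc]
    exact add_mem hs hw')
  refine ⟨v, ?_⟩
  rw [show z - extD (universalTwist C η) Y v = (z - w - extD (universalTwist C η) Y v) + w by abel]
  exact add_mem (Submodule.mem_sup_left hv) (Submodule.mem_sup_right hw)

/-- The boundary of a given `z` lies over one member of the chain, where a solution exists. -/
theorem RelAcyclic.sSup {Y : DGComod C} {c : Set (Submodule ℚ Y.carrier)} (hne : c.Nonempty)
    (hc : IsChain (· ≤ ·) c) (h : ∀ S ∈ c, RelAcyclic η Y S) : RelAcyclic η Y (sSup c) := by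
  intro z hz
  have : Nonempty c := hne.to_subtype
  rw [sSup_eq_iSup'] at hz ⊢
  obtain ⟨S, hS⟩ := mem_tensorSub_iSup_of_directed hc.directed hz
  obtain ⟨w, hw⟩ := h S.1 S.2 z hS
  exact ⟨w, tensorSub_mono (le_iSup (fun S : c => S.1) S) hw⟩

open Cardinal in
-- A Löwenheim–Skolem argument: choose a solution `w` for each `z` and close up under the vectors
-- occurring in it, so that relative cycles over `T` are solved over `T`.
theorem RelAcyclic.exists_isSub {Y : DGComod C} {S : Submodule ℚ Y.carrier}
    (h : RelAcyclic η Y S) (y : Y.carrier) :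
    ∃ T, Y.IsSub T ∧ y ∈ T ∧ #T ≤ max ℵ₀ #(cobar C η).carrier ∧
      ∀ z ∈ tensorSub (cobar C η).carrier T,
        extD (universalTwist C η) Y z ∈ tensorSub (cobar C η).carrier S →
        ∃ w ∈ tensorSub (cobar C η).carrier T,
          z - extD (universalTwist C η) Y w ∈ tensorSub (cobar C η).carrier S := by
  have h' : ∀ z, ∃ (e : ℕ → Y.carrier) (w : (cobar C η).carrier ⊗[ℚ] Y.carrier),
      w ∈ tensorSub (cobar C η).carrier (Submodule.span ℚ (Set.range e)) ∧
      (extD (universalTwist C η) Y z ∈ tensorSub (cobar C η).carrier S →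
        z - extD (universalTwist C η) Y w ∈ tensorSub (cobar C η).carrier S) := by
    intro z
    by_cases hz : extD (universalTwist C η) Y z ∈ tensorSub (cobar C η).carrier S
    · obtain ⟨w, hw⟩ := h z hz
      obtain ⟨e, he⟩ := exists_mem_tensorSub_range w
      exact ⟨e, w, he, fun _ => hw⟩
    · exact ⟨0, 0, zero_mem _, fun hz' => absurd hz' hz⟩
  choose e w hw hw' using h'
  obtain ⟨T, hT, hyT, hcl, hcard⟩ := exists_closed_isSub Y
    -- The operation with parameters `(a, m)` sends vectors `x i` to the `m`-th vector needed for
    -- the chosen solution at `∑ a i ⊗ x i`.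
    (fun n => (Fin n → (cobar C η).carrier) × ULift.{u} ℕ)
    (fun n k x => e (∑ i, k.1 i ⊗ₜ x i) k.2.down) y
  refine ⟨T, hT, hyT, hcard.trans (max_le (le_max_left _ _) (mk_list_prod_le _)), ?_⟩
  intro z hz hzS
  obtain ⟨n, a, x, hx, rfl⟩ := exists_sum_tmul_of_mem_tensorSub hz
  refine ⟨_, tensorSub_mono (Submodule.span_le.2 ?_) (hw _), hw' _ hzS⟩
  rintro _ ⟨m, rfl⟩
  exact hcl n (a, ⟨m⟩) x hx

open Cardinal in
-- As for monomorphisms, but `T` is chosen so that `S ∩ T → T` is a `t`-equivalence, and acyclicity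
-- relative to the current domain is maintained through the induction.
theorem rlp_generating_trivCof :
    (generating (trivCof C η) (max ℵ₀ #(cobar C η).carrier)).rlp = (trivCof C η).rlp := by
  refine le_antisymm (fun E B p hp => ?_) (MorphismProperty.antitone_rlp (generating_le _ _))
  intro X Y i hi
  have hi' := (monomorphisms_iff i).1 hi.1
  refine hasLiftingProperty_of_step i hi' p (RelAcyclic η Y) (fun c hne hc h => .sSup hne hc h)
    ((tEquivalences_iff_relAcyclic hi').1 hi.2) fun S hS hSY hne => ?_
  obtain ⟨y, -, hy⟩ := SetLike.exists_of_lt (lt_top_iff_ne_top.2 hne)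
  obtain ⟨T, hT, hyT, hcard, hST⟩ := hSY.exists_isSub y
  have := hasLiftingProperty_of_rlp_generating hp (subIncl (hS.inf hT) hT inf_le_right)
    ⟨(monomorphisms_iff _).2 (injective_subIncl _ _ _),
      tEquivalences_subIncl _ _ _ fun z hz hzS => by
        rw [tensorSub_inf] at hzS
        obtain ⟨w, hw, hw'⟩ := hST z hz hzS.1
        refine ⟨w, hw, ?_⟩
        rw [tensorSub_inf]
        exact ⟨hw', sub_mem hz (extD_mem_tensorSub hT hw)⟩⟩
    ((Cardinal.mk_le_mk_of_subset (inf_le_right : S ⊓ T ≤ T)).trans hcard) hcard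
  exact ⟨S ⊔ T, hS.sup hT, lt_of_le_of_ne le_sup_left fun h =>
    hy (h ▸ Submodule.mem_sup_right hyT), hSY.sup hS hST, hasLiftingProperty_subIncl_sup hS hT p⟩

end RelAcyclic

end DGComod

open Limits

namespace DGComod

variable {C : DGCoalg.{u}} {η : Coaugmentation C}

/-! ### Local presentability. -/

section Presentable

variable {J : Type u} [SmallCategory J] {F : J ⥤ DGComod C} {c : Cocone F}

/-- Filtered colimits of comodules are computed on underlying sets: `forget C` is a left adjoint,
and filtered colimits of vector spaces are computed there. -/
instance (J : Type u) [SmallCategory J] [IsFiltered J] :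
    PreservesColimitsOfShape J (forget C ⋙ CategoryTheory.forget (ModuleCat.{u} ℚ)) := by
  have : PreservesColimitsOfShape J (forget C) :=
    (forgetAdj C).leftAdjoint_preservesColimits.preservesColimitsOfShape
  exact inferInstanceAs (PreservesColimitsOfShape J (forget C ⋙
    forget₂ (ModuleCat.{u} ℚ) AddCommGrpCat.{u} ⋙ CategoryTheory.forget AddCommGrpCat.{u}))

theorem exists_map_eq_zero [IsFiltered J] (hc : IsColimit c) {j : J} (x : (F.obj j).carrier)
    (hx : Hom.lin (c.ι.app j) x = 0) : ∃ (k : J) (a : j ⟶ k), Hom.lin (F.map a) x = 0 := by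
  have h := isColimitOfPreserves (forget C ⋙ CategoryTheory.forget (ModuleCat.{u} ℚ)) hc
  obtain ⟨k, a, hk⟩ := (Types.FilteredColimit.isColimit_eq_iff' h (i := j) x
    (0 : (F.obj j).carrier)).1 (hx.trans (map_zero (Hom.lin (c.ι.app j))).symm)
  exact ⟨k, a, hk.trans (map_zero (Hom.lin (F.map a)))⟩

theorem exists_preimage [IsFiltered J] (hc : IsColimit c) (x : c.pt.carrier) :
    ∃ (j : J) (y : (F.obj j).carrier), Hom.lin (c.ι.app j) y = x :=
  Types.jointly_surjective_of_isColimit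
    (isColimitOfPreserves (forget C ⋙ CategoryTheory.forget (ModuleCat.{u} ℚ)) hc) x

theorem exists_map_eq_zero_of_hasCardinalLT {κ : Cardinal.{u}} [Fact κ.IsRegular]
    [IsCardinalFiltered J κ] (hc : IsColimit c) {j : J} {K : Type u} (hK : HasCardinalLT K κ)
    (x : K → (F.obj j).carrier) (hx : ∀ i, Hom.lin (c.ι.app j) (x i) = 0) :
    ∃ (k : J) (a : j ⟶ k), ∀ i, Hom.lin (F.map a) (x i) = 0 := by
  have := isFiltered_of_isCardinalFiltered J κ
  choose k a ha using fun i => exists_map_eq_zero hc (x i) (hx i)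
  obtain ⟨m, b, e, h⟩ := IsCardinalFiltered.wideSpan a hK
  refine ⟨m, e, fun i => ?_⟩
  rw [← h i, Functor.map_comp, comp_lin, LinearMap.comp_apply, ha, map_zero]

/-- Preimages of the values on a basis are moved to a common stage, which exists because `X` has
fewer than `κ` elements. -/
theorem exists_linear_factorization {κ : Cardinal.{u}} [Fact κ.IsRegular]
    [IsCardinalFiltered J κ] (hc : IsColimit c) {X : DGComod C} (hX : HasCardinalLT X.carrier κ)
    (f : X.carrier →ₗ[ℚ] c.pt.carrier) :
    ∃ (j : J) (g : X.carrier →ₗ[ℚ] (F.obj j).carrier), Hom.lin (c.ι.app j) ∘ₗ g = f := by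
  have := isFiltered_of_isCardinalFiltered J κ
  choose j y hy using fun x => exists_preimage hc (f x)
  let b := Module.Basis.ofVectorSpace ℚ X.carrier
  refine ⟨IsCardinalFiltered.max j hX, b.constr ℚ fun i =>
    Hom.lin (F.map (IsCardinalFiltered.toMax j hX (b i))) (y (b i)), b.ext fun i => ?_⟩
  rw [LinearMap.comp_apply, b.constr_basis, ← hy, ← c.w (IsCardinalFiltered.toMax j hX (b i))]
  rfl

/-- A linear factorization fails to be a morphism by fewer than `κ` defects, all vanishing in the
colimit, so at a later stage it is a morphism. -/
theorem exists_factorization {κ : Cardinal.{u}} [Fact κ.IsRegular] (hκ : Cardinal.aleph0 < κ)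
    [IsCardinalFiltered J κ] (hc : IsColimit c) {X : DGComod C} (hX : HasCardinalLT X.carrier κ)
    (f : X ⟶ c.pt) : ∃ (j : J) (g : X ⟶ F.obj j), g ≫ c.ι.app j = f := by
  obtain ⟨j, g, hg⟩ := exists_linear_factorization hc hX (Hom.lin f)
  have hg' : ∀ x, Hom.lin (c.ι.app j) (g x) = Hom.lin f x := LinearMap.congr_fun hg
  have h1 : ∀ x, ∃ e : ℕ → LinearMap.ker (Hom.lin (c.ι.app j)),
      (F.obj j).coact (g x) - g.lTensor C.carrier (X.coact x) ∈
        tensorSub C.carrier (Submodule.span ℚ (Set.range fun n => (e n).1)) := by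
    intro x
    have hx : (F.obj j).coact (g x) - g.lTensor C.carrier (X.coact x) ∈
        tensorSub C.carrier (LinearMap.ker (Hom.lin (c.ι.app j))) := by
      rw [tensorSub_ker, LinearMap.mem_ker, map_sub, ← Hom.map_coact, hg', Hom.map_coact,
        ← LinearMap.lTensor_comp_apply, hg, sub_self]
    obtain ⟨z, hz⟩ := hx
    obtain ⟨e, he⟩ := exists_mem_tensorSub_range z
    refine ⟨e, hz ▸ lTensor_mem_tensorSub (fun y hy => ?_) he⟩
    have h2 := Submodule.apply_mem_span_image_of_mem_span
      (LinearMap.ker (Hom.lin (c.ι.app j))).subtype hy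
    rwa [← Set.range_comp] at h2
  choose e he using h1
  -- The defects against the differential and the projections, and vectors of the kernel supporting
  -- the coaction defect. There are countably many for each `x`; uncountability of `κ` keeps their
  -- total below `κ`.
  let D : X.carrier × Option (ℤ ⊕ ℕ) → (F.obj j).carrier
    | (x, none) => g (X.d x) - (F.obj j).d (g x)
    | (x, some (Sum.inl n)) => g (X.proj n x) - (F.obj j).proj n (g x)
    | (x, some (Sum.inr n)) => e x n
  have hD : ∀ i, Hom.lin (c.ι.app j) (D i) = 0 := by
    rintro ⟨x, _ | n | n⟩
    · change Hom.lin (c.ι.app j) (_ - _) = 0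
      rw [map_sub, hg', Hom.map_d, Hom.map_d, hg']
      exact sub_self _
    · change Hom.lin (c.ι.app j) (_ - _) = 0
      rw [map_sub, hg', DGVect.map_proj₀ (V := X.toDGVect) (Hom.map_mem f),
        DGVect.map_proj₀ (V := (F.obj j).toDGVect) (Hom.map_mem (c.ι.app j)), hg']
      exact sub_self _
    · exact (e x n).2
  have hcount : HasCardinalLT (Option (ℤ ⊕ ℕ)) κ := by
    have h2 : Cardinal.lift.{u} (Cardinal.mk (Option (ℤ ⊕ ℕ))) ≤ Cardinal.aleph0 := by simp
    have h3 : Cardinal.lift.{u} (Cardinal.mk (Option (ℤ ⊕ ℕ))) < κ := h2.trans_lt hκ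
    simpa [HasCardinalLT] using h3
  obtain ⟨k, a, ha⟩ := exists_map_eq_zero_of_hasCardinalLT hc (κ := κ)
    (hasCardinalLT_prod hκ.le hX hcount) D hD
  let φ := F.map a
  have hd : ∀ x, Hom.lin φ (g (X.d x)) = (F.obj k).d (Hom.lin φ (g x)) := fun x => by
    have h2 : Hom.lin φ (g (X.d x) - (F.obj j).d (g x)) = 0 := ha (x, none)
    rw [map_sub, sub_eq_zero] at h2
    rw [h2, Hom.map_d]
  have hp : ∀ n x, Hom.lin φ (g (X.proj n x)) = (F.obj k).proj n (Hom.lin φ (g x)) := fun n x => by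
    have h2 : Hom.lin φ (g (X.proj n x) - (F.obj j).proj n (g x)) = 0 := ha (x, some (Sum.inl n))
    rw [map_sub, sub_eq_zero] at h2
    rw [h2, DGVect.map_proj₀ (V := (F.obj j).toDGVect) (Hom.map_mem φ)]
  have hco : ∀ x, (F.obj k).coact (Hom.lin φ (g x)) =
      (Hom.lin φ ∘ₗ g).lTensor C.carrier (X.coact x) := fun x => by
    have h2 : tensorSub C.carrier (Submodule.span ℚ (Set.range fun n => (e x n).1)) ≤
        tensorSub C.carrier (LinearMap.ker (Hom.lin φ)) := by
      refine tensorSub_mono (Submodule.span_le.2 ?_)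
      rintro _ ⟨n, rfl⟩
      exact ha (x, some (Sum.inr n))
    have h3 := h2 (he x)
    rw [tensorSub_ker, LinearMap.mem_ker, map_sub, sub_eq_zero, ← Hom.map_coact] at h3
    rw [h3, LinearMap.lTensor_comp_apply]
  let g' : X ⟶ F.obj k :=
    { lin := Hom.lin φ ∘ₗ g
      map_mem := DGVect.mem_gr_of_commutes (V := X.toDGVect) (W := (F.obj k).toDGVect) hp
      map_d := hd
      map_coact := hco }
  refine ⟨k, g', DGComod.hom_ext fun x => ?_⟩
  rw [← hg', ← c.w a]
  rfl

theorem isCardinalPresentable_of_hasCardinalLT {κ : Cardinal.{u}} [Fact κ.IsRegular]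
    (hκ : Cardinal.aleph0 < κ) (X : DGComod C) (hX : HasCardinalLT X.carrier κ) :
    IsCardinalPresentable X κ where
  preservesColimitOfShape J _ _ := ⟨fun {F} => ⟨fun {c} hc => ⟨by
    have := isFiltered_of_isCardinalFiltered J κ
    refine Types.FilteredColimit.isColimitOf' _ _ (fun f => ?_) (fun j f g h => ?_)
    · obtain ⟨j, g, hg⟩ := exists_factorization hκ hc hX f
      exact ⟨j, g, hg.symm⟩
    · have h' : (show X ⟶ F.obj j from f) ≫ c.ι.app j = (show X ⟶ F.obj j from g) ≫ c.ι.app j := h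
      obtain ⟨k, a, ha⟩ := exists_map_eq_zero_of_hasCardinalLT hc hX
        (fun x => Hom.lin (show X ⟶ F.obj j from f) x - Hom.lin (show X ⟶ F.obj j from g) x)
        (fun x => by
          rw [map_sub, sub_eq_zero]
          exact LinearMap.congr_fun (congrArg Hom.lin h') x)
      refine ⟨k, a, DGComod.hom_ext fun x => ?_⟩
      have := ha x
      rw [map_sub, sub_eq_zero] at this
      exact this⟩⟩⟩

/-- Every element lies in a countable subcomodule, so maps from countable comodules detect equality
of morphisms and surjectivity of monomorphisms. -/
theorem isStrongGenerator_skeleton :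
    (ObjectProperty.ofObj (skeleton C Cardinal.aleph0)).IsStrongGenerator := by
  have key : ∀ (N : DGComod C) (y : N.carrier), ∃ S, ∃ h : skeleton C Cardinal.aleph0 S ⟶ N,
      y ∈ LinearMap.range (Hom.lin h) := by
    intro N y
    obtain ⟨T, hT, hyT, -, hcard⟩ := exists_closed_isSub N (fun _ => PEmpty) (fun n k => k.elim) y
    obtain ⟨S, ⟨e⟩⟩ := exists_iso_skeleton (κ := Cardinal.aleph0) (N.sub T hT)
      (hcard.trans (by simp))
    refine ⟨S, e.inv ≫ subι T hT, Hom.lin e.hom (⟨y, hyT⟩ : T), ?_⟩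
    have h := LinearMap.congr_fun (congrArg Hom.lin e.hom_inv_id) (⟨y, hyT⟩ : T)
    exact congrArg (Hom.lin (subι T hT)) h
  rw [ObjectProperty.isStrongGenerator_iff]
  refine ⟨fun X Y f g hfg => DGComod.hom_ext fun x => ?_, fun X Y i hi h => ?_⟩
  · obtain ⟨S, k, z, rfl⟩ := key X x
    exact LinearMap.congr_fun (congrArg Hom.lin (hfg _ ⟨S⟩ k)) z
  · refine isIso_of_bijective i ⟨(mono_iff_injective i).1 hi, fun y => ?_⟩
    obtain ⟨S, k, z, rfl⟩ := key Y y
    obtain ⟨f, hf⟩ := h _ ⟨S⟩ k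
    exact ⟨Hom.lin f z, LinearMap.congr_fun (congrArg Hom.lin hf) z⟩

instance : IsLocallyPresentable.{u} (DGComod C) := by
  obtain ⟨κ, hκ, hX⟩ :=
    -- The summand `ℕ` makes `κ` uncountable; the other summand bounds all objects of the skeleton,
    -- which are subcomodules of the envelope.
    HasCardinalLT.exists_regular_cardinal.{u} ((envelope C Cardinal.aleph0).carrier ⊕ ℕ)
  rw [hasCardinalLT_sum_iff _ _ _ hκ.aleph0_le] at hX
  have : Fact κ.IsRegular := ⟨hκ⟩
  refine ⟨κ, this, (IsCardinalLocallyPresentable.iff_exists_isStrongGenerator _ _).2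
    ⟨_, inferInstance, isStrongGenerator_skeleton, ?_⟩⟩
  rintro _ ⟨S⟩
  exact isCardinalPresentable_of_hasCardinalLT (by simpa [HasCardinalLT] using hX.2) _
    (hX.1.of_injective _ (Subtype.val_injective (p := (· ∈ S.1))))

end Presentable

theorem isCombinatorial (hη : η.IsConnected) :
    let := modelCategory η hη
    IsCombinatorial.{u} (DGComod C) := by
  let := modelCategory η hη
  exact ⟨inferInstance, _, _, inferInstance, inferInstance,
    (rlp_trivCof_inf_tEquivalences (η := η)).trans (rlp_generating_monomorphisms le_rfl).symm,
    rlp_generating_trivCof.symm⟩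

end DGComod

end

end DGKoszul

theorem mainTheorem6 (C : DGKoszul.DGCoalg.{u}) (hcocomm : C.IsCocommutative)
    (hred : C.IsTwoReduced) :
    ∃ (_ : ModelCategory (DGKoszul.DGMod (DGKoszul.cobar C hred.coaugmentation)))
      (_ : ModelCategory (DGKoszul.DGComod C)),
      DGKoszul.IsProjectiveModelStructure (DGKoszul.cobar C hred.coaugmentation) ∧
      DGKoszul.IsLeftInduced (DGKoszul.tShriek C hred.coaugmentation) ∧
      weakEquivalences (DGKoszul.DGComod C) = DGKoszul.tEquivalences C hred.coaugmentation ∧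
      cofibrations (DGKoszul.DGComod C) =
        MorphismProperty.monomorphisms (DGKoszul.DGComod C) ∧
      DGKoszul.IsCombinatorial.{u} (DGKoszul.DGComod C) ∧
      DGKoszul.IsQuillenEquivalence (DGKoszul.tAdj C hred.coaugmentation) := by
  -- `C₀ = ℚ` gives the connectedness on which the existence of primitive elements depends.
  have hη : hred.coaugmentation.IsConnected := hred.exists_e.choose_spec.2.2
  let m₁ := DGKoszul.DGMod.modelCategory _ hη
  let m₂ := DGKoszul.DGComod.modelCategory _ hη
  exact ⟨m₁, m₂, ⟨rfl, rfl⟩, DGKoszul.DGComod.isLeftInduced hη, rfl, rfl,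
    DGKoszul.DGComod.isCombinatorial hη, DGKoszul.DGComod.isQuillenEquivalence hη⟩
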